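/- Let $n\ge 1$ be an integer and $g>0$. Let $\mathbf e_1,\dots,\mathbf e_n$ be the standard basis of Euclidean space $\mathbb R^n$ with inner product $\langle\cdot,\cdot\rangle$, let $\boldsymbol E=\{\mathbf x\in\mathbb R^n : x_1+\cdots+x_n=0\}$ with its $(n-1)$-dimensional Lebesgue measure $d\mathbf x$, and put $\mathbf R=\{\mathbf e_j-\mathbf e_k: j\ne k\}$, $\mathbf R^+=\{\mathbf e_j-\mathbf e_k: j<k\}$, $\boldsymbol\alpha_j=\mathbf e_j-\mathbf e_{j+1}$ ($1\le j\le n-1$), $\boldsymbol\alpha_0=\mathbf e_1-\mathbf e_n$, $\boldsymbol\omega_j=\mathbf e_1+\cdots+\mathbf e_j-\frac jn(\mathbf e_1+\cdots+\mathbf e_n)$ and $\boldsymbol\rho=\boldsymbol\omega_1+\cdots+\boldsymbol\omega_{n-1}$. Define $$\boldsymbol C=\{\mathbf x\in\boldsymbol E:\langle\mathbf x,\boldsymbol\alpha_j\rangle>0,\ 1\le j\le n-1\},\qquad \boldsymbol A=\{\mathbf x\in\boldsymbol E:\langle\mathbf x,\boldsymbol\alpha_0\rangle\le 1,\ \langle\mathbf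 x,\boldsymbol\alpha_j\rangle\ge 0,\ 1\le j\le n-1\},$$ $$\mathcal P^{(\infty)}=\Bigl\{\sum_{j=1}^{n-1}k_j\boldsymbol\omega_j: k_j\in\mathbb Z_{\ge0}\Bigr\},\qquad \mathcal P^{(m)}=\Bigl\{\sum_{j=1}^{n-1}k_j\boldsymbol\omega_j: k_j\in\mathbb Z_{\ge0},\ \sum_j k_j\le m\Bigr\}\quad(m\ge1).$$ For a permutation $\sigma\in\mathcal S_n$ let $\boldsymbol\xi_\sigma=\sigma(\boldsymbol\xi)$ be the vector with permuted coordinates. *Lattice functions.* For $-1<t<1$ and $\boldsymbol\lambda\in\mathcal P^{(m)}$ let $$\Delta^{(m)}_{\boldsymbol\lambda}=\prod_{\boldsymbol\alpha\in\mathbf R^+,\ \langle\boldsymbol\lambda,\boldsymbol\alpha\rangle=0}\frac{1-t^{\langle\boldsymbol\rho,\boldsymbol\alpha\rangle}}{1-t^{1+\langle\boldsymbol\rho,\boldsymbol\alpha\rangle}}\prod_{\boldsymbol\alpha\in\mathbf R^+,\ \langle\boldsymbol\lambda,\boldsymbol\alpha\rangle=m}\frac{1-t^{n-\langle\boldsymbol\rho,\boldsymbol\alpha\rangle}}{1-t^{1+n-\langle\boldsymbol\rho,\boldsymbol\alpha\rangle}},$$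 $$\Psi_{\boldsymbol\lambda}(\boldsymbol\xi)=\sum_{\sigma\in\mathcal S_n}\Bigl(\prod_{\boldsymbol\alpha\in\mathbf R^+}\frac{1-t\,e^{-i\langle\boldsymbol\alpha,\boldsymbol\xi_\sigma\rangle}}{1-e^{-i\langle\boldsymbol\alpha,\boldsymbol\xi_\sigma\rangle}}\Bigr)e^{i\langle\boldsymbol\lambda,\boldsymbol\xi_\sigma\rangle}.$$ From now on $t=e^{-g/m}$. For $\mathbf x\in\boldsymbol C$ let $[\mathbf x]=\sum_{j=1}^{n-1}\lfloor\langle\mathbf x,\boldsymbol\alpha_j\rangle\rfloor\,\boldsymbol\omega_j$, and let the staircase embedding of $\Psi(\boldsymbol\xi)$ be $\Psi^{(m)}(\mathbf x,\boldsymbol\xi)=\sqrt{\Delta^{(m)}_{[m\mathbf x]}}\,\Psi_{[m\mathbf x]}(\boldsymbol\xi)$ if $[m\mathbf x]\in\mathcal P^{(m)}$ and $\Psi^{(m)}(\mathbf x,\boldsymbol\xi)=0$ otherwise. The lattice Bethe vector $\boldsymbol\xi^{(m)}_{\boldsymbol\mu}$ is the solution $\boldsymbol\xi\in\boldsymbol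 E$ of $$m\,\xi_j+\sum_{l\ne j}\theta(\xi_j-\xi_l)=2\pi(\boldsymbol\rho+\boldsymbol\mu)_j\quad(1\le j\le n),\qquad \theta(x)=(1-t^2)\int_0^x\frac{dy}{1-2t\cos y+t^2}.$$ *Lieb–Liniger functions.* Let $$\Psi^{(\infty)}(\mathbf x,\boldsymbol\xi)=\sum_{\sigma\in\mathcal S_n}\Bigl(\prod_{\boldsymbol\alpha\in\mathbf R^+}\frac{\langle\boldsymbol\alpha,\boldsymbol\xi_\sigma\rangle-ig}{\langle\boldsymbol\alpha,\boldsymbol\xi_\sigma\rangle}\Bigr)e^{i\langle\mathbf x,\boldsymbol\xi_\sigma\rangle}.$$ The Yang–Yang vector $\boldsymbol\xi^{(\infty)}_{\boldsymbol\mu}$ is the solution $\boldsymbol\xi\in\boldsymbol E$ of $\ \xi_j+\sum_{l\ne j}2\arctan\bigl(\frac{\xi_j-\xi_l}{g}\bigr)=2\pi(\boldsymbol\rho+\boldsymbol\mu)_j$, $1\le j\le n$. Then the following hold. 1. For all $m\ge1$ and $\boldsymbol\mu\in\mathcal P^{(m)}$ the vector $\boldsymbol\xi=\boldsymbol\xi^{(m)}_{\boldsymbol\mu}$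 exists and is unique; it satisfies $\langle\boldsymbol\xi,\boldsymbol\alpha_0\rangle<2\pi$ and $\langle\boldsymbol\xi,\boldsymbol\alpha_j\rangle>0$ for $1\le j\le n-1$, and it solves the Bethe system $$e^{im\langle\boldsymbol\beta,\boldsymbol\xi\rangle}=\Bigl(\frac{1-te^{i\langle\boldsymbol\beta,\boldsymbol\xi\rangle}}{e^{i\langle\boldsymbol\beta,\boldsymbol\xi\rangle}-t}\Bigr)^2\prod_{\boldsymbol\alpha\in\mathbf R,\ \langle\boldsymbol\alpha,\boldsymbol\beta\rangle=1}\frac{1-te^{i\langle\boldsymbol\alpha,\boldsymbol\xi\rangle}}{e^{i\langle\boldsymbol\alpha,\boldsymbol\xi\rangle}-t}\qquad\forall\boldsymbol\beta\in\mathbf R .$$ Moreover $\Psi^{(m)}(\cdot,\boldsymbol\xi^{(m)}_{\boldsymbol\mu})\in L^2(\boldsymbol C,d\mathbf x)$. 2. For all $\boldsymbol\mu\in\mathcal P^{(\infty)}$ the vector $\boldsymbol\xi=\boldsymbol\xi^{(\infty)}_{\boldsymbol\mu}$ exists and is unique; it lies in $\boldsymbol C$ and solves the Bethe system $$e^{i\langle\boldsymbol\beta,\boldsymbol\xi\rangle}=\Bigl(\frac{ig+\langle\boldsymbol\beta,\boldsymbol\xi\rangle}{ig-\langle\boldsymbol\beta,\boldsymbol\xi\rangle}\Bigr)^2\prod_{\boldsymbol\alpha\in\mathbf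 R,\ \langle\boldsymbol\alpha,\boldsymbol\beta\rangle=1}\frac{ig+\langle\boldsymbol\alpha,\boldsymbol\xi\rangle}{ig-\langle\boldsymbol\alpha,\boldsymbol\xi\rangle}\qquad\forall\boldsymbol\beta\in\mathbf R .$$ Moreover $\Psi^{(\infty)}(\cdot,\boldsymbol\xi^{(\infty)}_{\boldsymbol\mu})\in L^2(\boldsymbol A,d\mathbf x)$. 3. (Convergence of inner products.) For all $\boldsymbol\mu,\boldsymbol\mu'\in\mathcal P^{(\infty)}$, $$\lim_{m\to\infty}\int_{\boldsymbol C}\Psi^{(m)}(\mathbf x,\boldsymbol\xi^{(m)}_{\boldsymbol\mu})\,\overline{\Psi^{(m)}(\mathbf x,\boldsymbol\xi^{(m)}_{\boldsymbol\mu'})}\,d\mathbf x=\int_{\boldsymbol A}\Psi^{(\infty)}(\mathbf x,\boldsymbol\xi^{(\infty)}_{\boldsymbol\mu})\,\overline{\Psi^{(\infty)}(\mathbf x,\boldsymbol\xi^{(\infty)}_{\boldsymbol\mu'})}\,d\mathbf x .$$ 4. (Orthogonality.) For all $\boldsymbol\mu,\boldsymbol\mu'\in\mathcal P^{(\infty)}$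 the integral $\int_{\boldsymbol A}\Psi^{(\infty)}(\mathbf x,\boldsymbol\xi^{(\infty)}_{\boldsymbol\mu})\,\overline{\Psi^{(\infty)}(\mathbf x,\boldsymbol\xi^{(\infty)}_{\boldsymbol\mu'})}\,d\mathbf x$ is $0$ if $\boldsymbol\mu\ne\boldsymbol\mu'$, and a positive real number if $\boldsymbol\mu=\boldsymbol\mu'$. -/

import Mathlib

open MeasureTheory Filter Topology

noncomputable section

namespace BetheAlcove

/-- `ℝⁿ` with its Euclidean inner product. -/
abbrev V (n : ℕ) : Type := EuclideanSpace ℝ (Fin n)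

/-- The center-of-mass plane `E = {x ∈ ℝⁿ | x₁ + ⋯ + xₙ = 0}`. -/
def massPlane (n : ℕ) : Submodule ℝ (V n) where
  carrier := {x | ∑ i, x i = 0}
  add_mem' := by
    intro a b ha hb
    simp only [Set.mem_ofPred_eq, PiLp.add_apply, Finset.sum_add_distrib] at *
    rw [ha, hb, add_zero]
  zero_mem' := by simp
  smul_mem' := by
    intro c x hx
    simp only [Set.mem_ofPred_eq, PiLp.smul_apply, smul_eq_mul, ← Finset.mul_sum] at *
    rw [hx, mul_zero]

/-- The `(n-1)`-dimensional Lebesgue measure `dx` of the Euclidean space `E`, regarded as a measure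
on `ℝⁿ` carried by `E`: the Haar measure giving mass `1` to the unit cube spanned by an orthonormal
basis of `E`. -/
def planeVolume (n : ℕ) : Measure (V n) :=
  ((stdOrthonormalBasis ℝ (massPlane n)).toBasis.addHaar).map Subtype.val

/-- The vector `e_j - e_k`, for `p = (j, k)`. -/
def root {n : ℕ} (p : Fin n × Fin n) : V n :=
  EuclideanSpace.single p.1 (1 : ℝ) - EuclideanSpace.single p.2 (1 : ℝ)

/-- The index set of the roots `R = {e_j - e_k | j ≠ k}` (the map `root` is injective on it). -/
def roots (n : ℕ) : Finset (Fin n × Fin n) := Finset.univ.filter fun p => p.1 ≠ p.2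

/-- The index set of the positive roots `R⁺ = {e_j - e_k | j < k}`. -/
def posRoots (n : ℕ) : Finset (Fin n × Fin n) := Finset.univ.filter fun p => p.1 < p.2

/-- The height `⟨ρ, e_j - e_k⟩ = k - j` of a positive root. -/
def height {n : ℕ} (p : Fin n × Fin n) : ℕ := p.2.val - p.1.val

/-- The standard basis vector `e_j`, numbered from `1` to `n`. -/
def basisVec (n j : ℕ) : V n := WithLp.toLp 2 fun i => if i.val + 1 = j then 1 else 0

/-- The simple root `α_j = e_j - e_{j+1}`, for `1 ≤ j ≤ n - 1`. -/
def simpleRoot (n j : ℕ) : V n := basisVec n j - basisVec n (j + 1)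

/-- The root `α₀ = e₁ - eₙ`. -/
def highestRoot (n : ℕ) : V n := basisVec n 1 - basisVec n n

/-- The fundamental weight `ω_j = e₁ + ⋯ + e_j - (j/n)(e₁ + ⋯ + eₙ)`, for `1 ≤ j ≤ n - 1`. -/
def fundWeight (n j : ℕ) : V n :=
  ∑ i ∈ Finset.Icc 1 j, basisVec n i - ((j : ℝ) / n) • ∑ i ∈ Finset.Icc 1 n, basisVec n i

/-- `ρ = ω₁ + ⋯ + ω_{n-1}`, half the sum of the positive roots. -/
def rho (n : ℕ) : V n := ∑ j ∈ Finset.Icc 1 (n - 1), fundWeight n j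

/-- The open chamber `C = {x ∈ E | ⟨x, α_j⟩ > 0, j = 1, …, n - 1}`. -/
def chamber (n : ℕ) : Set (V n) :=
  {x | x ∈ massPlane n ∧ ∀ j ∈ Finset.Icc 1 (n - 1), 0 < inner ℝ x (simpleRoot n j)}

/-- The alcove `A = {x ∈ E | ⟨x, α₀⟩ ≤ 1, ⟨x, α_j⟩ ≥ 0, j = 1, …, n - 1}`. -/
def alcove (n : ℕ) : Set (V n) :=
  {x | x ∈ massPlane n ∧ inner ℝ x (highestRoot n) ≤ 1 ∧
    ∀ j ∈ Finset.Icc 1 (n - 1), 0 ≤ inner ℝ x (simpleRoot n j)}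

/-- `2π Int(A) = {x ∈ E | ⟨x, α₀⟩ < 2π, ⟨x, α_j⟩ > 0, j = 1, …, n - 1}`. -/
def openAlcoveTwoPi (n : ℕ) : Set (V n) :=
  {x | x ∈ chamber n ∧ inner ℝ x (highestRoot n) < 2 * Real.pi}

/-- The cone of dominant weights
`P^(∞) = {k₁ω₁ + ⋯ + k_{n-1}ω_{n-1} | k_j ∈ ℤ_{≥0}}`. -/
def dominantWeights (n : ℕ) : Set (V n) :=
  {μ | ∃ k : ℕ → ℕ, μ = ∑ j ∈ Finset.Icc 1 (n - 1), (k j : ℝ) • fundWeight n j}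

/-- The finite grid
`P^(m) = {k₁ω₁ + ⋯ + k_{n-1}ω_{n-1} | k_j ∈ ℤ_{≥0}, k₁ + ⋯ + k_{n-1} ≤ m}`. -/
def latticeAlcove (n m : ℕ) : Set (V n) :=
  {μ | ∃ k : ℕ → ℕ, ∑ j ∈ Finset.Icc 1 (n - 1), k j ≤ m ∧
    μ = ∑ j ∈ Finset.Icc 1 (n - 1), (k j : ℝ) • fundWeight n j}

/-- The action of a permutation on `ℝⁿ`, `σ(e_i) = e_{σ i}`. -/
def permute {n : ℕ} (σ : Equiv.Perm (Fin n)) (ξ : V n) : V n :=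
  WithLp.toLp 2 fun i => ξ (σ.symm i)

/-! ### The lattice model -/

/-- The weight function `Δ^(m)_λ` of the lattice Hilbert space. -/
def latticeWeight (n m : ℕ) (t : ℝ) (lam : V n) : ℝ :=
  (∏ p ∈ (posRoots n).filter (fun p => inner ℝ lam (root p) = (0 : ℝ)),
      (1 - t ^ height p) / (1 - t ^ (1 + height p))) *
    ∏ p ∈ (posRoots n).filter (fun p => inner ℝ lam (root p) = (m : ℝ)),
      (1 - t ^ (n - height p)) / (1 - t ^ (1 + n - height p))

/-- The lattice Bethe wave function (Hall–Littlewood polynomial)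
`Ψ_λ(ξ) = ∑_σ ∏_{α ∈ R⁺} (1 - t e^{-i⟨α, ξ_σ⟩}) / (1 - e^{-i⟨α, ξ_σ⟩}) e^{i⟨λ, ξ_σ⟩}`. -/
def hallLittlewood (n : ℕ) (t : ℝ) (lam ξ : V n) : ℂ :=
  ∑ σ : Equiv.Perm (Fin n),
    (∏ p ∈ posRoots n,
      (1 - (t : ℂ) * Complex.exp (-(Complex.I * ((inner ℝ (root p) (permute σ ξ) : ℝ) : ℂ)))) /
        (1 - Complex.exp (-(Complex.I * ((inner ℝ (root p) (permute σ ξ) : ℝ) : ℂ))))) *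
      Complex.exp (Complex.I * ((inner ℝ lam (permute σ ξ) : ℝ) : ℂ))

/-- The integral part `[x] = [⟨x, α₁⟩] ω₁ + ⋯ + [⟨x, α_{n-1}⟩] ω_{n-1}` of a vector `x` in the
closure of the chamber. -/
def intPart (n : ℕ) (x : V n) : V n :=
  ∑ j ∈ Finset.Icc 1 (n - 1), (⌊(inner ℝ x (simpleRoot n j) : ℝ)⌋₊ : ℝ) • fundWeight n j

open Classical in
/-- The staircase embedding `J^(m)` of a lattice function `φ` (of which only the values on `P^(m)`
matter): `(J^(m) φ)(x) = √(Δ^(m)_{[mx]}) φ_{[mx]}` if `[mx] ∈ P^(m)`, and `0` otherwise. -/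
def staircase (n m : ℕ) (t : ℝ) (φ : V n → ℂ) (x : V n) : ℂ :=
  if intPart n ((m : ℝ) • x) ∈ latticeAlcove n m then
    (Real.sqrt (latticeWeight n m t (intPart n ((m : ℝ) • x))) : ℂ) * φ (intPart n ((m : ℝ) • x))
  else 0

/-- `θ(x) = (1 - t²) ∫₀ˣ (1 - 2t cos y + t²)⁻¹ dy`, `-1 < t < 1`. -/
def latticeTheta (t x : ℝ) : ℝ :=
  (1 - t ^ 2) * ∫ y in (0 : ℝ)..x, (1 - 2 * t * Real.cos y + t ^ 2)⁻¹

/-- `ξ` is the lattice Bethe vector with label `μ`: it lies in `E` and solves the Bethe equations in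
logarithmic form, `m ξ_j + ∑_{l ≠ j} θ(ξ_j - ξ_l) = 2π (ρ + μ)_j`.
The usual form with right-hand side `2π m_j`, `m_j ∈ ℤ`, `m₁ > ⋯ > mₙ`, for a vector in `ℝⁿ`, is
turned into this one by orthogonal projection onto `E`, under which the vector of the `m_j` becomes
`ρ + μ`. -/
def IsLatticeBetheVector (n m : ℕ) (t : ℝ) (μ ξ : V n) : Prop :=
  ξ ∈ massPlane n ∧ ∀ j : Fin n,
    (m : ℝ) * ξ j + ∑ l ∈ Finset.univ.erase j, latticeTheta t (ξ j - ξ l) =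
      2 * Real.pi * (rho n + μ) j

/-- The lattice Bethe vector `ξ^(m)_μ`. -/
def latticeBetheVector (n m : ℕ) (t : ℝ) (μ : V n) : V n :=
  Classical.epsilon (IsLatticeBetheVector n m t μ)

/-- The algebraic Bethe system of the lattice model: for all roots `β`,
`e^{im⟨β,ξ⟩} = ((1 - t e^{i⟨β,ξ⟩}) / (e^{i⟨β,ξ⟩} - t))²
  ∏_{α ∈ R, ⟨α,β⟩ = 1} (1 - t e^{i⟨α,ξ⟩}) / (e^{i⟨α,ξ⟩} - t)`. -/
def LatticeBetheSystem (n m : ℕ) (t : ℝ) (ξ : V n) : Prop :=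
  ∀ β ∈ roots n,
    Complex.exp (Complex.I * (m : ℂ) * ((inner ℝ (root β) ξ : ℝ) : ℂ)) =
      ((1 - (t : ℂ) * Complex.exp (Complex.I * ((inner ℝ (root β) ξ : ℝ) : ℂ))) /
        (Complex.exp (Complex.I * ((inner ℝ (root β) ξ : ℝ) : ℂ)) - (t : ℂ))) ^ 2 *
      ∏ α ∈ (roots n).filter (fun α => inner ℝ (root α) (root β) = (1 : ℝ)),
        (1 - (t : ℂ) * Complex.exp (Complex.I * ((inner ℝ (root α) ξ : ℝ) : ℂ))) /
          (Complex.exp (Complex.I * ((inner ℝ (root α) ξ : ℝ) : ℂ)) - (t : ℂ))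

/-- The coupling `t = e^{-g/m}`. -/
def coupling (g : ℝ) (m : ℕ) : ℝ := Real.exp (-(g / m))

/-- The staircase embedding `Ψ^(m)(x, ξ) = (J^(m) Ψ(ξ))(x)` of the lattice Bethe wave function, with
`t = e^{-g/m}`. -/
def staircaseWave (n m : ℕ) (g : ℝ) (ξ x : V n) : ℂ :=
  staircase n m (coupling g m) (fun lam => hallLittlewood n (coupling g m) lam ξ) x

/-! ### The Lieb–Liniger model -/

/-- The Lieb–Liniger Bethe wave function
`Ψ^(∞)(x, ξ) = ∑_σ ∏_{α ∈ R⁺} (⟨α, ξ_σ⟩ - ig) / ⟨α, ξ_σ⟩ e^{i⟨x, ξ_σ⟩}`. -/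
def liebLinigerWave (n : ℕ) (g : ℝ) (ξ x : V n) : ℂ :=
  ∑ σ : Equiv.Perm (Fin n),
    (∏ p ∈ posRoots n,
      (((inner ℝ (root p) (permute σ ξ) : ℝ) : ℂ) - Complex.I * (g : ℂ)) /
        ((inner ℝ (root p) (permute σ ξ) : ℝ) : ℂ)) *
      Complex.exp (Complex.I * ((inner ℝ x (permute σ ξ) : ℝ) : ℂ))

/-- `ξ` is the Yang–Yang vector with label `μ`: it lies in `E` and solves
`ξ_j + ∑_{l ≠ j} 2 arctan((ξ_j - ξ_l)/g) = 2π (ρ + μ)_j`, the projection onto `E` of the Bethe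
equations in logarithmic form. -/
def IsYangYangVector (n : ℕ) (g : ℝ) (μ ξ : V n) : Prop :=
  ξ ∈ massPlane n ∧ ∀ j : Fin n,
    ξ j + ∑ l ∈ Finset.univ.erase j, 2 * Real.arctan ((ξ j - ξ l) / g) =
      2 * Real.pi * (rho n + μ) j

/-- The Yang–Yang vector `ξ^(∞)_μ`. -/
def yangYangVector (n : ℕ) (g : ℝ) (μ : V n) : V n :=
  Classical.epsilon (IsYangYangVector n g μ)

/-- The algebraic Bethe system of the Lieb–Liniger model: for all roots `β`,
`e^{i⟨β,ξ⟩} = ((ig + ⟨β,ξ⟩) / (ig - ⟨β,ξ⟩))²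
  ∏_{α ∈ R, ⟨α,β⟩ = 1} (ig + ⟨α,ξ⟩) / (ig - ⟨α,ξ⟩)`. -/
def LiebLinigerBetheSystem (n : ℕ) (g : ℝ) (ξ : V n) : Prop :=
  ∀ β ∈ roots n,
    Complex.exp (Complex.I * ((inner ℝ (root β) ξ : ℝ) : ℂ)) =
      ((Complex.I * (g : ℂ) + ((inner ℝ (root β) ξ : ℝ) : ℂ)) /
        (Complex.I * (g : ℂ) - ((inner ℝ (root β) ξ : ℝ) : ℂ))) ^ 2 *
      ∏ α ∈ (roots n).filter (fun α => inner ℝ (root α) (root β) = (1 : ℝ)),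
        (Complex.I * (g : ℂ) + ((inner ℝ (root α) ξ : ℝ) : ℂ)) /
          (Complex.I * (g : ℂ) - ((inner ℝ (root α) ξ : ℝ) : ℂ))

/-- The `L²` inner product `∫_D φ(x) conj(ψ(x)) dx` over a subset `D` of `E`. -/
def innerOn {n : ℕ} (D : Set (V n)) (φ ψ : V n → ℂ) : ℂ :=
  ∫ x in D, φ x * (starRingEnd ℂ) (ψ x) ∂(planeVolume n)

end BetheAlcove

end

open BetheAlcove

/-! Everything is done in gap coordinates. With `n = N + 1`, the map `ofGaps` identifies `E` with
`ℝ^N` by `y ↦ ∑ y_j ω_j`. The measure on `E` becomes a constant multiple of Lebesgue measure,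
dominant weights become vectors of natural numbers, and the alcove becomes the simplex `y_j ≥ 0`, `∑
y_j ≤ 1`.

Both kinds of Bethe vector solve `a ξ_j + ∑_l θ(ξ_j - ξ_l) = c_j` with `θ` odd and increasing. This
is the critical point equation of a coercive action, whence existence; monotonicity gives uniqueness
and a Lipschitz bound in the right-hand side (`phase_stability`). Exponentiating differences of the
equations gives the algebraic Bethe systems. For `t = e^{-g/m}` the phase `θ(x/m)` tends to `2
arctan(x/g)`, so the Lipschitz bound shows that `m ξ^(m)` converges to the Yang–Yang vector
(`tendsto_latticeBetheVector`). The staircase functions then converge pointwise off a null set, with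
a uniform bound and a common bounded support, and dominated convergence yields the limit of the
inner products (`tendsto_innerOn`).

Orthogonality is proved on the lattice and survives the limit. The inner product of staircase
functions is a multiple of the finite sum `latticePairing`. Expanding `∏_j (1 + u e^{iξ_j})` times
the wave function gives a sum over binary words, each word moving the particles it marks by one
step. Words that leave the alcove are brought back by the `t`-exchange relation and by
quasi-periodicity, the latter being the Bethe equations. A `t`-multinomial identity
(`cyclicWeight_mul_sum`) collects the result into moves between lattice states. The collected
weights are invariant under reversing the move and complementing the word, so the adjoint of the
generating function is explicit (`latticePairing_adjoint`). A nonzero pairing therefore forces the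
numbers `e^{iξ_j}` to occur among the `e^{iξ'_j}`; since both vectors have spread less than `2π` and
sum zero, they coincide (`eq_of_exp_eq_exp`), and then so do the labels.

The norms are positive because the Lieb–Liniger function does not vanish identically on the open
alcove: along the direction `ρ` it is an exponential sum whose largest frequency belongs to the
identity permutation alone and has a nonzero coefficient. -/

noncomputable section

namespace BetheAlcove

/-! ### Gap coordinates on the plane `E` -/

lemma inner_root {n : ℕ} (x : V n) (p : Fin n × Fin n) :
    inner ℝ x (root p) = x p.1 - x p.2 := by
  simp [root, inner_sub_right, EuclideanSpace.inner_single_right]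

lemma inner_root_left {n : ℕ} (x : V n) (p : Fin n × Fin n) :
    inner ℝ (root p) x = x p.1 - x p.2 := by
  rw [real_inner_comm, inner_root]

lemma basisVec_succ {n : ℕ} (i : Fin n) :
    basisVec n (i.val + 1) = EuclideanSpace.single i (1 : ℝ) := by
  ext k
  simp [basisVec, Fin.ext_iff]

lemma simpleRoot_succ {N : ℕ} (j : Fin N) :
    simpleRoot (N + 1) (j.val + 1) = root (j.castSucc, j.succ) := by
  have h1 := basisVec_succ j.castSucc
  have h2 := basisVec_succ j.succ
  simp only [Fin.val_castSucc, Fin.val_succ] at h1 h2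
  simp [simpleRoot, root, h1, h2]

lemma highestRoot_succ (N : ℕ) : highestRoot (N + 1) = root ((0 : Fin (N + 1)), Fin.last N) := by
  have h1 := basisVec_succ (0 : Fin (N + 1))
  have h2 := basisVec_succ (Fin.last N)
  simp only [Fin.val_zero, zero_add, Fin.val_last] at h1 h2
  simp [highestRoot, root, h1, h2]

lemma forall_mem_Icc_one_iff {N : ℕ} {P : ℕ → Prop} :
    (∀ j ∈ Finset.Icc 1 (N + 1 - 1), P j) ↔ ∀ j : Fin N, P (j.val + 1) := by
  constructor
  · intro h j
    exact h _ (by simp)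
  · intro h j hj
    simp only [Finset.mem_Icc] at hj
    have := h ⟨j - 1, by omega⟩
    simpa [Nat.sub_add_cancel hj.1] using this

lemma sum_Icc_one_eq {N : ℕ} {M : Type*} [AddCommMonoid M] (f : ℕ → M) :
    ∑ j ∈ Finset.Icc 1 (N + 1 - 1), f j = ∑ j : Fin N, f (j.val + 1) := by
  rw [← Finset.sum_range (fun j => f (j + 1)), Nat.add_sub_cancel, ← Finset.Ico_succ_right_eq_Icc,
    Finset.sum_Ico_eq_sum_range]
  simp [add_comm]

lemma fundWeight_apply {n : ℕ} (j : ℕ) (i : Fin n) :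
    fundWeight n j i = (if i.val < j then 1 else 0) - (j : ℝ) / n := by
  simp only [fundWeight, PiLp.sub_apply, PiLp.smul_apply, WithLp.ofLp_sum, Finset.sum_apply,
    basisVec, Finset.sum_ite_eq, Finset.mem_Icc, smul_eq_mul]
  have : i.val + 1 ≤ n := i.2
  simp [this]

lemma mem_massPlane {n : ℕ} {x : V n} : x ∈ massPlane n ↔ ∑ i, x i = 0 := Iff.rfl

lemma fundWeight_mem {N : ℕ} (j : Fin N) : fundWeight (N + 1) (j.val + 1) ∈ massPlane (N + 1) := by
  rw [mem_massPlane]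
  have h : ∀ i : Fin (N + 1), fundWeight (N + 1) (j.val + 1) i =
      (if i.val < j.val + 1 then 1 else 0) - ((j.val + 1 : ℕ) : ℝ) / (N + 1 : ℕ) :=
    fundWeight_apply _
  simp only [h, Finset.sum_sub_distrib, Finset.sum_const, Finset.card_univ, Fintype.card_fin]
  rw [Fin.sum_univ_eq_sum_range (fun i => if i < j.val + 1 then (1 : ℝ) else 0),
    Finset.sum_ite, Finset.sum_const_zero, Finset.sum_const, add_zero]
  have : (Finset.range (N + 1)).filter (fun i => i < j.val + 1) = Finset.range (j.val + 1) := by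
    ext i; simp; omega
  rw [this]
  simp only [Finset.card_range, nsmul_eq_mul, mul_one]
  field_simp
  ring

/-- The vector of `E` with prescribed inner products with the simple roots. -/
def ofGaps (N : ℕ) : (Fin N → ℝ) →ₗ[ℝ] V (N + 1) :=
  ∑ j : Fin N, (LinearMap.proj j).smulRight (fundWeight (N + 1) (j.val + 1))

lemma ofGaps_eq {N : ℕ} (y : Fin N → ℝ) :
    ofGaps N y = ∑ j : Fin N, y j • fundWeight (N + 1) (j.val + 1) := by
  simp [ofGaps]

lemma ofGaps_mem {N : ℕ} (y : Fin N → ℝ) : ofGaps N y ∈ massPlane (N + 1) := by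
  rw [ofGaps_eq]
  exact Submodule.sum_mem _ fun j _ => Submodule.smul_mem _ _ (fundWeight_mem j)

lemma ofGaps_sub {N : ℕ} (y : Fin N → ℝ) {i k : Fin (N + 1)} (hik : i ≤ k) :
    ofGaps N y i - ofGaps N y k =
      ∑ j : Fin N, if i.val ≤ j.val ∧ j.val < k.val then y j else 0 := by
  have h : ∀ (j : Fin N) (i : Fin (N + 1)), fundWeight (N + 1) (j.val + 1) i =
      (if i.val < j.val + 1 then 1 else 0) - ((j.val + 1 : ℕ) : ℝ) / (N + 1 : ℕ) :=
    fun j => fundWeight_apply _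
  rw [ofGaps_eq]
  simp only [WithLp.ofLp_sum, Finset.sum_apply, PiLp.smul_apply, smul_eq_mul, h]
  rw [← Finset.sum_sub_distrib]
  refine Finset.sum_congr rfl fun j _ => ?_
  have hik' : i.val ≤ k.val := hik
  by_cases h1 : i.val < j.val + 1 <;> by_cases h2 : k.val < j.val + 1
  · simp [h1, h2]; intro; omega
  · rw [if_pos h1, if_neg h2, if_pos ⟨by omega, by omega⟩]; ring
  · omega
  · rw [if_neg h1, if_neg h2, if_neg (by omega)]; ring

lemma ofGaps_gap {N : ℕ} (y : Fin N → ℝ) (j : Fin N) :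
    ofGaps N y j.castSucc - ofGaps N y j.succ = y j := by
  rw [ofGaps_sub y (Fin.castSucc_le_succ j), Finset.sum_eq_single j]
  · simp
  · intro i _ hij
    rw [if_neg]
    simp only [Fin.val_castSucc, Fin.val_succ]
    intro h
    exact hij (Fin.ext (by omega))
  · simp

lemma ofGaps_zero_sub_last {N : ℕ} (y : Fin N → ℝ) :
    ofGaps N y 0 - ofGaps N y (Fin.last N) = ∑ j, y j := by
  rw [ofGaps_sub y (Fin.zero_le _)]
  simp

/-- Equal gaps force the difference to be a constant vector, and the zero-sum condition makes the
constant vanish. -/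
lemma ext_of_gaps {N : ℕ} {x y : V (N + 1)} (hx : x ∈ massPlane (N + 1))
    (hy : y ∈ massPlane (N + 1))
    (h : ∀ j : Fin N, x j.castSucc - x j.succ = y j.castSucc - y j.succ) : x = y := by
  have h0 : ∀ i : Fin (N + 1), x i - y i = x 0 - y 0 := by
    intro i
    induction i using Fin.induction with
    | zero => rfl
    | succ j ih => linarith [h j]
  have hs : ∑ i, (x i - y i) = 0 := by
    rw [Finset.sum_sub_distrib, mem_massPlane.1 hx, mem_massPlane.1 hy, sub_zero]
  rw [Finset.sum_congr rfl fun i _ => h0 i] at hs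
  have h00 : x 0 - y 0 = 0 := by
    simp only [Finset.sum_const, Finset.card_univ, Fintype.card_fin, nsmul_eq_mul,
      mul_eq_zero] at hs
    rcases hs with hs | hs
    · exact absurd hs (by positivity)
    · exact hs
  ext i
  linarith [h0 i]

lemma eq_ofGaps {N : ℕ} {x : V (N + 1)} (hx : x ∈ massPlane (N + 1)) :
    x = ofGaps N (fun j => x j.castSucc - x j.succ) :=
  ext_of_gaps hx (ofGaps_mem _) fun j => by rw [ofGaps_gap]

lemma ofGaps_injective (N : ℕ) : Function.Injective (ofGaps N) := by
  intro y y' h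
  ext j
  rw [← ofGaps_gap y j, ← ofGaps_gap y' j, h]

/-- The plane `E` is identified with the space of gaps. -/
def gapsEquiv (N : ℕ) : (Fin N → ℝ) ≃ₗ[ℝ] massPlane (N + 1) :=
  LinearEquiv.ofBijective ((ofGaps N).codRestrict _ ofGaps_mem)
    ⟨fun _ _ h => ofGaps_injective N (congrArg Subtype.val h),
      fun x => ⟨_, Subtype.ext (eq_ofGaps x.2).symm⟩⟩

/-- Uniqueness of Haar measure. The value of the constant never matters: it is common to both sides
of the limit, and only its positivity enters the norms. -/
lemma planeVolume_eq (N : ℕ) : ∃ c : NNReal, 0 < c ∧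
    planeVolume (N + 1) = c • (volume : Measure (Fin N → ℝ)).map (ofGaps N) := by
  let e := (gapsEquiv N).toContinuousLinearEquiv
  let μ : Measure (massPlane (N + 1)) := (volume : Measure (Fin N → ℝ)).map e
  have hμ : μ.IsAddHaarMeasure := e.isAddHaarMeasure_map volume
  let ν : Measure (massPlane (N + 1)) :=
    (stdOrthonormalBasis ℝ (massPlane (N + 1))).toBasis.addHaar
  refine ⟨Measure.addHaarScalarFactor ν μ,
    Measure.addHaarScalarFactor_pos_of_isAddHaarMeasure ν μ, ?_⟩
  change ν.map Subtype.val = _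
  conv_lhs => rw [Measure.isAddLeftInvariant_eq_smul ν μ]
  rw [Measure.map_smul]
  congr 1
  rw [Measure.map_map measurable_subtype_coe e.continuous.measurable]
  rfl

lemma measurableEmbedding_ofGaps (N : ℕ) : MeasurableEmbedding (ofGaps N) := by
  have : Topology.IsClosedEmbedding (ofGaps N) :=
    LinearMap.isClosedEmbedding_of_injective
      (LinearMap.ker_eq_bot.2 (ofGaps_injective N))
  exact this.measurableEmbedding

lemma inner_simpleRoot {N : ℕ} (x : V (N + 1)) (j : Fin N) :
    inner ℝ x (simpleRoot (N + 1) (j.val + 1)) = x j.castSucc - x j.succ := by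
  rw [simpleRoot_succ, inner_root]

lemma inner_highestRoot {N : ℕ} (x : V (N + 1)) :
    inner ℝ x (highestRoot (N + 1)) = x 0 - x (Fin.last N) := by
  rw [highestRoot_succ, inner_root]

lemma mem_chamber_iff {N : ℕ} {x : V (N + 1)} :
    x ∈ chamber (N + 1) ↔ x ∈ massPlane (N + 1) ∧ ∀ j : Fin N, x j.succ < x j.castSucc := by
  simp only [chamber, Set.mem_ofPred_eq, forall_mem_Icc_one_iff, inner_simpleRoot, sub_pos]

lemma ofGaps_mem_chamber {N : ℕ} {y : Fin N → ℝ} :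
    ofGaps N y ∈ chamber (N + 1) ↔ ∀ j, 0 < y j := by
  simp only [chamber, Set.mem_ofPred_eq, forall_mem_Icc_one_iff, inner_simpleRoot, ofGaps_gap,
    ofGaps_mem, true_and]

lemma ofGaps_mem_alcove {N : ℕ} {y : Fin N → ℝ} :
    ofGaps N y ∈ alcove (N + 1) ↔ ∑ j, y j ≤ 1 ∧ ∀ j, 0 ≤ y j := by
  simp only [alcove, Set.mem_ofPred_eq, forall_mem_Icc_one_iff, inner_simpleRoot, ofGaps_gap,
    ofGaps_mem, true_and, inner_highestRoot, ofGaps_zero_sub_last]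

lemma rho_eq (N : ℕ) : rho (N + 1) = ofGaps N 1 := by
  rw [rho, sum_Icc_one_eq, ofGaps_eq]
  simp

lemma exists_fin_extend {N : ℕ} (k : Fin N → ℕ) : ∃ k' : ℕ → ℕ, ∀ j : Fin N, k' (j.val + 1) = k j :=
  ⟨fun i => if h : i - 1 < N then k ⟨i - 1, h⟩ else 0, fun j => by simp⟩

lemma mem_dominantWeights {N : ℕ} {μ : V (N + 1)} :
    μ ∈ dominantWeights (N + 1) ↔ ∃ k : Fin N → ℕ, μ = ofGaps N (fun j => (k j : ℝ)) := by
  simp only [dominantWeights, Set.mem_ofPred_eq, sum_Icc_one_eq, ofGaps_eq]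
  constructor
  · rintro ⟨k, rfl⟩
    exact ⟨fun j => k (j.val + 1), rfl⟩
  · rintro ⟨k, rfl⟩
    obtain ⟨k', hk'⟩ := exists_fin_extend k
    exact ⟨k', by simp [hk']⟩

lemma mem_latticeAlcove {N m : ℕ} {μ : V (N + 1)} :
    μ ∈ latticeAlcove (N + 1) m ↔
      ∃ k : Fin N → ℕ, ∑ j, k j ≤ m ∧ μ = ofGaps N (fun j => (k j : ℝ)) := by
  simp only [latticeAlcove, Set.mem_ofPred_eq, sum_Icc_one_eq, ofGaps_eq]
  constructor
  · rintro ⟨k, h, rfl⟩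
    exact ⟨fun j => k (j.val + 1), h, rfl⟩
  · rintro ⟨k, h, rfl⟩
    obtain ⟨k', hk'⟩ := exists_fin_extend k
    exact ⟨k', by simp [hk', h]⟩

lemma ofGaps_mem_latticeAlcove {N m : ℕ} {k : Fin N → ℕ} :
    ofGaps N (fun j => (k j : ℝ)) ∈ latticeAlcove (N + 1) m ↔ ∑ j, k j ≤ m := by
  rw [mem_latticeAlcove]
  constructor
  · rintro ⟨k', h, he⟩
    have := ofGaps_injective N he
    have hk : k = k' := by
      ext j
      exact_mod_cast congrFun this j
    rwa [hk]
  · intro h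
    exact ⟨k, h, rfl⟩

lemma intPart_ofGaps {N : ℕ} (y : Fin N → ℝ) :
    intPart (N + 1) (ofGaps N y) = ofGaps N (fun j => (⌊y j⌋₊ : ℝ)) := by
  simp only [intPart, sum_Icc_one_eq, inner_simpleRoot, ofGaps_gap]
  rw [ofGaps_eq]

lemma intPart_smul_ofGaps {N : ℕ} (m : ℕ) (y : Fin N → ℝ) :
    intPart (N + 1) ((m : ℝ) • ofGaps N y) = ofGaps N (fun j => (⌊(m : ℝ) * y j⌋₊ : ℝ)) := by
  rw [← map_smul, intPart_ofGaps]
  rfl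

/-! ### Equations `a ξ_j + ∑_{l ≠ j} θ(ξ_j - ξ_l) = c_j` with odd monotone phase `θ` -/

section PhaseEquation

variable {ι : Type*} [Fintype ι] [DecidableEq ι] {θ : ℝ → ℝ}

lemma sum_erase_phase (h0 : θ 0 = 0) (ξ : ι → ℝ) (j : ι) :
    ∑ l ∈ Finset.univ.erase j, θ (ξ j - ξ l) = ∑ l, θ (ξ j - ξ l) := by
  rw [← Finset.add_sum_erase _ _ (Finset.mem_univ j), sub_self, h0, zero_add]

omit [DecidableEq ι] in
lemma sum_sum_phase_eq_zero (hodd : ∀ x, θ (-x) = -θ x) (ξ : ι → ℝ) :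
    ∑ j, ∑ l, θ (ξ j - ξ l) = 0 := by
  have h : ∑ j, ∑ l, θ (ξ j - ξ l) = -∑ j, ∑ l, θ (ξ j - ξ l) := by
    conv_lhs => rw [Finset.sum_comm]
    simp only [← Finset.sum_neg_distrib]
    refine Finset.sum_congr rfl fun j _ => Finset.sum_congr rfl fun l _ => ?_
    rw [← hodd, neg_sub]
  linarith

-- Exchanging `j` and `l` and using oddness, twice the sum has the terms `((ξ_j - ξ_l) - (η_j -
-- η_l)) (θ(ξ_j - ξ_l) - θ(η_j - η_l))`, which are nonnegative since `θ` is monotone.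
omit [DecidableEq ι] in
lemma phase_form_nonneg (hodd : ∀ x, θ (-x) = -θ x) (hmono : Monotone θ) (ξ η : ι → ℝ) :
    0 ≤ ∑ j, ∑ l, (ξ j - η j) * (θ (ξ j - ξ l) - θ (η j - η l)) := by
  have h : ∑ j, ∑ l, (ξ j - η j) * (θ (ξ j - ξ l) - θ (η j - η l)) =
      -∑ j, ∑ l, (ξ l - η l) * (θ (ξ j - ξ l) - θ (η j - η l)) := by
    conv_lhs => rw [Finset.sum_comm]
    simp only [← Finset.sum_neg_distrib]
    refine Finset.sum_congr rfl fun j _ => Finset.sum_congr rfl fun l _ => ?_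
    rw [← neg_sub (ξ j) (ξ l), ← neg_sub (η j) (η l), hodd, hodd]
    ring
  have h2 : 0 ≤ ∑ j, ∑ l, ((ξ j - η j) * (θ (ξ j - ξ l) - θ (η j - η l)) -
      (ξ l - η l) * (θ (ξ j - ξ l) - θ (η j - η l))) := by
    refine Finset.sum_nonneg fun j _ => Finset.sum_nonneg fun l _ => ?_
    rw [← sub_mul]
    rcases le_total (ξ j - ξ l) (η j - η l) with hle | hle
    · exact mul_nonneg_of_nonpos_of_nonpos (by linarith) (by linarith [hmono hle])
    · exact mul_nonneg (by linarith) (by linarith [hmono hle])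
  simp only [Finset.sum_sub_distrib] at h2
  linarith

omit [DecidableEq ι] in
/-- Strong monotonicity of the phase equations. -/
lemma phase_stability (hodd : ∀ x, θ (-x) = -θ x) (hmono : Monotone θ) {a : ℝ} (ha : 0 < a)
    (ξ η c d : ι → ℝ) (hξ : ∀ j, a * ξ j + ∑ l, θ (ξ j - ξ l) = c j)
    (hη : ∀ j, a * η j + ∑ l, θ (η j - η l) = d j) :
    ∑ j, (ξ j - η j) ^ 2 ≤ (∑ j, (c j - d j) ^ 2) / a ^ 2 := by
  have h := phase_form_nonneg hodd hmono ξ η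
  have h1 : ∑ j, ∑ l, (ξ j - η j) * (θ (ξ j - ξ l) - θ (η j - η l)) =
      ∑ j, ((ξ j - η j) * (c j - d j) - a * (ξ j - η j) ^ 2) := by
    refine Finset.sum_congr rfl fun j _ => ?_
    rw [← Finset.mul_sum, Finset.sum_sub_distrib, ← hξ, ← hη]
    ring
  have h2 : ∑ j, ((ξ j - η j) * (c j - d j) - a * (ξ j - η j) ^ 2) ≤
      ∑ j, ((c j - d j) ^ 2 / (2 * a) - a / 2 * (ξ j - η j) ^ 2) := by
    refine Finset.sum_le_sum fun j _ => ?_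
    -- Young's inequality `xy ≤ a x²/2 + y²/(2a)`, as a completed square.
    have : 0 ≤ (a * (ξ j - η j) - (c j - d j)) ^ 2 / (2 * a) := by positivity
    have e : (a * (ξ j - η j) - (c j - d j)) ^ 2 / (2 * a) =
        a / 2 * (ξ j - η j) ^ 2 - (ξ j - η j) * (c j - d j) + (c j - d j) ^ 2 / (2 * a) := by
      field_simp
      ring
    linarith
  conv_rhs at h2 => rw [Finset.sum_sub_distrib, ← Finset.sum_div, ← Finset.mul_sum]
  have h3 : a / 2 * ∑ j, (ξ j - η j) ^ 2 ≤ (∑ j, (c j - d j) ^ 2) / (2 * a) := by linarith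
  rw [le_div_iff₀ (by positivity)] at h3 ⊢
  nlinarith

-- If `ξ_j ≤ ξ_k`, every term on the left of equation `j` would be at most the corresponding term of
-- equation `k`.
omit [DecidableEq ι] in
lemma phase_lt_of_lt (hmono : Monotone θ) {a : ℝ} (ha : 0 < a) {ξ c : ι → ℝ}
    (hξ : ∀ j, a * ξ j + ∑ l, θ (ξ j - ξ l) = c j) {j k : ι} (h : c k < c j) : ξ k < ξ j := by
  by_contra! hle
  have h1 : ∑ l, θ (ξ j - ξ l) ≤ ∑ l, θ (ξ k - ξ l) :=
    Finset.sum_le_sum fun l _ => hmono (by linarith)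
  have h2 : a * ξ j ≤ a * ξ k := by gcongr
  linarith [hξ j, hξ k]

/-- The Yang–Yang action with potential `Θ`. -/
def phaseAction (θ : ℝ → ℝ) (a : ℝ) (c : ι → ℝ) (ξ : ι → ℝ) : ℝ :=
  ∑ j, (a / 2 * ξ j ^ 2 - c j * ξ j) +
    2⁻¹ * ∑ j, ∑ l, ∫ y in (0 : ℝ)..(ξ j - ξ l), θ y

/-- Critical points of the action are the solutions. The variable `ξ_i` enters the double sum once
as first and once as second index; by oddness the two contributions agree, and the factor `1/2`
absorbs the repetition. -/
lemma hasDerivAt_phaseAction (hc : Continuous θ) (hodd : ∀ x, θ (-x) = -θ x) (a : ℝ)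
    (c ξ : ι → ℝ) (i : ι) :
    HasDerivAt (fun s : ℝ => phaseAction θ a c (ξ + s • Pi.single i 1))
      (a * ξ i + ∑ l, θ (ξ i - ξ l) - c i) 0 := by
  have hl : ∀ j, HasDerivAt (fun s : ℝ => (ξ + s • (Pi.single i 1 : ι → ℝ)) j)
      ((Pi.single i (1 : ℝ) : ι → ℝ) j) 0 := by
    intro j
    simpa using ((hasDerivAt_id (0 : ℝ)).mul_const ((Pi.single i (1 : ℝ) : ι → ℝ) j)).const_add (ξ j)
  have h1 : HasDerivAt (fun s : ℝ => ∑ j, (a / 2 * ((ξ + s • (Pi.single i 1 : ι → ℝ)) j) ^ 2 -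
      c j * (ξ + s • (Pi.single i 1 : ι → ℝ)) j))
      (∑ j, (a / 2 * (2 * ξ j * (Pi.single i (1 : ℝ) : ι → ℝ) j) -
        c j * (Pi.single i (1 : ℝ) : ι → ℝ) j)) 0 := by
    refine HasDerivAt.fun_sum fun j _ => ?_
    have := (((hl j).pow 2).const_mul (a / 2)).fun_sub ((hl j).const_mul (c j))
    simpa using this
  have h2 : HasDerivAt (fun s : ℝ => 2⁻¹ * ∑ j, ∑ l,
      ∫ y in (0 : ℝ)..((ξ + s • (Pi.single i 1 : ι → ℝ)) j - (ξ + s • (Pi.single i 1 : ι → ℝ)) l),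
        θ y)
      (2⁻¹ * ∑ j, ∑ l, θ (ξ j - ξ l) *
        ((Pi.single i (1 : ℝ) : ι → ℝ) j - (Pi.single i (1 : ℝ) : ι → ℝ) l)) 0 := by
    refine HasDerivAt.const_mul _ (HasDerivAt.fun_sum fun j _ => HasDerivAt.fun_sum fun l _ => ?_)
    have hI : HasDerivAt (fun x => ∫ y in (0 : ℝ)..x, θ y) (θ (ξ j - ξ l))
        ((ξ + (0 : ℝ) • (Pi.single i 1 : ι → ℝ)) j - (ξ + (0 : ℝ) • (Pi.single i 1 : ι → ℝ)) l) := by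
      have := (hc.integral_hasStrictDerivAt 0 (ξ j - ξ l)).hasDerivAt
      simpa using this
    exact hI.comp (0 : ℝ) ((hl j).sub (hl l))
  have h3 := h1.add h2
  refine h3.congr_deriv ?_
  have e1 : ∑ j, ∑ l, θ (ξ j - ξ l) *
        ((Pi.single i (1 : ℝ) : ι → ℝ) j - (Pi.single i (1 : ℝ) : ι → ℝ) l) =
      2 * ∑ l, θ (ξ i - ξ l) := by
    simp only [mul_sub, Finset.sum_sub_distrib]
    rw [Finset.sum_comm (f := fun j l => θ (ξ j - ξ l) * (Pi.single i (1 : ℝ) : ι → ℝ) l)]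
    simp only [Pi.single_apply, mul_ite, mul_one, mul_zero]
    have : ∀ j, (∑ l, if j = i then θ (ξ j - ξ l) else 0) =
        if j = i then ∑ l, θ (ξ j - ξ l) else 0 := by
      intro j; split_ifs <;> simp
    have h' : ∀ j, (∑ l, if j = i then θ (ξ l - ξ j) else 0) =
        if j = i then ∑ l, θ (ξ l - ξ j) else 0 := by
      intro j; split_ifs <;> simp
    simp only [this, h', Finset.sum_ite_eq', Finset.mem_univ, if_true]
    have : ∑ l, θ (ξ l - ξ i) = -∑ l, θ (ξ i - ξ l) := by
      rw [← Finset.sum_neg_distrib]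
      refine Finset.sum_congr rfl fun l _ => ?_
      rw [← hodd, neg_sub]
    rw [this]
    ring
  rw [e1, Finset.sum_sub_distrib]
  simp [Pi.single_apply]
  ring

/-- A minimizer of the action is a solution. The potential of an odd monotone `θ` is nonnegative and
half of the quadratic term absorbs the linear one, so the action is coercive. -/
lemma exists_phase_solution (hc : Continuous θ) (hodd : ∀ x, θ (-x) = -θ x)
    (hmono : Monotone θ) {a : ℝ} (ha : 0 < a) (c : ι → ℝ) :
    ∃ ξ : ι → ℝ, ∀ j, a * ξ j + ∑ l, θ (ξ j - ξ l) = c j := by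
  have h0 : θ 0 = 0 := by have := hodd 0; rw [neg_zero] at this; linarith
  have hpot : ∀ x, 0 ≤ ∫ y in (0 : ℝ)..x, θ y := by
    intro x
    rcases le_total 0 x with hx | hx
    · exact intervalIntegral.integral_nonneg hx fun y hy => h0 ▸ hmono hy.1
    · rw [intervalIntegral.integral_symm, ← intervalIntegral.integral_neg]
      exact intervalIntegral.integral_nonneg hx fun y hy => by
        have := hmono hy.2
        linarith
  have hcont : Continuous (fun ξ : EuclideanSpace ℝ ι => phaseAction θ a c ξ) := by
    have hI : Continuous fun x => ∫ y in (0 : ℝ)..x, θ y :=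
      intervalIntegral.continuous_primitive (fun _ _ => hc.intervalIntegrable _ _) 0
    unfold phaseAction
    fun_prop
  have hbound : ∀ ξ : EuclideanSpace ℝ ι,
      a / 4 * ‖ξ‖ ^ 2 + (-∑ j, c j ^ 2 / a) ≤ phaseAction θ a c ξ := by
    intro ξ
    have h1 : 0 ≤ 2⁻¹ * ∑ j, ∑ l, ∫ y in (0 : ℝ)..(ξ j - ξ l), θ y :=
      mul_nonneg (by norm_num)
        (Finset.sum_nonneg fun j _ => Finset.sum_nonneg fun l _ => hpot _)
    have h2 : a / 4 * ‖ξ‖ ^ 2 + (-∑ j, c j ^ 2 / a) ≤ ∑ j, (a / 2 * ξ j ^ 2 - c j * ξ j) := by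
      rw [EuclideanSpace.real_norm_sq_eq, Finset.mul_sum, ← Finset.sum_neg_distrib,
        ← Finset.sum_add_distrib]
      refine Finset.sum_le_sum fun j _ => ?_
      have : 0 ≤ (a * ξ j - 2 * c j) ^ 2 / (4 * a) := by positivity
      have e : (a * ξ j - 2 * c j) ^ 2 / (4 * a) =
          a / 4 * ξ j ^ 2 - c j * ξ j + c j ^ 2 / a := by
        field_simp
        ring
      linarith
    unfold phaseAction
    linarith
  have hlim : Tendsto (fun ξ : EuclideanSpace ℝ ι => phaseAction θ a c ξ)
      (cocompact (EuclideanSpace ℝ ι)) atTop := by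
    refine tendsto_atTop_mono hbound (tendsto_atTop_add_const_right _ _ ?_)
    exact ((tendsto_pow_atTop (two_ne_zero)).comp
      (tendsto_norm_cocompact_atTop)).const_mul_atTop (by positivity)
  obtain ⟨ξ, hξ⟩ := hcont.exists_forall_le hlim
  refine ⟨ξ, fun j => ?_⟩
  have hd := hasDerivAt_phaseAction hc hodd a c ξ j
  have hmin : IsLocalMin (fun s : ℝ => phaseAction θ a c (ξ.ofLp + s • Pi.single j 1)) 0 := by
    refine Filter.Eventually.of_forall fun s => ?_
    have := hξ (WithLp.toLp 2 (ξ.ofLp + s • Pi.single j 1))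
    simpa using this
  linarith [hmin.hasDerivAt_eq_zero hd]

end PhaseEquation

/-- Summing the equations cancels the odd phases and leaves `a ∑ ξ_j = ∑ c_j = 0`, so a solution
lies in `E` automatically. -/
lemma existsUnique_phase_solution {n : ℕ} {θ : ℝ → ℝ} (hc : Continuous θ)
    (hodd : ∀ x, θ (-x) = -θ x) (hmono : Monotone θ) {a : ℝ} (ha : 0 < a) {c : Fin n → ℝ}
    (hsum : ∑ j, c j = 0) :
    ∃! ξ : V n, ξ ∈ massPlane n ∧
      ∀ j, a * ξ j + ∑ l ∈ Finset.univ.erase j, θ (ξ j - ξ l) = c j := by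
  have h0 : θ 0 = 0 := by have := hodd 0; rw [neg_zero] at this; linarith
  obtain ⟨ξ, hξ⟩ := exists_phase_solution hc hodd hmono ha c
  refine ⟨WithLp.toLp 2 ξ, ⟨?_, fun j => ?_⟩, ?_⟩
  · have h := Finset.sum_congr rfl fun j (_ : j ∈ Finset.univ) => hξ j
    rw [Finset.sum_add_distrib, sum_sum_phase_eq_zero hodd, hsum, add_zero, ← Finset.mul_sum] at h
    rw [mem_massPlane]
    exact (mul_eq_zero.1 h).resolve_left ha.ne'
  · rw [sum_erase_phase (ξ := ξ) h0]
    exact hξ j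
  · rintro η ⟨-, hη⟩
    have h := phase_stability hodd hmono ha η.ofLp ξ c c
      (fun j => by rw [← hη j, sum_erase_phase (ξ := η.ofLp) h0]) hξ
    simp only [sub_self, ne_eq, OfNat.ofNat_ne_zero, not_false_eq_true, zero_pow,
      Finset.sum_const_zero, zero_div] at h
    have h' := (Finset.sum_eq_zero_iff_of_nonneg fun j _ => sq_nonneg _).1
      (le_antisymm h (Finset.sum_nonneg fun j _ => sq_nonneg (η j - ξ j)))
    ext j
    have := h' j (Finset.mem_univ j)
    rw [sq_eq_zero_iff] at this
    exact sub_eq_zero.1 this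

/-! ### The lattice phase -/

section LatticePhase

variable {t : ℝ}

lemma phase_denom_pos (ht0 : 0 < t) (ht1 : t < 1) (y : ℝ) :
    0 < 1 - 2 * t * Real.cos y + t ^ 2 := by
  nlinarith [Real.cos_le_one y, sq_pos_of_pos (sub_pos.2 ht1)]

lemma continuous_phase_integrand (ht0 : 0 < t) (ht1 : t < 1) :
    Continuous fun y : ℝ => (1 - 2 * t * Real.cos y + t ^ 2)⁻¹ :=
  Continuous.inv₀ (by fun_prop) fun y => (phase_denom_pos ht0 ht1 y).ne'

lemma hasDerivAt_latticeTheta (ht0 : 0 < t) (ht1 : t < 1) (x : ℝ) :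
    HasDerivAt (latticeTheta t) ((1 - t ^ 2) * (1 - 2 * t * Real.cos x + t ^ 2)⁻¹) x :=
  (((continuous_phase_integrand ht0 ht1).integral_hasStrictDerivAt 0 x).hasDerivAt).const_mul _

lemma latticeTheta_zero : latticeTheta t 0 = 0 := by simp [latticeTheta]

lemma continuous_latticeTheta (ht0 : 0 < t) (ht1 : t < 1) : Continuous (latticeTheta t) :=
  continuous_iff_continuousAt.2 fun x => (hasDerivAt_latticeTheta ht0 ht1 x).continuousAt

lemma strictMono_latticeTheta (ht0 : 0 < t) (ht1 : t < 1) : StrictMono (latticeTheta t) := by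
  refine strictMono_of_deriv_pos fun x => ?_
  rw [(hasDerivAt_latticeTheta ht0 ht1 x).deriv]
  have := phase_denom_pos ht0 ht1 x
  have : 0 < 1 - t ^ 2 := by nlinarith
  positivity

lemma latticeTheta_neg (x : ℝ) : latticeTheta t (-x) = -latticeTheta t x := by
  have h := intervalIntegral.integral_comp_neg (a := 0) (b := x)
    (fun y : ℝ => (1 - 2 * t * Real.cos y + t ^ 2)⁻¹)
  simp only [Real.cos_neg, neg_zero] at h
  rw [latticeTheta, latticeTheta, intervalIntegral.integral_symm, ← h]
  ring

lemma exp_sub_ne_zero (ht0 : 0 < t) (ht1 : t < 1) (x : ℝ) :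
    Complex.exp (Complex.I * x) - t ≠ 0 := by
  intro h
  have := congrArg norm (sub_eq_zero.1 h)
  rw [mul_comm, Complex.norm_exp_ofReal_mul_I, Complex.norm_real, Real.norm_of_nonneg ht0.le] at this
  linarith

lemma one_sub_mul_exp_ne_zero (ht0 : 0 < t) (ht1 : t < 1) (x : ℝ) :
    1 - t * Complex.exp (Complex.I * x) ≠ 0 := by
  intro h
  have := congrArg norm (sub_eq_zero.1 h)
  rw [norm_mul, mul_comm Complex.I, Complex.norm_exp_ofReal_mul_I, Complex.norm_real,
    Real.norm_of_nonneg ht0.le, norm_one] at this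
  linarith

/-- The ratio of the two sides has derivative zero and equals `1` at the origin; thus `θ` is a
continuous logarithm of the two-body scattering factor. -/
lemma exp_neg_latticeTheta (ht0 : 0 < t) (ht1 : t < 1) (x : ℝ) :
    Complex.exp (-(Complex.I * latticeTheta t x)) =
      (1 - t * Complex.exp (Complex.I * x)) / (Complex.exp (Complex.I * x) - t) := by
  let h : ℝ → ℂ := fun x => Complex.exp (Complex.I * latticeTheta t x) *
    (1 - t * Complex.exp (Complex.I * x)) / (Complex.exp (Complex.I * x) - t)
  have hd : ∀ x, HasDerivAt h 0 x := by
    intro x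
    have hθ := ((hasDerivAt_latticeTheta ht0 ht1 x).ofReal_comp.const_mul Complex.I).cexp
    have hE : HasDerivAt (fun x : ℝ => Complex.exp (Complex.I * x))
        (Complex.exp (Complex.I * x) * (Complex.I * (1 : ℝ))) x :=
      (((hasDerivAt_id x).ofReal_comp).const_mul Complex.I).cexp
    have h1 := (hθ.mul ((hE.const_mul (t : ℂ)).const_sub 1)).div (hE.sub_const (t : ℂ))
      (exp_sub_ne_zero ht0 ht1 x)
    refine h1.congr_deriv ?_
    have e1 := exp_sub_ne_zero ht0 ht1 x
    have e2 := one_sub_mul_exp_ne_zero ht0 ht1 x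
    have e3 : Complex.exp (Complex.I * x) ≠ 0 := Complex.exp_ne_zero _
    -- This is `|1 - t e^{ix}|²` written as a rational function of `e^{ix}`, which reduces the
    -- vanishing of the derivative to algebra.
    have ecos : ((1 - 2 * t * Real.cos x + t ^ 2 : ℝ) : ℂ) =
        (1 - t * Complex.exp (Complex.I * x)) * (Complex.exp (Complex.I * x) - t) /
          Complex.exp (Complex.I * x) := by
      push_cast
      rw [Complex.cos, neg_mul, mul_comm (x : ℂ) Complex.I, Complex.exp_neg]
      field_simp
      ring
    simp only [Complex.ofReal_mul, Complex.ofReal_inv, ecos, Pi.mul_apply]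
    set E := Complex.exp (Complex.I * x)
    rw [div_eq_zero_iff]
    left
    push_cast
    field_simp
    ring
  have hconst : h x = h 0 :=
    is_const_of_deriv_eq_zero (fun x => (hd x).differentiableAt) (fun x => (hd x).deriv) x 0
  have h0 : h 0 = 1 := by
    have : (1 : ℂ) - t ≠ 0 := by
      have := exp_sub_ne_zero ht0 ht1 0
      simpa using this
    simp [h, latticeTheta_zero, this]
  rw [h0] at hconst
  rw [Complex.exp_neg]
  have : Complex.exp (Complex.I * latticeTheta t x) ≠ 0 := Complex.exp_ne_zero _
  refine inv_eq_of_mul_eq_one_right ?_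
  refine Eq.trans ?_ hconst
  simp only [h]
  ring

/-- By `exp_neg_latticeTheta` the value is an integer multiple of `2π`, and it is positive by
monotonicity. The lower bound suffices for the spread estimate. -/
lemma two_pi_le_latticeTheta (ht0 : 0 < t) (ht1 : t < 1) :
    2 * Real.pi ≤ latticeTheta t (2 * Real.pi) := by
  have h := exp_neg_latticeTheta ht0 ht1 (2 * Real.pi)
  have e : Complex.exp (Complex.I * ((2 * Real.pi : ℝ) : ℂ)) = 1 := by
    rw [mul_comm]; push_cast; exact Complex.exp_two_pi_mul_I
  have h1t : (1 : ℂ) - t ≠ 0 := by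
    have := exp_sub_ne_zero ht0 ht1 0
    simpa using this
  rw [e, mul_one, div_self h1t, Complex.exp_eq_one_iff] at h
  obtain ⟨k, hk⟩ := h
  have hk' : latticeTheta t (2 * Real.pi) = -k * (2 * Real.pi) := by
    have := congrArg Complex.im hk
    simpa using congrArg Neg.neg this
  have hpos : 0 < latticeTheta t (2 * Real.pi) := by
    rw [← latticeTheta_zero (t := t)]
    exact strictMono_latticeTheta ht0 ht1 (by positivity)
  have hk1 : (1 : ℝ) ≤ -k := by
    have : (0 : ℝ) < -k := by
      by_contra! hle
      nlinarith [Real.pi_pos]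
    have h2 : (0 : ℤ) < -k := by exact_mod_cast this
    exact_mod_cast h2
  rw [hk']
  nlinarith [Real.pi_pos]

lemma latticeTheta_add_two_pi (ht0 : 0 < t) (ht1 : t < 1) (x : ℝ) :
    latticeTheta t (x + 2 * Real.pi) = latticeTheta t x + latticeTheta t (2 * Real.pi) := by
  have hp : Function.Periodic (fun y : ℝ => (1 - 2 * t * Real.cos y + t ^ 2)⁻¹)
      (2 * Real.pi) := by
    intro y
    simp
  have hi := fun a b => (continuous_phase_integrand ht0 ht1).intervalIntegrable (μ := volume) a b
  have h := hp.intervalIntegral_add_eq x 0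
  rw [zero_add] at h
  simp only [latticeTheta]
  rw [← intervalIntegral.integral_add_adjacent_intervals (hi 0 x) (hi x _), h]
  ring

end LatticePhase

lemma exp_neg_two_arctan (y : ℝ) {g : ℝ} (hg : 0 < g) :
    Complex.exp (-(Complex.I * ((2 * Real.arctan (y / g) : ℝ) : ℂ))) =
      (Complex.I * g + y) / (Complex.I * g - y) := by
  set a := Real.arctan (y / g)
  have hs : 0 < Real.sqrt (1 + (y / g) ^ 2) := by positivity
  have hs2 : ((Real.sqrt (1 + (y / g) ^ 2) : ℝ) : ℂ) ^ 2 = 1 + (y / g : ℂ) ^ 2 := by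
    rw [← Complex.ofReal_pow, Real.sq_sqrt (by positivity)]
    push_cast
    rfl
  have h1 : Complex.exp (-(Complex.I * a)) =
      (1 - Complex.I * (y / g)) / (Real.sqrt (1 + (y / g) ^ 2) : ℝ) := by
    have : -(Complex.I * a) = ((-a : ℝ) : ℂ) * Complex.I := by push_cast; ring
    rw [this, Complex.exp_mul_I, ← Complex.ofReal_cos, ← Complex.ofReal_sin, Real.cos_neg,
      Real.sin_neg, Real.cos_arctan, Real.sin_arctan]
    push_cast
    ring
  have h2 : -(Complex.I * ((2 * a : ℝ) : ℂ)) = -(Complex.I * a) + -(Complex.I * a) := by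
    push_cast; ring
  have hg' : (g : ℂ) ≠ 0 := by exact_mod_cast hg.ne'
  have hne : Complex.I * g - y ≠ 0 := by
    intro h
    have := congrArg Complex.im h
    simp at this
    exact hg.ne' this
  have hne2 : (1 : ℂ) + (y / g : ℂ) ^ 2 ≠ 0 := by
    rw [← hs2]
    exact pow_ne_zero _ (by exact_mod_cast hs.ne')
  rw [h2, Complex.exp_add, h1, div_mul_div_comm, ← sq, ← sq, hs2, div_eq_div_iff hne2 hne]
  field_simp
  linear_combination (-2 * g ^ 2 * y + Complex.I * y ^ 2 * g - y ^ 3) * Complex.I_sq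

/-! ### From the logarithmic to the algebraic Bethe equations -/

/-- For `β = e_j - e_k` such a root shares exactly one end with `β`, in the same position; sharing
both would give inner product `2`. -/
lemma filter_inner_root_eq {n : ℕ} {j k : Fin n} (hjk : j ≠ k) :
    (roots n).filter (fun α => inner ℝ (root α) (root (j, k)) = (1 : ℝ)) =
      ((Finset.univ.erase j).erase k).image (fun l => (j, l)) ∪
        ((Finset.univ.erase j).erase k).image (fun l => (l, k)) := by
  ext ⟨p, q⟩
  simp only [roots, Finset.mem_filter, Finset.mem_univ, true_and, inner_root, Finset.mem_union,
    Finset.mem_image, Finset.mem_erase, and_true, Prod.mk.injEq]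
  simp only [root, PiLp.sub_apply, PiLp.single_apply]
  constructor
  · rintro ⟨hpq, h⟩
    by_cases h1 : p = j
    · subst h1
      by_cases h2 : q = k
      · subst h2
        simp [hjk, hjk.symm] at h
      · exact Or.inl ⟨q, ⟨h2, Ne.symm hpq⟩, rfl, rfl⟩
    · by_cases h2 : q = k
      · subst h2
        exact Or.inr ⟨p, ⟨hpq, h1⟩, rfl, rfl⟩
      · exfalso
        rw [if_neg (Ne.symm h1), if_neg (Ne.symm h2)] at h
        split_ifs at h <;> norm_num at h
  · rintro (⟨l, ⟨h1, h2⟩, rfl, rfl⟩ | ⟨l, ⟨h1, h2⟩, rfl, rfl⟩)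
    · exact ⟨Ne.symm h2, by simp [hjk.symm, h1.symm, h2.symm]⟩
    · exact ⟨h1, by simp [hjk, h1.symm, h2.symm]⟩

lemma sum_filter_inner_root {n : ℕ} {j k : Fin n} (hjk : j ≠ k) {M : Type*} [AddCommMonoid M]
    (f : Fin n × Fin n → M) :
    ∑ α ∈ (roots n).filter (fun α => inner ℝ (root α) (root (j, k)) = (1 : ℝ)), f α =
      ∑ l ∈ (Finset.univ.erase j).erase k, (f (j, l) + f (l, k)) := by
  rw [filter_inner_root_eq hjk, Finset.sum_union, Finset.sum_image, Finset.sum_image,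
    Finset.sum_add_distrib]
  · intro a _ b _ h; simpa using h
  · intro a _ b _ h; simpa using h
  · rw [Finset.disjoint_left]
    rintro ⟨p, q⟩ h1 h2
    simp only [Finset.mem_image, Finset.mem_erase, Prod.mk.injEq, Finset.mem_univ] at h1 h2
    obtain ⟨l, ⟨h3, h4, -⟩, rfl, rfl⟩ := h1
    obtain ⟨l', ⟨h5, h6, -⟩, h7, h8⟩ := h2
    exact h6 h7

/-- Subtract equation `k` from equation `j` and exponentiate. The phase `θ(ξ_j - ξ_k)` occurs in
both, hence the square; the remaining phases pair up into the roots with inner product `1`. The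
right-hand side is an integer multiple of `2π` and disappears. -/
lemma bethe_system_of_phase {n : ℕ} {θ : ℝ → ℝ} (hodd : ∀ x, θ (-x) = -θ x) {a : ℝ}
    {ξ : V n} {r : Fin n → ℝ}
    (hξ : ∀ j, a * ξ j + ∑ l ∈ Finset.univ.erase j, θ (ξ j - ξ l) = 2 * Real.pi * r j)
    (hr : ∀ j k, ∃ z : ℤ, r j - r k = z) {S : ℝ → ℂ}
    (hS : ∀ x, Complex.exp (-(Complex.I * θ x)) = S x) {β : Fin n × Fin n} (hβ : β ∈ roots n) :
    Complex.exp (Complex.I * (a : ℂ) * ((inner ℝ (root β) ξ : ℝ) : ℂ)) =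
      S (inner ℝ (root β) ξ) ^ 2 *
      ∏ α ∈ (roots n).filter (fun α => inner ℝ (root α) (root β) = (1 : ℝ)),
        S (inner ℝ (root α) ξ) := by
  obtain ⟨j, k⟩ := β
  have hjk : j ≠ k := by simpa [roots] using hβ
  simp only [← hS]
  rw [← Complex.exp_sum, ← Complex.exp_nat_mul, ← Complex.exp_add, Complex.exp_eq_exp_iff_exists_int]
  obtain ⟨z, hz⟩ := hr j k
  refine ⟨z, ?_⟩
  rw [sum_filter_inner_root hjk]
  simp only [inner_root_left]
  have hkj : k ∈ (Finset.univ.erase j : Finset (Fin n)) := by simp [hjk.symm]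
  have hjk' : j ∈ (Finset.univ.erase k : Finset (Fin n)) := by simp [hjk]
  have hj := hξ j
  have hk := hξ k
  rw [← Finset.add_sum_erase _ _ hkj] at hj
  rw [← Finset.add_sum_erase _ _ hjk', Finset.erase_right_comm] at hk
  have hkk : ∑ l ∈ (Finset.univ.erase j).erase k, θ (ξ k - ξ l) =
      -∑ l ∈ (Finset.univ.erase j).erase k, θ (ξ l - ξ k) := by
    rw [← Finset.sum_neg_distrib]
    refine Finset.sum_congr rfl fun l _ => ?_
    rw [← hodd, neg_sub]
  have hkj' : θ (ξ k - ξ j) = -θ (ξ j - ξ k) := by rw [← hodd, neg_sub]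
  rw [hkk, hkj'] at hk
  have key : a * (ξ j - ξ k) = -2 * θ (ξ j - ξ k) -
      ∑ l ∈ (Finset.univ.erase j).erase k, (θ (ξ j - ξ l) + θ (ξ l - ξ k)) + z * (2 * Real.pi) := by
    rw [Finset.sum_add_distrib, ← hz]
    linear_combination hj - hk
  have key' := congrArg (fun x : ℝ => (x : ℂ)) key
  simp only [Complex.ofReal_add, Complex.ofReal_sub, Complex.ofReal_mul, Complex.ofReal_neg,
    Complex.ofReal_sum, Complex.ofReal_ofNat, Complex.ofReal_intCast] at key'
  have e : ∑ l ∈ (Finset.univ.erase j).erase k,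
      (-(Complex.I * (θ (ξ j - ξ l) : ℂ)) + -(Complex.I * (θ (ξ l - ξ k) : ℂ))) =
      -(Complex.I * ∑ l ∈ (Finset.univ.erase j).erase k,
        ((θ (ξ j - ξ l) : ℂ) + (θ (ξ l - ξ k) : ℂ))) := by
    rw [Finset.mul_sum, ← Finset.sum_neg_distrib]
    refine Finset.sum_congr rfl fun l _ => by ring
  rw [e]
  push_cast
  linear_combination Complex.I * key'

/-! ### The label vectors `ρ + μ` -/

lemma rho_add_ofGaps {N : ℕ} (k : Fin N → ℕ) :
    rho (N + 1) + ofGaps N (fun j => (k j : ℝ)) = ofGaps N (fun j => (1 + k j : ℝ)) := by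
  rw [rho_eq, ← map_add]
  rfl

lemma label_sub_int {N : ℕ} (k : Fin N → ℕ) (i j : Fin (N + 1)) :
    ∃ z : ℤ, ofGaps N (fun j => (1 + k j : ℝ)) i - ofGaps N (fun j => (1 + k j : ℝ)) j = z := by
  have key : ∀ i j : Fin (N + 1), i ≤ j → ∃ z : ℤ,
      ofGaps N (fun j => (1 + k j : ℝ)) i - ofGaps N (fun j => (1 + k j : ℝ)) j = z := by
    intro i j hij
    refine ⟨∑ l : Fin N, if i.val ≤ l.val ∧ l.val < j.val then 1 + (k l : ℤ) else 0, ?_⟩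
    rw [ofGaps_sub _ hij]
    push_cast
    rfl
  rcases le_total i j with h | h
  · exact key i j h
  · obtain ⟨z, hz⟩ := key j i h
    exact ⟨-z, by push_cast; linarith⟩

lemma sum_label {N : ℕ} (y : Fin N → ℝ) : ∑ j, 2 * Real.pi * ofGaps N y j = 0 := by
  rw [← Finset.mul_sum, mem_massPlane.1 (ofGaps_mem y), mul_zero]

/-! ### The coupling -/

lemma coupling_pos (g : ℝ) (m : ℕ) : 0 < coupling g m := Real.exp_pos _

lemma coupling_lt_one {g : ℝ} (hg : 0 < g) {m : ℕ} (hm : 1 ≤ m) : coupling g m < 1 := by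
  have : (0 : ℝ) < m := by exact_mod_cast hm
  rw [coupling, Real.exp_lt_one_iff]
  have : 0 < g / m := by positivity
  linarith

/-! ### The lattice Bethe vectors -/

lemma existsUnique_latticeBethe {N m : ℕ} {t : ℝ} (ht0 : 0 < t) (ht1 : t < 1) (hm : 1 ≤ m)
    (k : Fin N → ℕ) :
    ∃! ξ : V (N + 1), IsLatticeBetheVector (N + 1) m t (ofGaps N fun j => (k j : ℝ)) ξ := by
  have h := existsUnique_phase_solution (continuous_latticeTheta ht0 ht1) latticeTheta_neg
    (strictMono_latticeTheta ht0 ht1).monotone (a := (m : ℝ)) (by exact_mod_cast hm)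
    (sum_label (fun j : Fin N => (1 + k j : ℝ)))
  simpa only [IsLatticeBetheVector, rho_add_ofGaps] using h

lemma latticeBetheVector_spec {N m : ℕ} {t : ℝ} (ht0 : 0 < t) (ht1 : t < 1) (hm : 1 ≤ m)
    (k : Fin N → ℕ) :
    IsLatticeBetheVector (N + 1) m t (ofGaps N fun j => (k j : ℝ))
      (latticeBetheVector (N + 1) m t (ofGaps N fun j => (k j : ℝ))) :=
  Classical.epsilon_spec (existsUnique_latticeBethe ht0 ht1 hm k).exists

lemma IsLatticeBetheVector.phase_eq {N m : ℕ} {t : ℝ} {k : Fin N → ℕ} {ξ : V (N + 1)}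
    (h : IsLatticeBetheVector (N + 1) m t (ofGaps N fun j => (k j : ℝ)) ξ) (j : Fin (N + 1)) :
    m * ξ j + ∑ l, latticeTheta t (ξ j - ξ l) =
      2 * Real.pi * ofGaps N (fun j => (1 + k j : ℝ)) j := by
  rw [← rho_add_ofGaps, ← h.2 j, sum_erase_phase (ξ := ξ.ofLp) latticeTheta_zero]

lemma IsLatticeBetheVector.mem_chamber {N m : ℕ} {t : ℝ} (ht0 : 0 < t) (ht1 : t < 1)
    (hm : 1 ≤ m) {k : Fin N → ℕ} {ξ : V (N + 1)}
    (h : IsLatticeBetheVector (N + 1) m t (ofGaps N fun j => (k j : ℝ)) ξ) :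
    ξ ∈ chamber (N + 1) := by
  refine mem_chamber_iff.2 ⟨h.1, fun j => ?_⟩
  refine phase_lt_of_lt (strictMono_latticeTheta ht0 ht1).monotone (a := (m : ℝ))
    (by exact_mod_cast hm) h.phase_eq ?_
  have := ofGaps_gap (fun j => (1 + k j : ℝ)) j
  have h0 : (0 : ℝ) ≤ k j := Nat.cast_nonneg _
  have hp := Real.pi_pos
  gcongr
  linarith

/-- If the spread were at least `2π`, each phase in the first equation would exceed its counterpart
in the last by at least `θ(2π) ≥ 2π`. The two equations would then differ by at least `2π(m + N +
1)`, whereas their right-hand sides differ by `2π(N + ∑ k_j) ≤ 2π(N + m)`. -/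
lemma IsLatticeBetheVector.sub_lt {N m : ℕ} {t : ℝ} (ht0 : 0 < t) (ht1 : t < 1)
    {k : Fin N → ℕ} (hk : ∑ j, k j ≤ m) {ξ : V (N + 1)}
    (h : IsLatticeBetheVector (N + 1) m t (ofGaps N fun j => (k j : ℝ)) ξ) :
    ξ 0 - ξ (Fin.last N) < 2 * Real.pi := by
  by_contra! hge
  have h0 := h.phase_eq 0
  have h1 := h.phase_eq (Fin.last N)
  have h2 := ofGaps_zero_sub_last (fun j => (1 + k j : ℝ))
  have h3 : ∑ l, (latticeTheta t (ξ (Fin.last N) - ξ l) + 2 * Real.pi) ≤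
      ∑ l, latticeTheta t (ξ 0 - ξ l) := by
    refine Finset.sum_le_sum fun l _ => ?_
    calc latticeTheta t (ξ (Fin.last N) - ξ l) + 2 * Real.pi
        ≤ latticeTheta t (ξ (Fin.last N) - ξ l) + latticeTheta t (2 * Real.pi) := by
          gcongr; exact two_pi_le_latticeTheta ht0 ht1
      _ = latticeTheta t (ξ (Fin.last N) - ξ l + 2 * Real.pi) :=
          (latticeTheta_add_two_pi ht0 ht1 _).symm
      _ ≤ _ := (strictMono_latticeTheta ht0 ht1).monotone (by linarith)
  rw [Finset.sum_add_distrib] at h3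
  simp only [Finset.sum_const, Finset.card_univ, Fintype.card_fin, nsmul_eq_mul] at h3
  rw [Finset.sum_add_distrib] at h2
  simp only [Finset.sum_const, Finset.card_univ, Fintype.card_fin, nsmul_eq_mul, mul_one] at h2
  have hk' : ∑ j, (k j : ℝ) ≤ m := by exact_mod_cast hk
  have hp := Real.pi_pos
  have h4 : (m : ℝ) * (2 * Real.pi) ≤ m * (ξ 0 - ξ (Fin.last N)) := by gcongr
  push_cast at h3
  nlinarith

lemma IsLatticeBetheVector.betheSystem {N m : ℕ} {t : ℝ} (ht0 : 0 < t) (ht1 : t < 1)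
    {k : Fin N → ℕ} {ξ : V (N + 1)}
    (h : IsLatticeBetheVector (N + 1) m t (ofGaps N fun j => (k j : ℝ)) ξ) :
    LatticeBetheSystem (N + 1) m t ξ := by
  intro β hβ
  have h2 := h.2
  rw [rho_add_ofGaps] at h2
  exact bethe_system_of_phase latticeTheta_neg h2 (label_sub_int k)
    (exp_neg_latticeTheta ht0 ht1) hβ

/-! ### The Yang–Yang vectors -/

lemma strictMono_arctan_phase {g : ℝ} (hg : 0 < g) :
    StrictMono fun x : ℝ => 2 * Real.arctan (x / g) := by
  intro x y hxy
  have := Real.arctan_strictMono (div_lt_div_of_pos_right hxy hg)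
  simpa using this

lemma arctan_phase_neg (g x : ℝ) : 2 * Real.arctan (-x / g) = -(2 * Real.arctan (x / g)) := by
  rw [neg_div, Real.arctan_neg]
  ring

lemma existsUnique_yangYang {N : ℕ} {g : ℝ} (hg : 0 < g) (k : Fin N → ℕ) :
    ∃! ξ : V (N + 1), IsYangYangVector (N + 1) g (ofGaps N fun j => (k j : ℝ)) ξ := by
  have h := existsUnique_phase_solution (θ := fun x : ℝ => 2 * Real.arctan (x / g))
    (by fun_prop) (arctan_phase_neg g) (strictMono_arctan_phase hg).monotone one_pos
    (sum_label (fun j : Fin N => (1 + k j : ℝ)))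
  simpa only [IsYangYangVector, rho_add_ofGaps, one_mul] using h

lemma yangYangVector_spec {N : ℕ} {g : ℝ} (hg : 0 < g) (k : Fin N → ℕ) :
    IsYangYangVector (N + 1) g (ofGaps N fun j => (k j : ℝ))
      (yangYangVector (N + 1) g (ofGaps N fun j => (k j : ℝ))) :=
  Classical.epsilon_spec (existsUnique_yangYang hg k).exists

lemma IsYangYangVector.phase_eq {N : ℕ} {g : ℝ} {k : Fin N → ℕ} {ξ : V (N + 1)}
    (h : IsYangYangVector (N + 1) g (ofGaps N fun j => (k j : ℝ)) ξ) (j : Fin (N + 1)) :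
    1 * ξ j + ∑ l, 2 * Real.arctan ((ξ j - ξ l) / g) =
      2 * Real.pi * ofGaps N (fun j => (1 + k j : ℝ)) j := by
  rw [← rho_add_ofGaps, ← h.2 j, one_mul,
    sum_erase_phase (θ := fun x => 2 * Real.arctan (x / g)) (ξ := ξ.ofLp) (by simp)]

lemma IsYangYangVector.mem_chamber {N : ℕ} {g : ℝ} (hg : 0 < g) {k : Fin N → ℕ}
    {ξ : V (N + 1)} (h : IsYangYangVector (N + 1) g (ofGaps N fun j => (k j : ℝ)) ξ) :
    ξ ∈ chamber (N + 1) := by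
  refine mem_chamber_iff.2 ⟨h.1, fun j => ?_⟩
  refine phase_lt_of_lt (strictMono_arctan_phase hg).monotone one_pos h.phase_eq ?_
  have := ofGaps_gap (fun j => (1 + k j : ℝ)) j
  have h0 : (0 : ℝ) ≤ k j := Nat.cast_nonneg _
  have hp := Real.pi_pos
  gcongr
  linarith

lemma IsYangYangVector.betheSystem {N : ℕ} {g : ℝ} (hg : 0 < g) {k : Fin N → ℕ}
    {ξ : V (N + 1)} (h : IsYangYangVector (N + 1) g (ofGaps N fun j => (k j : ℝ)) ξ) :
    LiebLinigerBetheSystem (N + 1) g ξ := by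
  intro β hβ
  have h2 : ∀ j, (1 : ℝ) * ξ j + ∑ l ∈ Finset.univ.erase j, 2 * Real.arctan ((ξ j - ξ l) / g) =
      2 * Real.pi * ofGaps N (fun j => (1 + k j : ℝ)) j := by
    intro j
    rw [← rho_add_ofGaps, ← h.2 j, one_mul]
  have := bethe_system_of_phase (θ := fun x : ℝ => 2 * Real.arctan (x / g))
    (arctan_phase_neg g) h2 (label_sub_int k) (fun x => exp_neg_two_arctan x hg) hβ
  simpa using this

/-! ### The continuum limit of the Bethe vectors -/

/-- The form with `dslope` avoids dividing by `w m`, which may vanish. -/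
lemma tendsto_nat_mul_of_hasDerivAt {𝕜 : Type*} [RCLike 𝕜] {f : 𝕜 → 𝕜} {f' : 𝕜}
    (hf : HasDerivAt f f' 0) (h0 : f 0 = 0) {w : ℕ → 𝕜} {w₀ : 𝕜}
    (hw : Tendsto w atTop (𝓝 w₀)) :
    Tendsto (fun m : ℕ => (m : 𝕜) * f (w m / m)) atTop (𝓝 (w₀ * f')) := by
  have h1 : Tendsto (fun m : ℕ => w m / (m : 𝕜)) atTop (𝓝 0) := by
    have := hw.mul (tendsto_inv_atTop_nhds_zero_nat (𝕜 := 𝕜))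
    simpa [div_eq_mul_inv] using this
  have h2 : Tendsto (fun m : ℕ => dslope f 0 (w m / m)) atTop (𝓝 f') := by
    have hc := (continuousAt_dslope_same.2 hf.differentiableAt).tendsto
    rw [dslope_same, hf.deriv] at hc
    exact hc.comp h1
  refine (hw.mul h2).congr' ?_
  filter_upwards [eventually_ge_atTop 1] with m hm
  have hm0 : (m : 𝕜) ≠ 0 := by exact_mod_cast (by omega : m ≠ 0)
  have := sub_smul_dslope f 0 (w m / m)
  rw [sub_zero, h0, sub_zero, smul_eq_mul] at this
  rw [← this]
  field_simp

lemma tendsto_nat_mul_one_sub_exp_neg {w : ℕ → ℂ} {w₀ : ℂ} (hw : Tendsto w atTop (𝓝 w₀)) :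
    Tendsto (fun m : ℕ => (m : ℂ) * (1 - Complex.exp (-(w m / m)))) atTop (𝓝 w₀) := by
  have hd : HasDerivAt (fun z : ℂ => 1 - Complex.exp (-z)) 1 0 := by
    have := ((hasDerivAt_neg (0 : ℂ)).cexp).const_sub 1
    simpa using this
  have := tendsto_nat_mul_of_hasDerivAt hd (by simp) hw
  simpa using this

lemma tendsto_nat_mul_one_sub_coupling (g : ℝ) :
    Tendsto (fun m : ℕ => (m : ℝ) * (1 - coupling g m)) atTop (𝓝 g) := by
  have hd : HasDerivAt (fun z : ℝ => 1 - Real.exp (-z)) 1 0 := by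
    have := ((hasDerivAt_neg (0 : ℝ)).exp).const_sub 1
    simpa using this
  have := tendsto_nat_mul_of_hasDerivAt hd (by simp)
    (tendsto_const_nhds (x := g) (f := (atTop : Filter ℕ)))
  simpa [coupling] using this

lemma tendsto_coupling (g : ℝ) : Tendsto (fun m : ℕ => coupling g m) atTop (𝓝 1) := by
  have : Tendsto (fun m : ℕ => g / (m : ℝ)) atTop (𝓝 0) := tendsto_const_div_atTop_nhds_zero_nat g
  have h := (Real.continuous_exp.tendsto _).comp this.neg
  simpa [coupling, Function.comp_def] using h

lemma tendsto_phase_integrand {g : ℝ} (hg : 0 < g) (y : ℝ) :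
    Tendsto (fun m : ℕ => (1 - coupling g m ^ 2) / m *
      (1 - 2 * coupling g m * Real.cos (y / m) + coupling g m ^ 2)⁻¹) atTop
      (𝓝 (2 * g * (g ^ 2 + y ^ 2)⁻¹)) := by
  have h1 := tendsto_nat_mul_one_sub_coupling g
  have h2 := tendsto_coupling g
  have h3 : Tendsto (fun m : ℕ => (m : ℝ) * Real.sin (y / 2 / m)) atTop (𝓝 (y / 2 * 1)) := by
    have hd : HasDerivAt Real.sin 1 0 := by simpa using Real.hasDerivAt_sin 0
    exact tendsto_nat_mul_of_hasDerivAt hd (by simp) tendsto_const_nhds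
  have hnum : Tendsto (fun m : ℕ => m * (1 - coupling g m) * (1 + coupling g m)) atTop
      (𝓝 (g * (1 + 1))) := h1.mul (h2.const_add 1)
  -- Numerator and denominator are multiplied by `m²`, using `1 - 2t cos x + t² = (1 - t)² + 4t
  -- sin²(x/2)`.
  have hden : Tendsto (fun m : ℕ => (m * (1 - coupling g m)) ^ 2 +
      4 * coupling g m * ((m : ℝ) * Real.sin (y / 2 / m)) ^ 2) atTop
      (𝓝 (g ^ 2 + 4 * 1 * (y / 2 * 1) ^ 2)) :=
    (h1.pow 2).add ((h2.const_mul 4).mul (h3.pow 2))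
  have hne : g ^ 2 + 4 * 1 * (y / 2 * 1) ^ 2 ≠ 0 := by positivity
  have h4 := hnum.mul (hden.inv₀ hne)
  have e : g * (1 + 1) * (g ^ 2 + 4 * 1 * (y / 2 * 1) ^ 2)⁻¹ = 2 * g * (g ^ 2 + y ^ 2)⁻¹ := by
    congr 1
    · ring
    · congr 1; ring
  rw [e] at h4
  refine h4.congr' ?_
  filter_upwards [eventually_ge_atTop 1] with m hm
  have hm0 : (m : ℝ) ≠ 0 := by exact_mod_cast (by omega : m ≠ 0)
  have hcos : Real.cos (y / m) = 1 - 2 * Real.sin (y / 2 / m) ^ 2 := by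
    rw [show y / (m : ℝ) = 2 * (y / 2 / m) by field_simp, Real.cos_two_mul, Real.cos_sq']
    ring
  have hd := phase_denom_pos (coupling_pos g m) (coupling_lt_one hg hm) (y / m)
  have e1 : (m * (1 - coupling g m)) ^ 2 +
      4 * coupling g m * ((m : ℝ) * Real.sin (y / 2 / m)) ^ 2 =
      m ^ 2 * (1 - 2 * coupling g m * Real.cos (y / m) + coupling g m ^ 2) := by
    rw [hcos]; ring
  rw [e1]
  field_simp
  ring

lemma integral_lorentz {g : ℝ} (hg : 0 < g) (x : ℝ) :
    ∫ y in (0 : ℝ)..x, 2 * g * (g ^ 2 + y ^ 2)⁻¹ = 2 * Real.arctan (x / g) := by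
  have hd : ∀ y ∈ Set.uIcc 0 x,
      HasDerivAt (fun y : ℝ => 2 * Real.arctan (y / g)) (2 * g * (g ^ 2 + y ^ 2)⁻¹) y := by
    intro y _
    refine ((((hasDerivAt_id y).div_const g).arctan).const_mul 2).congr_deriv ?_
    simp only [id]
    field_simp
  have hc : Continuous fun y : ℝ => 2 * g * (g ^ 2 + y ^ 2)⁻¹ :=
    continuous_const.mul (Continuous.inv₀ (by fun_prop) fun y => by positivity)
  rw [intervalIntegral.integral_eq_sub_of_hasDerivAt hd (hc.intervalIntegrable _ _)]
  simp

/-- Substituting `y/m` for `y` fixes the interval of integration; the integrands then tend to a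
Lorentzian, whose primitive is the arctangent. -/
lemma tendsto_latticeTheta {g : ℝ} (hg : 0 < g) (x : ℝ) :
    Tendsto (fun m : ℕ => latticeTheta (coupling g m) (x / m)) atTop
      (𝓝 (2 * Real.arctan (x / g))) := by
  rw [← integral_lorentz hg]
  have key : Tendsto (fun m : ℕ => ∫ y in (0 : ℝ)..x, (1 - coupling g m ^ 2) / m *
      (1 - 2 * coupling g m * Real.cos (y / m) + coupling g m ^ 2)⁻¹) atTop
      (𝓝 (∫ y in (0 : ℝ)..x, 2 * g * (g ^ 2 + y ^ 2)⁻¹)) := by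
    -- The integrand is at most `(1 - t²)/(m (1 - t)²) ≤ 2/(m (1 - t))`, hence at most `4/g` once `m
    -- (1 - t) ≥ g/2`.
    refine intervalIntegral.tendsto_integral_filter_of_dominated_convergence (fun _ => 4 / g)
      ?_ ?_ (by simp) ?_
    · filter_upwards [eventually_ge_atTop 1] with m hm
      refine Continuous.aestronglyMeasurable ?_
      exact continuous_const.mul
        ((continuous_phase_integrand (coupling_pos g m) (coupling_lt_one hg hm)).comp
          (continuous_id.div_const _))
    · filter_upwards [eventually_ge_atTop 1,
        (tendsto_nat_mul_one_sub_coupling g).eventually_const_le (half_lt_self hg)] with m hm hmg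
      refine Eventually.of_forall fun y _ => ?_
      have hd := phase_denom_pos (coupling_pos g m) (coupling_lt_one hg hm) (y / m)
      have ht0 := coupling_pos g m
      have ht1 := coupling_lt_one hg hm
      have hm0 : (0 : ℝ) < m := by exact_mod_cast hm
      have ht2 : 0 < 1 - coupling g m ^ 2 := by nlinarith
      rw [Real.norm_of_nonneg (by positivity), ← div_eq_mul_inv, div_div,
        div_le_div_iff₀ (by positivity) hg]
      have h1 : (1 - coupling g m) ^ 2 ≤
          1 - 2 * coupling g m * Real.cos (y / m) + coupling g m ^ 2 := by
        nlinarith [Real.cos_le_one (y / m)]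
      have h2 : g / 2 * (1 - coupling g m) ≤ m * (1 - coupling g m) ^ 2 := by
        rw [sq, ← mul_assoc]
        exact mul_le_mul_of_nonneg_right hmg (by linarith)
      have h3 : (m : ℝ) * (1 - coupling g m) ^ 2 ≤
          m * (1 - 2 * coupling g m * Real.cos (y / m) + coupling g m ^ 2) := by gcongr
      nlinarith [mul_pos hg (sub_pos.2 ht1)]
    · exact Eventually.of_forall fun y _ => tendsto_phase_integrand hg y
  refine key.congr' ?_
  filter_upwards [eventually_ge_atTop 1] with m hm
  have hm0 : (m : ℝ) ≠ 0 := by exact_mod_cast (by omega : m ≠ 0)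
  rw [latticeTheta, intervalIntegral.integral_const_mul,
    intervalIntegral.integral_comp_div
      (fun y => (1 - 2 * coupling g m * Real.cos y + coupling g m ^ 2)⁻¹) hm0, zero_div,
    smul_eq_mul, ← mul_assoc, div_mul_cancel₀ _ hm0]

/-- The rescaled lattice Bethe vectors converge to the Yang–Yang vector. -/
lemma tendsto_latticeBetheVector {N : ℕ} {g : ℝ} (hg : 0 < g) (k : Fin N → ℕ)
    (j : Fin (N + 1)) :
    Tendsto (fun m : ℕ => (m : ℝ) *
      latticeBetheVector (N + 1) m (coupling g m) (ofGaps N fun j => (k j : ℝ)) j) atTop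
      (𝓝 (yangYangVector (N + 1) g (ofGaps N fun j => (k j : ℝ)) j)) := by
  set η := yangYangVector (N + 1) g (ofGaps N fun j => (k j : ℝ))
  have hη : IsYangYangVector (N + 1) g (ofGaps N fun j => (k j : ℝ)) η := yangYangVector_spec hg k
  set ξ := fun m : ℕ => latticeBetheVector (N + 1) m (coupling g m) (ofGaps N fun j => (k j : ℝ))
  have hbound : ∀ᶠ m : ℕ in atTop, (m * ξ m j - η j) ^ 2 ≤
      ∑ i, (2 * Real.pi * ofGaps N (fun j => (1 + k j : ℝ)) i -
        (1 * η i + ∑ l, latticeTheta (coupling g m) ((η i - η l) / m))) ^ 2 := by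
    filter_upwards [eventually_ge_atTop 1] with m hm
    have hm0 : (0 : ℝ) < m := by exact_mod_cast hm
    have hξ := latticeBetheVector_spec (coupling_pos g m) (coupling_lt_one hg hm) hm k
    -- The vector `m ξ^(m)` solves the equations with phase `θ(·/m)` and `a = 1`. The limit `η`
    -- solves them with its own left-hand side as data, so the distance is bounded by the defect of
    -- `η`, which tends to zero.
    have h := phase_stability (θ := fun x => latticeTheta (coupling g m) (x / m))
      (fun x => by rw [neg_div, latticeTheta_neg])
      (fun x y hxy => (strictMono_latticeTheta (coupling_pos g m)
        (coupling_lt_one hg hm)).monotone (div_le_div_of_nonneg_right hxy hm0.le))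
      one_pos (fun i => m * ξ m i) η.ofLp
      (fun i => 2 * Real.pi * ofGaps N (fun j => (1 + k j : ℝ)) i) _ (fun i => by
        rw [one_mul]
        rw [← hξ.phase_eq i]
        congr 1
        refine Finset.sum_congr rfl fun l _ => ?_
        rw [← mul_sub, mul_div_cancel_left₀ _ hm0.ne']) (fun i => rfl)
    rw [one_pow, div_one] at h
    exact (Finset.single_le_sum (f := fun i => (m * ξ m i - η i) ^ 2)
      (fun i _ => sq_nonneg _) (Finset.mem_univ j)).trans h
  have hlim : Tendsto (fun m : ℕ =>
      ∑ i, (2 * Real.pi * ofGaps N (fun j => (1 + k j : ℝ)) i -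
        (1 * η i + ∑ l, latticeTheta (coupling g m) ((η i - η l) / m))) ^ 2) atTop (𝓝 0) := by
    have : (0 : ℝ) = ∑ i, (2 * Real.pi * ofGaps N (fun j => (1 + k j : ℝ)) i -
        (1 * η i + ∑ l, 2 * Real.arctan ((η i - η l) / g))) ^ 2 := by
      simp only [hη.phase_eq, sub_self]
      simp
    rw [this]
    refine tendsto_finsetSum _ fun i _ => Tendsto.pow (Tendsto.const_sub _
      (Tendsto.const_add _ (tendsto_finsetSum _ fun l _ => tendsto_latticeTheta hg _))) 2
  have h0 : Tendsto (fun m : ℕ => (m * ξ m j - η j) ^ 2) atTop (𝓝 0) :=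
    tendsto_of_tendsto_of_tendsto_of_le_of_le' tendsto_const_nhds hlim
      (Eventually.of_forall fun _ => sq_nonneg _) hbound
  have h1 : Tendsto (fun m : ℕ => |m * ξ m j - η j|) atTop (𝓝 0) := by
    have := (Real.continuous_sqrt.tendsto 0).comp h0
    simpa [Function.comp_def, Real.sqrt_sq_eq_abs] using this
  have h2 := (tendsto_zero_iff_abs_tendsto_zero _).2 h1
  simpa using h2.add_const (η j)

/-! ### Integration over subsets of `E` in gap coordinates -/

lemma restrict_planeVolume_eq (N : ℕ) : ∃ c : NNReal, 0 < c ∧ ∀ D : Set (V (N + 1)),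
    (planeVolume (N + 1)).restrict D =
      c • ((volume : Measure (Fin N → ℝ)).restrict (ofGaps N ⁻¹' D)).map (ofGaps N) := by
  obtain ⟨c, hc, h⟩ := planeVolume_eq N
  refine ⟨c, hc, fun D => ?_⟩
  rw [h, Measure.restrict_smul, (measurableEmbedding_ofGaps N).restrict_map]

/-- The constant is chosen before the domain, so the integrals over the chamber and over the alcove
carry the same one. -/
lemma innerOn_eq (N : ℕ) : ∃ c : ℝ, 0 < c ∧ ∀ (D : Set (V (N + 1))) (φ ψ : V (N + 1) → ℂ),
    innerOn D φ ψ =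
      c * ∫ y in ofGaps N ⁻¹' D, φ (ofGaps N y) * (starRingEnd ℂ) (ψ (ofGaps N y)) := by
  obtain ⟨c, hc, h⟩ := restrict_planeVolume_eq N
  refine ⟨c, hc, fun D φ ψ => ?_⟩
  rw [innerOn, h, integral_smul_nnreal_measure, (measurableEmbedding_ofGaps N).integral_map]
  rfl

lemma memLp_planeVolume_of_gaps {N : ℕ} {D : Set (V (N + 1))} {φ : V (N + 1) → ℂ}
    (h : MemLp (fun y => φ (ofGaps N y)) 2
      ((volume : Measure (Fin N → ℝ)).restrict (ofGaps N ⁻¹' D))) :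
    MemLp φ 2 ((planeVolume (N + 1)).restrict D) := by
  obtain ⟨c, hc, hD⟩ := restrict_planeVolume_eq N
  rw [hD]
  have := (measurableEmbedding_ofGaps N).memLp_map_measure_iff.2 h
  exact this.smul_measure (c := (c : ENNReal)) ENNReal.coe_ne_top

lemma preimage_chamber (N : ℕ) : ofGaps N ⁻¹' chamber (N + 1) = {y | ∀ j, 0 < y j} := by
  ext y
  exact ofGaps_mem_chamber

lemma preimage_alcove (N : ℕ) :
    ofGaps N ⁻¹' alcove (N + 1) = {y | ∑ j, y j ≤ 1 ∧ ∀ j, 0 ≤ y j} := by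
  ext y
  exact ofGaps_mem_alcove

/-! ### Coordinate expressions of the wave functions -/

lemma inner_permute {n : ℕ} (x ξ : V n) (σ : Equiv.Perm (Fin n)) :
    inner ℝ x (permute σ ξ) = ∑ i, x i * ξ (σ.symm i) := by
  simp [PiLp.inner_apply, permute, mul_comm]

lemma inner_root_permute {n : ℕ} (ξ : V n) (σ : Equiv.Perm (Fin n)) (p : Fin n × Fin n) :
    inner ℝ (root p) (permute σ ξ) = ξ (σ.symm p.1) - ξ (σ.symm p.2) := by
  rw [inner_root_left]
  rfl

/-- A factor of the coefficients of the lattice wave function. -/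
def latticeFactor (t d : ℝ) : ℂ :=
  (1 - (t : ℂ) * Complex.exp (-(Complex.I * (d : ℂ)))) / (1 - Complex.exp (-(Complex.I * (d : ℂ))))

/-- A factor of the coefficients of the Lieb–Liniger wave function. -/
def liebLinigerFactor (g d : ℝ) : ℂ := ((d : ℂ) - Complex.I * (g : ℂ)) / (d : ℂ)

lemma hallLittlewood_eq (n : ℕ) (t : ℝ) (lam ξ : V n) :
    hallLittlewood n t lam ξ = ∑ σ : Equiv.Perm (Fin n),
      (∏ p ∈ posRoots n, latticeFactor t (ξ (σ.symm p.1) - ξ (σ.symm p.2))) *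
        Complex.exp (Complex.I * ((∑ i, lam i * ξ (σ.symm i) : ℝ) : ℂ)) := by
  simp only [hallLittlewood, inner_root_permute, latticeFactor]
  simp only [inner_permute]

lemma liebLinigerWave_eq (n : ℕ) (g : ℝ) (ξ x : V n) :
    liebLinigerWave n g ξ x = ∑ σ : Equiv.Perm (Fin n),
      (∏ p ∈ posRoots n, liebLinigerFactor g (ξ (σ.symm p.1) - ξ (σ.symm p.2))) *
        Complex.exp (Complex.I * ((∑ i, x i * ξ (σ.symm i) : ℝ) : ℂ)) := by
  simp only [liebLinigerWave, inner_root_permute, liebLinigerFactor]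
  simp only [inner_permute]

lemma norm_exp_I_mul_ofReal' (x : ℝ) : ‖Complex.exp (Complex.I * (x : ℂ))‖ = 1 := by
  rw [mul_comm, Complex.norm_exp_ofReal_mul_I]

lemma norm_hallLittlewood_le (n : ℕ) (t : ℝ) (lam ξ : V n) :
    ‖hallLittlewood n t lam ξ‖ ≤ ∑ σ : Equiv.Perm (Fin n),
      ‖∏ p ∈ posRoots n, latticeFactor t (ξ (σ.symm p.1) - ξ (σ.symm p.2))‖ := by
  rw [hallLittlewood_eq]
  refine (norm_sum_le _ _).trans (Finset.sum_le_sum fun σ _ => ?_)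
  rw [norm_mul, norm_exp_I_mul_ofReal', mul_one]

lemma continuous_liebLinigerWave (n : ℕ) (g : ℝ) (ξ : V n) :
    Continuous (liebLinigerWave n g ξ) := by
  simp only [funext (liebLinigerWave_eq n g ξ)]
  fun_prop

lemma strictAnti_of_mem_chamber {N : ℕ} {ξ : V (N + 1)} (h : ξ ∈ chamber (N + 1)) :
    StrictAnti ξ.ofLp :=
  Fin.strictAnti_iff_succ_lt.2 (mem_chamber_iff.1 h).2

/-- Since `t e^{-id} = e^{-(g + imd)/m}`, numerator and denominator both have the form `1 -
e^{-w/m}`, which is asymptotic to `w/m`; the quotient tends to `(g + i d₀)/(i d₀) = (d₀ - ig)/d₀`.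
-/
lemma tendsto_latticeFactor {g : ℝ} {d : ℕ → ℝ} {d₀ : ℝ} (hd₀ : d₀ ≠ 0)
    (hd : Tendsto (fun m : ℕ => (m : ℝ) * d m) atTop (𝓝 d₀)) :
    Tendsto (fun m : ℕ => latticeFactor (coupling g m) (d m)) atTop
      (𝓝 (liebLinigerFactor g d₀)) := by
  have hdc : Tendsto (fun m : ℕ => Complex.I * (((m : ℝ) * d m : ℝ) : ℂ)) atTop
      (𝓝 (Complex.I * (d₀ : ℂ))) :=
    ((Complex.continuous_ofReal.tendsto _).comp hd).const_mul _
  have hden := tendsto_nat_mul_one_sub_exp_neg hdc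
  have hnum := tendsto_nat_mul_one_sub_exp_neg (hdc.const_add (g : ℂ))
  have hne : Complex.I * (d₀ : ℂ) ≠ 0 := mul_ne_zero Complex.I_ne_zero (by exact_mod_cast hd₀)
  have h := hnum.div hden hne
  have e : ((g : ℂ) + Complex.I * d₀) / (Complex.I * d₀) = liebLinigerFactor g d₀ := by
    have : (d₀ : ℂ) ≠ 0 := by exact_mod_cast hd₀
    rw [liebLinigerFactor, div_eq_div_iff hne this]
    linear_combination ((g : ℂ) * d₀) * Complex.I_sq
  rw [e] at h
  refine h.congr' ?_
  filter_upwards [eventually_ge_atTop 1] with m hm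
  have hm0 : (m : ℂ) ≠ 0 := by exact_mod_cast (by omega : m ≠ 0)
  have e1 : -(Complex.I * (((m : ℝ) * d m : ℝ) : ℂ) / m) = -(Complex.I * (d m : ℂ)) := by
    push_cast
    field_simp
  have e2 : -(((g : ℂ) + Complex.I * (((m : ℝ) * d m : ℝ) : ℂ)) / m) =
      ((-(g / m) : ℝ) : ℂ) + -(Complex.I * (d m : ℂ)) := by
    push_cast
    field_simp
    ring
  simp only [Pi.div_apply]
  rw [e1, e2, Complex.exp_add, ← Complex.ofReal_exp, mul_div_mul_left _ _ hm0]
  rfl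

/-! ### The weight function -/

lemma weight_factor_mem {t : ℝ} (ht0 : 0 < t) (ht1 : t < 1) (h : ℕ) :
    0 ≤ (1 - t ^ h) / (1 - t ^ (1 + h)) ∧ (1 - t ^ h) / (1 - t ^ (1 + h)) ≤ 1 := by
  have h1 : t ^ (1 + h) < 1 := pow_lt_one₀ ht0.le ht1 (by omega)
  have h2 : t ^ (1 + h) ≤ t ^ h := pow_le_pow_of_le_one ht0.le ht1.le (by omega)
  have h3 : t ^ h ≤ 1 := pow_le_one₀ ht0.le ht1.le
  refine ⟨div_nonneg (by linarith) (by linarith), ?_⟩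
  rw [div_le_one (by linarith)]
  linarith

lemma height_le {n : ℕ} (p : Fin n × Fin n) : height p ≤ n := by
  unfold height
  omega

lemma latticeWeight_mem {n m : ℕ} {t : ℝ} (ht0 : 0 < t) (ht1 : t < 1) (lam : V n) :
    0 ≤ latticeWeight n m t lam ∧ latticeWeight n m t lam ≤ 1 := by
  have h1 := fun p : Fin n × Fin n => weight_factor_mem ht0 ht1 (height p)
  have h2 : ∀ p : Fin n × Fin n, 0 ≤ (1 - t ^ (n - height p)) / (1 - t ^ (1 + n - height p)) ∧
      (1 - t ^ (n - height p)) / (1 - t ^ (1 + n - height p)) ≤ 1 := by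
    intro p
    rw [Nat.add_sub_assoc (height_le p)]
    exact weight_factor_mem ht0 ht1 _
  unfold latticeWeight
  exact ⟨mul_nonneg (Finset.prod_nonneg fun p _ => (h1 p).1)
      (Finset.prod_nonneg fun p _ => (h2 p).1),
    mul_le_one₀ (Finset.prod_le_one (fun p _ => (h1 p).1) fun p _ => (h1 p).2)
      (Finset.prod_nonneg fun p _ => (h2 p).1)
      (Finset.prod_le_one (fun p _ => (h2 p).1) fun p _ => (h2 p).2)⟩

/-- In the interior of the lattice alcove no positive root takes the value `0` or `m`, so both
products are empty. -/
lemma latticeWeight_eq_one {N m : ℕ} (t : ℝ) {k : Fin N → ℕ} (hk : ∀ j, 1 ≤ k j)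
    (hkm : ∑ j, k j < m) : latticeWeight (N + 1) m t (ofGaps N fun j => (k j : ℝ)) = 1 := by
  have h : ∀ p ∈ posRoots (N + 1),
      0 < inner ℝ (ofGaps N fun j => (k j : ℝ)) (root p) ∧
        inner ℝ (ofGaps N fun j => (k j : ℝ)) (root p) < m := by
    intro p hp
    have hp' : p.1 < p.2 := by simpa [posRoots] using hp
    have hpv : p.1.val < p.2.val := hp'
    rw [inner_root, ofGaps_sub _ hp'.le]
    constructor
    · refine Finset.sum_pos' (fun j _ => by split_ifs <;> positivity)
        ⟨⟨p.1.val, by omega⟩, Finset.mem_univ _, ?_⟩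
      rw [if_pos ⟨le_rfl, hpv⟩]
      exact_mod_cast hk _
    · calc _ ≤ ∑ j, (k j : ℝ) := Finset.sum_le_sum fun j _ => by split_ifs <;> simp
        _ < m := by exact_mod_cast hkm
  unfold latticeWeight
  rw [Finset.filter_false_of_mem fun p hp => (h p hp).1.ne',
    Finset.filter_false_of_mem fun p hp => (h p hp).2.ne]
  simp

/-! ### The staircase functions in gap coordinates -/

lemma staircaseWave_ofGaps {N : ℕ} (m : ℕ) (g : ℝ) (ξ : V (N + 1)) (y : Fin N → ℝ) :
    staircaseWave (N + 1) m g ξ (ofGaps N y) =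
      if ∑ j, ⌊(m : ℝ) * y j⌋₊ ≤ m then
        (Real.sqrt (latticeWeight (N + 1) m (coupling g m)
          (ofGaps N fun j => (⌊(m : ℝ) * y j⌋₊ : ℝ))) : ℂ) *
          hallLittlewood (N + 1) (coupling g m) (ofGaps N fun j => (⌊(m : ℝ) * y j⌋₊ : ℝ)) ξ
      else 0 := by
  simp only [staircaseWave, staircase, intPart_smul_ofGaps, ofGaps_mem_latticeAlcove]

lemma measurable_floor_gaps {N : ℕ} (m : ℕ) :
    Measurable fun (y : Fin N → ℝ) (j : Fin N) => ⌊(m : ℝ) * y j⌋₊ :=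
  measurable_pi_lambda _ fun j => Nat.measurable_floor.comp ((measurable_pi_apply j).const_mul _)

/-- The function factors through the measurable map to the discrete space of floor vectors. -/
lemma measurable_staircaseWave_ofGaps {N : ℕ} (m : ℕ) (g : ℝ) (ξ : V (N + 1)) :
    Measurable fun y => staircaseWave (N + 1) m g ξ (ofGaps N y) := by
  simp only [staircaseWave_ofGaps]
  exact (Measurable.of_discrete (f := fun k : Fin N → ℕ => if ∑ j, k j ≤ m then
        (Real.sqrt (latticeWeight (N + 1) m (coupling g m)
          (ofGaps N fun j => (k j : ℝ))) : ℂ) *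
          hallLittlewood (N + 1) (coupling g m) (ofGaps N fun j => (k j : ℝ)) ξ
      else 0)).comp (measurable_floor_gaps m)

lemma norm_staircaseWave_le {N m : ℕ} (hm : 1 ≤ m) {g : ℝ} (hg : 0 < g) (ξ : V (N + 1))
    (y : Fin N → ℝ) :
    ‖staircaseWave (N + 1) m g ξ (ofGaps N y)‖ ≤ ∑ σ : Equiv.Perm (Fin (N + 1)),
      ‖∏ p ∈ posRoots (N + 1),
        latticeFactor (coupling g m) (ξ (σ.symm p.1) - ξ (σ.symm p.2))‖ := by
  rw [staircaseWave_ofGaps]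
  split_ifs
  · rw [norm_mul, Complex.norm_real, Real.norm_of_nonneg (Real.sqrt_nonneg _)]
    have h := latticeWeight_mem (n := N + 1) (m := m) (coupling_pos g m) (coupling_lt_one hg hm)
      (ofGaps N fun j => (⌊(m : ℝ) * y j⌋₊ : ℝ))
    calc _ ≤ 1 * ‖hallLittlewood (N + 1) (coupling g m)
          (ofGaps N fun j => (⌊(m : ℝ) * y j⌋₊ : ℝ)) ξ‖ := by
          gcongr
          exact Real.sqrt_le_one.2 h.2
      _ ≤ _ := by
          rw [one_mul]
          exact norm_hallLittlewood_le _ _ _ _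
  · rw [norm_zero]
    positivity

/-- Each floor is at most `m`, so `m y_j < m + 1 ≤ 2m`. The bound does not depend on `m`, which
gives all staircase functions a common box. -/
lemma lt_two_of_staircaseWave_ne_zero {N m : ℕ} (hm : 1 ≤ m) {g : ℝ} {ξ : V (N + 1)}
    {y : Fin N → ℝ} (h : staircaseWave (N + 1) m g ξ (ofGaps N y) ≠ 0) (j : Fin N) :
    y j < 2 := by
  rw [staircaseWave_ofGaps] at h
  have hk : ∑ j, ⌊(m : ℝ) * y j⌋₊ ≤ m := by
    by_contra hk
    exact h (if_neg hk)
  have h1 : ⌊(m : ℝ) * y j⌋₊ ≤ m :=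
    (Finset.single_le_sum (f := fun j => ⌊(m : ℝ) * y j⌋₊) (fun _ _ => Nat.zero_le _)
      (Finset.mem_univ j)).trans hk
  have h2 := Nat.lt_floor_add_one ((m : ℝ) * y j)
  have h3 : (⌊(m : ℝ) * y j⌋₊ : ℝ) ≤ m := by exact_mod_cast h1
  have h4 : (1 : ℝ) ≤ m := by exact_mod_cast hm
  by_contra! h5
  nlinarith

/-- A box containing the supports of the staircase functions. -/
def gapBox (N : ℕ) : Set (Fin N → ℝ) := Set.Icc 0 (fun _ => 2)

lemma measure_gapBox_lt_top (N : ℕ) : volume (gapBox N) < ⊤ :=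
  isCompact_Icc.measure_lt_top

lemma measurableSet_gaps_pos (N : ℕ) : MeasurableSet {y : Fin N → ℝ | ∀ j, 0 < y j} := by
  simp only [Set.ofPred_forall]
  exact MeasurableSet.iInter fun j => measurableSet_lt measurable_const (measurable_pi_apply j)

lemma memLp_staircaseWave {N m : ℕ} (hm : 1 ≤ m) {g : ℝ} (hg : 0 < g) (ξ : V (N + 1)) :
    MemLp (staircaseWave (N + 1) m g ξ) 2 ((planeVolume (N + 1)).restrict (chamber (N + 1))) := by
  refine memLp_planeVolume_of_gaps ?_
  rw [preimage_chamber]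
  set M := ∑ σ : Equiv.Perm (Fin (N + 1)), ‖∏ p ∈ posRoots (N + 1),
        latticeFactor (coupling g m) (ξ (σ.symm p.1) - ξ (σ.symm p.2))‖
  have hb : MemLp ((gapBox N).indicator fun _ => M) 2
      ((volume : Measure (Fin N → ℝ)).restrict {y | ∀ j, 0 < y j}) :=
    (memLp_indicator_const 2 measurableSet_Icc M
      (Or.inr (measure_gapBox_lt_top N).ne)).restrict _
  refine hb.mono (measurable_staircaseWave_ofGaps m g ξ).aestronglyMeasurable ?_
  refine (ae_restrict_iff' (measurableSet_gaps_pos N)).2 (Eventually.of_forall fun y hy => ?_)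
  by_cases h0 : staircaseWave (N + 1) m g ξ (ofGaps N y) = 0
  · rw [h0, norm_zero]
    exact norm_nonneg _
  · have : y ∈ gapBox N :=
      ⟨fun j => (hy j).le, fun j => (lt_two_of_staircaseWave_ne_zero hm h0 j).le⟩
    rw [Set.indicator_of_mem this]
    exact (norm_staircaseWave_le hm hg ξ y).trans (le_abs_self _)

lemma isCompact_preimage_alcove (N : ℕ) : IsCompact (ofGaps N ⁻¹' alcove (N + 1)) := by
  rw [preimage_alcove]
  refine (isCompact_Icc (a := (0 : Fin N → ℝ)) (b := fun _ => 1)).of_isClosed_subset ?_ ?_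
  · refine IsClosed.inter (isClosed_le (f := fun y : Fin N → ℝ => ∑ j, y j) (g := fun _ => 1)
      (by fun_prop) continuous_const) ?_
    change IsClosed {y : Fin N → ℝ | ∀ j, 0 ≤ y j}
    simp only [Set.ofPred_forall]
    exact isClosed_iInter fun j => isClosed_le continuous_const (continuous_apply j)
  · rintro y ⟨h1, h2⟩
    exact ⟨h2, fun j => (Finset.single_le_sum (fun i _ => h2 i) (Finset.mem_univ j)).trans h1⟩

lemma continuous_ofGaps (N : ℕ) : Continuous (ofGaps N) :=
  LinearMap.continuous_of_finiteDimensional _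

lemma memLp_liebLinigerWave {N : ℕ} (g : ℝ) (ξ : V (N + 1)) :
    MemLp (liebLinigerWave (N + 1) g ξ) 2
      ((planeVolume (N + 1)).restrict (alcove (N + 1))) := by
  refine memLp_planeVolume_of_gaps ?_
  have hK := isCompact_preimage_alcove N
  have hc := (continuous_liebLinigerWave (N + 1) g ξ).comp (continuous_ofGaps N)
  obtain ⟨M, hM⟩ := hK.exists_bound_of_continuousOn hc.continuousOn
  have : IsFiniteMeasure ((volume : Measure (Fin N → ℝ)).restrict (ofGaps N ⁻¹' alcove (N + 1))) :=
    ⟨by simpa using hK.measure_lt_top⟩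
  exact MemLp.of_bound hc.aestronglyMeasurable M
    ((ae_restrict_iff' hK.isClosed.measurableSet).2 (Eventually.of_forall hM))

/-! ### Pointwise limits -/

lemma tendsto_hallLittlewood {n : ℕ} {g : ℝ} {ξ : ℕ → V n} {η : V n}
    (hη : Function.Injective η.ofLp)
    (hξ : ∀ j, Tendsto (fun m : ℕ => (m : ℝ) * ξ m j) atTop (𝓝 (η j)))
    {lam : ℕ → V n} {x : V n}
    (hlam : ∀ j, Tendsto (fun m : ℕ => lam m j / (m : ℝ)) atTop (𝓝 (x j))) :
    Tendsto (fun m : ℕ => hallLittlewood n (coupling g m) (lam m) (ξ m)) atTop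
      (𝓝 (liebLinigerWave n g η x)) := by
  simp only [hallLittlewood_eq, liebLinigerWave_eq]
  refine tendsto_finsetSum _ fun σ _ => Tendsto.mul (tendsto_finsetProd _ fun p hp => ?_) ?_
  · have hp' : p.1 < p.2 := by simpa [posRoots] using hp
    refine tendsto_latticeFactor ?_ ?_
    · rw [sub_ne_zero]
      intro h
      exact hp'.ne (σ.symm.injective (hη h))
    · simp only [mul_sub]
      exact (hξ _).sub (hξ _)
  · refine (Complex.continuous_exp.tendsto _).comp (Tendsto.const_mul _
      ((Complex.continuous_ofReal.tendsto _).comp ?_))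
    -- The exponent is split as `(λ/m) · (mξ)`, both factors being convergent.
    have h : Tendsto (fun m : ℕ => ∑ i, lam m i / (m : ℝ) * (m * ξ m (σ.symm i))) atTop
        (𝓝 (∑ i, x i * η (σ.symm i))) :=
      tendsto_finsetSum _ fun i _ => (hlam i).mul (hξ _)
    refine h.congr' ?_
    filter_upwards [eventually_ge_atTop 1] with m hm
    have hm0 : (m : ℝ) ≠ 0 := by exact_mod_cast (by omega : m ≠ 0)
    refine Finset.sum_congr rfl fun i _ => ?_
    field_simp

lemma tendsto_ofGaps_floor_div {N : ℕ} {y : Fin N → ℝ} (hy : ∀ j, 0 ≤ y j) (i : Fin (N + 1)) :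
    Tendsto (fun m : ℕ => ofGaps N (fun j => (⌊(m : ℝ) * y j⌋₊ : ℝ)) i / (m : ℝ)) atTop
      (𝓝 (ofGaps N y i)) := by
  have h : Tendsto (fun (m : ℕ) (j : Fin N) => (⌊(m : ℝ) * y j⌋₊ : ℝ) / m) atTop (𝓝 y) := by
    refine tendsto_pi_nhds.2 fun j => ?_
    have := (tendsto_nat_floor_mul_div_atTop (hy j)).comp tendsto_natCast_atTop_atTop
    simpa [Function.comp_def, mul_comm] using this
  have hc : Continuous fun y => ofGaps N y i := (PiLp.continuous_apply 2 _ i).comp (continuous_ofGaps N)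
  refine ((hc.tendsto y).comp h).congr fun m => ?_
  have : (fun j => (⌊(m : ℝ) * y j⌋₊ : ℝ) / m) =
      (m : ℝ)⁻¹ • fun j => (⌊(m : ℝ) * y j⌋₊ : ℝ) := by
    ext j
    simp [div_eq_inv_mul]
  simp only [Function.comp_apply]
  rw [this, map_smul]
  simp [div_eq_inv_mul]

lemma tendsto_staircaseWave {N : ℕ} {g : ℝ} {ξ : ℕ → V (N + 1)} {η : V (N + 1)}
    (hη : Function.Injective η.ofLp)
    (hξ : ∀ j, Tendsto (fun m : ℕ => (m : ℝ) * ξ m j) atTop (𝓝 (η j)))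
    {y : Fin N → ℝ} (hy : ∀ j, 0 < y j) (hy1 : ∑ j, y j < 1) :
    Tendsto (fun m : ℕ => staircaseWave (N + 1) m g (ξ m) (ofGaps N y)) atTop
      (𝓝 (liebLinigerWave (N + 1) g η (ofGaps N y))) := by
  refine (tendsto_hallLittlewood (g := g) hη hξ
    (tendsto_ofGaps_floor_div fun j => (hy j).le)).congr' ?_
  have hlarge : ∀ᶠ m : ℕ in atTop, ∀ j, 1 ≤ (m : ℝ) * y j := by
    refine eventually_all.2 fun j => ?_
    exact (tendsto_natCast_atTop_atTop.atTop_mul_const (hy j)).eventually_ge_atTop 1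
  filter_upwards [hlarge, eventually_ge_atTop 1] with m hm hm1
  have hm0 : (0 : ℝ) < m := by exact_mod_cast hm1
  have h1 : ∀ j, 1 ≤ ⌊(m : ℝ) * y j⌋₊ := fun j => Nat.le_floor (by simpa using hm j)
  have h2 : ∑ j, ⌊(m : ℝ) * y j⌋₊ < m := by
    have : ∑ j, (⌊(m : ℝ) * y j⌋₊ : ℝ) < m := by
      calc _ ≤ ∑ j, (m : ℝ) * y j :=
            Finset.sum_le_sum fun j _ => Nat.floor_le (mul_pos hm0 (hy j)).le
        _ = m * ∑ j, y j := by rw [Finset.mul_sum]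
        _ < m := by nlinarith
    exact_mod_cast this
  rw [staircaseWave_ofGaps, if_pos h2.le, latticeWeight_eq_one _ h1 h2]
  simp

/-- Rounding down loses at most `1` in each of the `N` gaps, so the floors still add up to more than
`m` once `m (∑ y_j - 1) > N`. -/
lemma eventually_staircaseWave_eq_zero {N : ℕ} (g : ℝ) (ξ : ℕ → V (N + 1)) {y : Fin N → ℝ}
    (hy1 : 1 < ∑ j, y j) :
    ∀ᶠ m : ℕ in atTop, staircaseWave (N + 1) m g (ξ m) (ofGaps N y) = 0 := by
  have h := (tendsto_natCast_atTop_atTop (R := ℝ)).atTop_mul_const (sub_pos.2 hy1)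
  filter_upwards [h.eventually_gt_atTop (N : ℝ)] with m hm
  rw [staircaseWave_ofGaps, if_neg]
  intro hle
  have h1 : ∑ j, ((m : ℝ) * y j - 1) ≤ ∑ j, (⌊(m : ℝ) * y j⌋₊ : ℝ) :=
    Finset.sum_le_sum fun j _ => (Nat.sub_one_lt_floor _).le
  have h2 : ∑ j, (⌊(m : ℝ) * y j⌋₊ : ℝ) ≤ m := by exact_mod_cast hle
  rw [Finset.sum_sub_distrib, ← Finset.mul_sum] at h1
  simp at h1
  linarith

/-- The sum of the absolute values of the coefficients bounds the function uniformly in `y`, and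
this sum converges as `m` grows. -/
lemma eventually_norm_staircaseWave_le {N : ℕ} {g : ℝ} (hg : 0 < g) {ξ : ℕ → V (N + 1)}
    {η : V (N + 1)} (hη : Function.Injective η.ofLp)
    (hξ : ∀ j, Tendsto (fun m : ℕ => (m : ℝ) * ξ m j) atTop (𝓝 (η j))) :
    ∃ M, ∀ᶠ m : ℕ in atTop, ∀ y, ‖staircaseWave (N + 1) m g (ξ m) (ofGaps N y)‖ ≤ M := by
  have h : Tendsto (fun m : ℕ => ∑ σ : Equiv.Perm (Fin (N + 1)), ‖∏ p ∈ posRoots (N + 1),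
        latticeFactor (coupling g m) (ξ m (σ.symm p.1) - ξ m (σ.symm p.2))‖) atTop
      (𝓝 (∑ σ : Equiv.Perm (Fin (N + 1)), ‖∏ p ∈ posRoots (N + 1),
        liebLinigerFactor g (η (σ.symm p.1) - η (σ.symm p.2))‖)) := by
    refine tendsto_finsetSum _ fun σ _ => Tendsto.norm (tendsto_finsetProd _ fun p hp => ?_)
    have hp' : p.1 < p.2 := by simpa [posRoots] using hp
    refine tendsto_latticeFactor ?_ ?_
    · rw [sub_ne_zero]
      intro h
      exact hp'.ne (σ.symm.injective (hη h))
    · simp only [mul_sub]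
      exact (hξ _).sub (hξ _)
  obtain ⟨M, hM⟩ := exists_gt (∑ σ : Equiv.Perm (Fin (N + 1)), ‖∏ p ∈ posRoots (N + 1),
        liebLinigerFactor g (η (σ.symm p.1) - η (σ.symm p.2))‖)
  refine ⟨M, ?_⟩
  filter_upwards [h.eventually_le_const hM, eventually_ge_atTop 1] with m hm hm1 y
  exact (norm_staircaseWave_le hm1 hg (ξ m) y).trans hm

/-! ### Convergence of the inner products -/

lemma volume_gaps_sum_eq_one (N : ℕ) :
    volume {y : Fin N → ℝ | ∑ j, y j = 1} = 0 := by
  let L : (Fin N → ℝ) →ₗ[ℝ] ℝ := ∑ j, LinearMap.proj j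
  let s : AffineSubspace ℝ (Fin N → ℝ) := (affineSpan ℝ {(1 : ℝ)}).comap L.toAffineMap
  have hs : (s : Set (Fin N → ℝ)) = {y | ∑ j, y j = 1} := by
    ext y
    simp [s, L]
  rw [← hs]
  refine Measure.addHaar_affineSubspace volume s fun htop => ?_
  have : (0 : Fin N → ℝ) ∈ (s : Set (Fin N → ℝ)) := by rw [htop]; trivial
  rw [hs] at this
  simp at this

lemma preimage_alcove_ae_eq (N : ℕ) :
    (ofGaps N ⁻¹' alcove (N + 1) : Set (Fin N → ℝ)) =ᵐ[volume]
      ({y | ∑ j, y j ≤ 1} ∩ {y | ∀ j, 0 < y j} : Set (Fin N → ℝ)) := by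
  have h : ∀ᵐ y : Fin N → ℝ ∂volume, ∀ j, y j ≠ 0 := by
    refine ae_all_iff.2 fun j => ?_
    have := Measure.pi_hyperplane (fun _ : Fin N => (volume : Measure ℝ)) j 0
    rw [ae_iff]
    simpa [volume_pi] using this
  filter_upwards [h] with y hy
  rw [preimage_alcove]
  refine propext ⟨fun h => ⟨h.1, fun j => lt_of_le_of_ne (h.2 j) (hy j).symm⟩,
    fun h => ⟨h.1, fun j => (h.2 j).le⟩⟩

lemma tendsto_innerOn {N : ℕ} {g : ℝ} (hg : 0 < g) {ξ ξ' : ℕ → V (N + 1)} {η η' : V (N + 1)}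
    (hη : Function.Injective η.ofLp) (hη' : Function.Injective η'.ofLp)
    (hξ : ∀ j, Tendsto (fun m : ℕ => (m : ℝ) * ξ m j) atTop (𝓝 (η j)))
    (hξ' : ∀ j, Tendsto (fun m : ℕ => (m : ℝ) * ξ' m j) atTop (𝓝 (η' j))) :
    Tendsto (fun m : ℕ => innerOn (chamber (N + 1)) (staircaseWave (N + 1) m g (ξ m))
        (staircaseWave (N + 1) m g (ξ' m))) atTop
      (𝓝 (innerOn (alcove (N + 1)) (liebLinigerWave (N + 1) g η)
        (liebLinigerWave (N + 1) g η'))) := by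
  obtain ⟨c, -, hc⟩ := innerOn_eq N
  simp only [hc]
  refine Tendsto.const_mul _ ?_
  have hmeas1 : MeasurableSet {y : Fin N → ℝ | ∑ j, y j ≤ 1} :=
    (isClosed_le (by fun_prop) continuous_const).measurableSet
  -- Up to a null set, the integral over the alcove is the integral over the chamber of a function
  -- cut off at `∑ y_j ≤ 1`. Both sides then use the same measure, as dominated convergence
  -- requires.
  rw [setIntegral_congr_set (preimage_alcove_ae_eq N), preimage_chamber,
    Set.inter_comm, ← setIntegral_indicator hmeas1]
  obtain ⟨M, hM⟩ := eventually_norm_staircaseWave_le hg hη hξ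
  obtain ⟨M', hM'⟩ := eventually_norm_staircaseWave_le hg hη' hξ'
  refine tendsto_integral_filter_of_dominated_convergence
    ((gapBox N).indicator fun _ => M * M') ?_ ?_ ?_ ?_
  · refine Eventually.of_forall fun m => Measurable.aestronglyMeasurable ?_
    exact (measurable_staircaseWave_ofGaps m g _).mul
      (Complex.continuous_conj.measurable.comp (measurable_staircaseWave_ofGaps m g _))
  · filter_upwards [hM, hM', eventually_ge_atTop 1] with m h h' hm
    refine (ae_restrict_iff' (measurableSet_gaps_pos N)).2 (Eventually.of_forall fun y hy => ?_)
    rw [norm_mul, RCLike.norm_conj]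
    by_cases h0 : staircaseWave (N + 1) m g (ξ m) (ofGaps N y) = 0
    · rw [h0, norm_zero, zero_mul]
      refine Set.indicator_nonneg (fun z _ => ?_) _
      exact mul_nonneg ((norm_nonneg _).trans (h 0)) ((norm_nonneg _).trans (h' 0))
    · have : y ∈ gapBox N :=
        ⟨fun j => (hy j).le, fun j => (lt_two_of_staircaseWave_ne_zero hm h0 j).le⟩
      rw [Set.indicator_of_mem this]
      exact mul_le_mul (h y) (h' y) (norm_nonneg _) ((norm_nonneg _).trans (h y))
  · refine Integrable.integrableOn ?_
    exact (integrable_indicator_iff measurableSet_Icc).2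
      (integrableOn_const (measure_gapBox_lt_top N).ne)
  · have h1 : ∀ᵐ y : Fin N → ℝ ∂volume, ∑ j, y j ≠ 1 := by
      rw [ae_iff]
      simpa using volume_gaps_sum_eq_one N
    refine (ae_restrict_iff' (measurableSet_gaps_pos N)).2 ?_
    filter_upwards [h1] with y hy1 hy
    rcases lt_or_gt_of_ne hy1 with hlt | hgt
    · rw [Set.indicator_of_mem (by exact hlt.le)]
      exact (tendsto_staircaseWave hη hξ hy hlt).mul
        ((Complex.continuous_conj.tendsto _).comp (tendsto_staircaseWave hη' hξ' hy hlt))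
    · rw [Set.indicator_of_notMem (by exact not_le.2 hgt)]
      refine tendsto_const_nhds.congr' ?_
      filter_upwards [eventually_staircaseWave_eq_zero g ξ hgt] with m hm
      rw [hm, zero_mul]

/-! ### Sorting binary words: a `t`-multinomial identity for functions with the exchange relation -/

section Sorting

variable {K : Type*} [Field K]

/-- The `t`-integer `1 + t + ⋯ + t^(h-1)`. -/
def qInt (t : K) (h : ℕ) : K := ∑ i ∈ Finset.range h, t ^ i

lemma qInt_zero (t : K) : qInt t 0 = 0 := by simp [qInt]

lemma qInt_one (t : K) : qInt t 1 = 1 := by simp [qInt]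

lemma qInt_add (t : K) (a b : ℕ) : qInt t (a + b) = qInt t a + t ^ a * qInt t b := by
  simp [qInt, Finset.sum_range_add, Finset.mul_sum, pow_add]

/-- The length of the first run: one plus the number of initial open bonds. -/
def firstRun : ℕ → (ℕ → Bool) → ℕ
  | 0, _ => 1
  | n + 1, b => if b 0 then 1 + firstRun n (fun l => b (l + 1)) else 1

/-- The product of inverse `t`-factorials of the lengths of the runs. -/
def runWeight (t : K) : ℕ → (ℕ → Bool) → K
  | 0, _ => 1
  | n + 1, b => runWeight t n (fun l => b (l + 1)) * (qInt t (firstRun (n + 1) b))⁻¹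

/-- The number of leading ones of a word within its first run. -/
def leadingOnes : (n : ℕ) → (ℕ → Bool) → (Fin (n + 1) → Bool) → ℕ
  | 0, _, ε => if ε 0 then 1 else 0
  | n + 1, b, ε => if ε 0 then
      (if b 0 then 1 + leadingOnes n (fun l => b (l + 1)) (Fin.tail ε) else 1) else 0

/-- The weight of a word, zero unless all runs are sorted. -/
def wordWeight (t : K) : (n : ℕ) → (ℕ → Bool) → (Fin (n + 1) → Bool) → K
  | 0, _, _ => 1
  | n + 1, b, ε => wordWeight t n (fun l => b (l + 1)) (Fin.tail ε) *
      (if b 0 then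
        if ε 0 then (qInt t (1 + leadingOnes n (fun l => b (l + 1)) (Fin.tail ε)))⁻¹
        else if Fin.tail ε 0 then 0 else (qInt t (1 + firstRun n (fun l => b (l + 1))))⁻¹
      else 1)

/-- The exchange relation along the open bonds. -/
def HasExchange (t : K) (n : ℕ) (b : ℕ → Bool) (G : (Fin (n + 1) → Bool) → K) : Prop :=
  ∀ (j : Fin n) (ε : Fin (n + 1) → Bool), b j = true → ε j.castSucc = false → ε j.succ = true →
    G ε = t * G (ε ∘ Equiv.swap j.castSucc j.succ)

variable {t : K}

lemma sum_word_cons {n : ℕ} {M : Type*} [AddCommMonoid M] (G : (Fin (n + 1) → Bool) → M) :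
    ∑ ε, G ε = ∑ ε : Fin n → Bool, G (Fin.cons true ε) + ∑ ε : Fin n → Bool, G (Fin.cons false ε) := by
  rw [← (Fin.consEquiv (fun _ : Fin (n + 1) => Bool)).sum_comp, Fintype.sum_prod_type,
    Fintype.sum_bool]
  rfl

lemma HasExchange.tail {n : ℕ} {b : ℕ → Bool} {G : (Fin (n + 2) → Bool) → K}
    (h : HasExchange t (n + 1) b G) (x : Bool) :
    HasExchange t n (fun l => b (l + 1)) (fun ε => G (Fin.cons x ε)) := by
  intro j ε hb h0 h1
  have h2 := h j.succ (Fin.cons x ε) hb (by rw [Fin.castSucc_succ, Fin.cons_succ, h0])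
    (by rw [Fin.cons_succ, h1])
  refine h2.trans ?_
  congr 2
  ext i
  refine Fin.cases ?_ (fun i => ?_) i
  · simp only [Function.comp_apply, Fin.cons_zero, Fin.castSucc_succ]
    rw [Equiv.swap_apply_of_ne_of_ne (Fin.succ_ne_zero _).symm (Fin.succ_ne_zero _).symm,
      Fin.cons_zero]
  · have : Equiv.swap (Fin.succ j).castSucc (Fin.succ j).succ (Fin.succ i) =
        (Equiv.swap j.castSucc j.succ i).succ := by
      rw [Fin.castSucc_succ]
      exact (Function.Injective.map_swap (Fin.succ_injective _) _ _ _).symm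
    simp only [Function.comp_apply, this, Fin.cons_succ]

lemma HasExchange.head {n : ℕ} {b : ℕ → Bool} {G : (Fin (n + 2) → Bool) → K}
    (h : HasExchange t (n + 1) b G) (hb : b 0 = true) (ε : Fin n → Bool) :
    G (Fin.cons false (Fin.cons true ε)) = t * G (Fin.cons true (Fin.cons false ε)) := by
  have h2 := h 0 (Fin.cons false (Fin.cons true ε)) hb (by simp) (by simp)
  rw [h2]
  congr 2
  ext i
  refine Fin.cases ?_ (fun i => Fin.cases ?_ (fun i => ?_) i) i
  · simp
  · have : (Fin.succ 0 : Fin (n + 2)) = Fin.succ (0 : Fin (n + 1)) := rfl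
    simp
  · simp only [Function.comp_apply, Fin.castSucc_zero]
    rw [Equiv.swap_apply_of_ne_of_ne (Fin.succ_ne_zero _)
      (fun h => Fin.succ_ne_zero i (Fin.succ_injective _ h))]
    rfl

lemma leadingOnes_le_firstRun : ∀ (n : ℕ) (b : ℕ → Bool) (ε : Fin (n + 1) → Bool),
    leadingOnes n b ε ≤ firstRun n b
  | 0, b, ε => by simp only [leadingOnes, firstRun]; split_ifs <;> omega
  | n + 1, b, ε => by
    have := leadingOnes_le_firstRun n (fun l => b (l + 1)) (Fin.tail ε)
    simp only [leadingOnes, firstRun]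
    split_ifs <;> omega

lemma leadingOnes_eq_zero_iff : ∀ (n : ℕ) (b : ℕ → Bool) (ε : Fin (n + 1) → Bool),
    leadingOnes n b ε = 0 ↔ ε 0 = false
  | 0, b, ε => by simp [leadingOnes]
  | n + 1, b, ε => by
    simp only [leadingOnes]
    split_ifs <;> simp_all

/-- Moving a leading zero through a sorted first run. -/
lemma sum_wordWeight_insert (ht : ∀ h, qInt t (h + 1) ≠ 0) :
    ∀ (n : ℕ) (b : ℕ → Bool) (f : ℕ → K) (G : (Fin (n + 2) → Bool) → K), b 0 = true →
      HasExchange t (n + 1) b G →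
      ∑ ε, f (leadingOnes n (fun l => b (l + 1)) ε) * wordWeight t n (fun l => b (l + 1)) ε *
        G (Fin.cons false ε) =
      ∑ ε, (if ε 0 then 0 else f 0 * wordWeight t n (fun l => b (l + 1)) ε *
        G (Fin.cons false ε)) +
      ∑ ε, f (leadingOnes n (fun l => b (l + 1)) ε + 1) * wordWeight t n (fun l => b (l + 1)) ε *
        (qInt t (firstRun n (fun l => b (l + 1)) - leadingOnes n (fun l => b (l + 1)) ε) *
          (qInt t (leadingOnes n (fun l => b (l + 1)) ε + 1))⁻¹ *
          t ^ (leadingOnes n (fun l => b (l + 1)) ε + 1)) * G (Fin.cons true ε)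
  | 0, b, f, G, hb, hG => by
    simp only [sum_word_cons, leadingOnes, wordWeight, firstRun, Fin.cons_zero, if_true,
      Bool.false_eq_true, if_false, hG.head hb, Finset.univ_unique, Finset.sum_singleton]
    simp [qInt_zero, qInt_one]
    ring
  | n + 1, b, f, G, hb, hG => by
    rw [sum_word_cons, sum_word_cons (n := n + 1), sum_word_cons (n := n + 1)]
    simp only [Fin.cons_zero, if_true, Bool.false_eq_true, if_false, Finset.sum_const_zero, zero_add,
      hG.head hb, leadingOnes, wordWeight, Fin.tail_cons, firstRun]
    by_cases hb1 : b 1 = true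
    · have h01 : b (0 + 1) = true := hb1
      simp only [h01, if_true]
      set b' : ℕ → Bool := fun l => b (l + 1) with hb'
      have hG' : HasExchange t (n + 1) b' (fun ε => G (Fin.cons true ε)) := hG.tail true
      -- The zero passes the first one at the cost of a factor `t` and must still traverse the
      -- remaining word. The factor `[1 + r]⁻¹` is the weight contributed by that first one, and the
      -- number of leading ones of the remaining word has dropped by one.
      have ih := sum_wordWeight_insert ht n b'
        (fun r => f (1 + r) * (qInt t (1 + r))⁻¹ * t) _ hb1 hG'
      have e1 : ∑ ε, f (1 + leadingOnes n (fun l => b (l + 1 + 1)) ε) *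
          (wordWeight t n (fun l => b (l + 1 + 1)) ε *
            (qInt t (1 + leadingOnes n (fun l => b (l + 1 + 1)) ε))⁻¹) *
          (t * G (Fin.cons true (Fin.cons false ε))) =
          ∑ ε, f (1 + leadingOnes n (fun l => b' (l + 1)) ε) *
            (qInt t (1 + leadingOnes n (fun l => b' (l + 1)) ε))⁻¹ * t *
            wordWeight t n (fun l => b' (l + 1)) ε * G (Fin.cons true (Fin.cons false ε)) :=
        Finset.sum_congr rfl fun ε _ => by simp only [hb']; ring
      rw [e1, ih]
      rw [add_comm]
      congr 1
      refine (add_comm _ _).trans ?_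
      congr 1
      · refine Finset.sum_congr rfl fun ε _ => ?_
        have e2 : 1 + firstRun n (fun l => b' (l + 1)) -
            (1 + leadingOnes n (fun l => b' (l + 1)) ε) =
            firstRun n (fun l => b' (l + 1)) - leadingOnes n (fun l => b' (l + 1)) ε := by omega
        simp only [hb'] at e2 ⊢
        rw [e2]
        have e3 : 1 + (leadingOnes n (fun l => b (l + 1 + 1)) ε + 1) =
          1 + leadingOnes n (fun l => b (l + 1 + 1)) ε + 1 := by omega
        rw [e3, add_comm (leadingOnes n (fun l => b (l + 1 + 1)) ε) 1]
        ring
      · refine Finset.sum_congr rfl fun ε _ => ?_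
        have hL := ht (firstRun n (fun l => b (l + 1 + 1)))
        rw [add_comm] at hL
        simp only [hb']
        split_ifs with h
        · ring
        · simp only [add_zero, Nat.sub_zero, qInt_one, pow_one]
          field_simp
    · have h01 : b (0 + 1) = false := by simpa using hb1
      simp only [h01, Bool.false_eq_true, if_false]
      simp only [zero_add, Nat.sub_self, qInt_zero, zero_mul, mul_zero, Finset.sum_const_zero,
        Nat.sub_zero, qInt_one, pow_one, mul_one, inv_one, one_mul]
      rw [add_comm]
      congr 1
      refine Finset.sum_congr rfl fun ε _ => ?_
      ring

/-- The sum of a function with the exchange relation over all words, in terms of sorted words. -/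
lemma runWeight_mul_sum (ht : ∀ h, qInt t (h + 1) ≠ 0) :
    ∀ (n : ℕ) (b : ℕ → Bool) (G : (Fin (n + 1) → Bool) → K), HasExchange t n b G →
      runWeight t n b * ∑ ε, G ε = ∑ ε, wordWeight t n b ε * G ε
  | 0, b, G, _ => by simp [runWeight, wordWeight]
  | n + 1, b, G, hG => by
    have ih1 := runWeight_mul_sum ht n _ _ (hG.tail true)
    have ih0 := runWeight_mul_sum ht n _ _ (hG.tail false)
    rw [sum_word_cons, sum_word_cons (G := fun ε => wordWeight t (n + 1) b ε * G ε)]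
    simp only [runWeight, wordWeight, firstRun, Fin.cons_zero, Fin.tail_cons, if_true,
      Bool.false_eq_true, if_false]
    rw [mul_right_comm, mul_add, ih1, ih0]
    by_cases hb : b 0 = true
    · simp only [hb, if_true]
      have h := sum_wordWeight_insert ht n b (fun _ => 1) G hb hG
      simp only [one_mul] at h
      rw [h, add_left_comm, ← Finset.sum_add_distrib, add_comm, add_mul, Finset.sum_mul,
        Finset.sum_mul]
      have hL := ht (firstRun n (fun l => b (l + 1)))
      rw [add_comm] at hL
      congr 1
      · refine Finset.sum_congr rfl fun ε _ => ?_
        have ho := ht (leadingOnes n (fun l => b (l + 1)) ε)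
        have hle := leadingOnes_le_firstRun n (fun l => b (l + 1)) ε
        -- For a word with leading letter one, `[L + 1]` accounts for the words already starting
        -- with a one and `t^(L+1) [R - L]` for those reached by moving a zero to the right;
        -- together they make `[1 + R]`, which cancels the new factor of `runWeight`.
        have hq : qInt t (1 + firstRun n (fun l => b (l + 1))) =
            qInt t (leadingOnes n (fun l => b (l + 1)) ε + 1) +
              t ^ (leadingOnes n (fun l => b (l + 1)) ε + 1) *
              qInt t (firstRun n (fun l => b (l + 1)) - leadingOnes n (fun l => b (l + 1)) ε) := by
          rw [← qInt_add]
          congr 1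
          omega
        rw [add_comm 1 (leadingOnes n (fun l => b (l + 1)) ε)]
        field_simp
        rw [hq]
        ring
      · refine Finset.sum_congr rfl fun ε _ => ?_
        split_ifs <;> ring
    · simp only [hb, Bool.false_eq_true, if_false, qInt_one, inv_one, mul_one]

end Sorting

/-! ### Weights of blocks of equal letters, and the sorting identity on a ring -/

section CyclicSorting

variable {K : Type*} [Field K] {t : K}

/-- The bonds joining equal letters. -/
def equalBonds (n : ℕ) (b : ℕ → Bool) (ε : Fin (n + 1) → Bool) : ℕ → Bool := fun l =>
  if h : l < n then b l && (ε ⟨l, by omega⟩ == ε ⟨l + 1, by omega⟩) else false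

lemma equalBonds_succ (n : ℕ) (b : ℕ → Bool) (ε : Fin (n + 2) → Bool) :
    (fun l => equalBonds (n + 1) b ε (l + 1)) =
      equalBonds n (fun l => b (l + 1)) (Fin.tail ε) := by
  funext l
  simp only [equalBonds, Nat.add_lt_add_iff_right]
  rfl

lemma equalBonds_zero (n : ℕ) (b : ℕ → Bool) (ε : Fin (n + 2) → Bool) :
    equalBonds (n + 1) b ε 0 = (b 0 && (ε 0 == Fin.tail ε 0)) := by
  simp only [equalBonds, Nat.zero_lt_succ, dif_pos]
  rfl

/-- All runs of the word are sorted. -/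
def SortedOn (n : ℕ) (b : ℕ → Bool) (ε : Fin (n + 1) → Bool) : Prop :=
  ∀ j : Fin n, b j = true → ε j.succ = true → ε j.castSucc = true

instance (n : ℕ) (b : ℕ → Bool) (ε : Fin (n + 1) → Bool) : Decidable (SortedOn n b ε) := by
  unfold SortedOn
  infer_instance

lemma sortedOn_succ (n : ℕ) (b : ℕ → Bool) (ε : Fin (n + 2) → Bool) :
    SortedOn (n + 1) b ε ↔ (b 0 = true → Fin.tail ε 0 = true → ε 0 = true) ∧
      SortedOn n (fun l => b (l + 1)) (Fin.tail ε) := by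
  unfold SortedOn
  rw [Fin.forall_fin_succ]
  rfl

lemma firstRun_equalBonds_of_true : ∀ (n : ℕ) (b : ℕ → Bool) (ε : Fin (n + 1) → Bool),
    ε 0 = true → firstRun n (equalBonds n b ε) = leadingOnes n b ε
  | 0, b, ε, h => by simp [firstRun, leadingOnes, h]
  | n + 1, b, ε, h => by
    simp only [firstRun, leadingOnes, equalBonds_succ, equalBonds_zero, h, if_true]
    by_cases hb : b 0 = true
    · simp only [hb, Bool.true_and, if_true]
      cases h1 : Fin.tail ε 0 with
      | false =>
        rw [(leadingOnes_eq_zero_iff n _ _).2 h1]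
        simp
      | true => simp [firstRun_equalBonds_of_true n _ _ h1]
    · simp [hb]

lemma firstRun_equalBonds_of_false : ∀ (n : ℕ) (b : ℕ → Bool) (ε : Fin (n + 1) → Bool),
    SortedOn n b ε → ε 0 = false → firstRun n (equalBonds n b ε) = firstRun n b
  | 0, b, ε, _, h => by simp [firstRun]
  | n + 1, b, ε, hs, h => by
    rw [sortedOn_succ] at hs
    simp only [firstRun, equalBonds_succ, equalBonds_zero, h]
    by_cases hb : b 0 = true
    · cases h1 : Fin.tail ε 0 with
      | false => simp [hb, firstRun_equalBonds_of_false n _ _ hs.2 h1]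
      | true =>
        have := hs.1 hb h1
        rw [h] at this
        exact absurd this (by simp)
    · simp [hb]

/-- A sorted run is a block of ones followed by a block of zeros, and the recursive weight is the
product of the inverse `t`-factorials of the blocks. In this form the two letters play the same
role, which the adjoint computation needs. -/
lemma wordWeight_eq : ∀ (n : ℕ) (b : ℕ → Bool) (ε : Fin (n + 1) → Bool),
    wordWeight t n b ε = if SortedOn n b ε then runWeight t n (equalBonds n b ε) else 0
  | 0, b, ε => by
    have : SortedOn 0 b ε := fun j => j.elim0
    simp [wordWeight, runWeight, this]
  | n + 1, b, ε => by
    have ih := wordWeight_eq n (fun l => b (l + 1)) (Fin.tail ε)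
    simp only [wordWeight, runWeight, equalBonds_succ, firstRun, equalBonds_zero, ih,
      sortedOn_succ]
    by_cases hs : SortedOn n (fun l => b (l + 1)) (Fin.tail ε)
    · simp only [hs, and_true, if_true]
      by_cases hb : b 0 = true
      · cases h0 : ε 0 <;> cases h1 : Fin.tail ε 0
        · simp [hb, firstRun_equalBonds_of_false n _ _ hs h1]
        · simp [hb]
        · simp [hb, (leadingOnes_eq_zero_iff n _ _).2 h1]
        · simp [hb, firstRun_equalBonds_of_true n _ _ h1]
      · simp [hb, qInt_one]
    · simp [hs]

lemma firstRun_congr : ∀ (n : ℕ) {b b' : ℕ → Bool}, (∀ l < n, b l = b' l) →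
    firstRun n b = firstRun n b'
  | 0, _, _, _ => rfl
  | n + 1, b, b', h => by
    simp only [firstRun, h 0 (Nat.succ_pos n)]
    rw [firstRun_congr n fun l hl => h (l + 1) (by omega)]

lemma firstRun_of_false : ∀ (n m : ℕ) {b : ℕ → Bool}, m ≤ n → b m = false →
    firstRun n b = firstRun m b
  | 0, m, b, hm, _ => by rw [Nat.le_zero.1 hm]
  | n + 1, 0, b, _, h => by simp [firstRun, h]
  | n + 1, m + 1, b, hm, h => by
    simp only [firstRun]
    rw [firstRun_of_false n m (b := fun l => b (l + 1)) (by omega) h]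

/-- Each site contributes the length of the rest of its run, so a run of length `r` gives `[1] ⋯
[r]`; the final site contributes `[1] = 1` and is left out. The sitewise form is what extends to the
ring. -/
lemma runWeight_eq_prod : ∀ (n : ℕ) (b : ℕ → Bool), runWeight t n b =
    ∏ i ∈ Finset.range n, (qInt t (firstRun (n - i) fun l => b (i + l)))⁻¹
  | 0, b => by simp [runWeight]
  | n + 1, b => by
    rw [runWeight, Finset.prod_range_succ', runWeight_eq_prod n]
    congr 1
    · refine Finset.prod_congr rfl fun i _ => ?_
      rw [Nat.add_sub_add_right]
      congr 3
      funext l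
      congr 1
      omega
    · simp

lemma runWeight_congr (n : ℕ) {b b' : ℕ → Bool} (h : ∀ l < n, b l = b' l) :
    runWeight t n b = runWeight t n b' := by
  rw [runWeight_eq_prod, runWeight_eq_prod]
  refine Finset.prod_congr rfl fun i hi => ?_
  rw [firstRun_congr (n - i) fun l hl => h (i + l) (by omega)]

/-- The product of inverse `t`-factorials of the lengths of the cyclic runs. -/
def cyclicWeight (t : K) (N : ℕ) (b : Fin (N + 1) → Bool) : K :=
  ∏ i : Fin (N + 1), (qInt t (firstRun N fun l => b (i + Fin.ofNat (N + 1) l)))⁻¹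

lemma cyclicWeight_rotate (N : ℕ) (b : Fin (N + 1) → Bool) (a : Fin (N + 1)) :
    cyclicWeight t N (fun j => b (j + a)) = cyclicWeight t N b := by
  unfold cyclicWeight
  rw [← Equiv.prod_comp (Equiv.addRight a)
    (fun i : Fin (N + 1) => (qInt t (firstRun N fun l => b (i + Fin.ofNat (N + 1) l)))⁻¹)]
  refine Finset.prod_congr rfl fun i _ => ?_
  congr 3
  funext l
  simp only [Equiv.coe_addRight]
  congr 1
  abel

/-- A closed bond between the last and the first site prevents runs from wrapping around, so cyclic
and linear run lengths agree. -/
lemma cyclicWeight_of_last {N : ℕ} {b : Fin (N + 1) → Bool} (h : b (Fin.last N) = false) :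
    cyclicWeight t N b = runWeight t N (fun l => b (Fin.ofNat (N + 1) l)) := by
  have key : ∀ i : Fin (N + 1),
      (qInt t (firstRun N fun l => b (i + Fin.ofNat (N + 1) l)))⁻¹ =
      (fun i : ℕ => (qInt t (firstRun (N - i) fun l => b (Fin.ofNat (N + 1) (i + l))))⁻¹) i := by
    intro i
    have hi : i.val ≤ N := by omega
    have e : (fun l : ℕ => b (i + Fin.ofNat (N + 1) l)) =
        fun l : ℕ => b (Fin.ofNat (N + 1) (i.val + l)) := by
      funext l
      congr 1
      ext
      simp [Fin.val_add]
    rw [e, firstRun_of_false N (N - i.val) (by omega)]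
    rw [Nat.add_sub_cancel' hi, ← h]
    congr 1
    ext
    simp
  unfold cyclicWeight
  rw [Finset.prod_congr rfl fun i _ => key i,
    Fin.prod_univ_eq_prod_range
      (fun i : ℕ => (qInt t (firstRun (N - i) fun l => b (Fin.ofNat (N + 1) (i + l))))⁻¹),
    Finset.prod_range_succ, runWeight_eq_prod]
  simp [firstRun, qInt_one]

/-- The exchange relation along the open bonds of a cyclic chain. -/
def HasCyclicExchange (t : K) (N : ℕ) (b : Fin (N + 1) → Bool)
    (G : (Fin (N + 1) → Bool) → K) : Prop :=
  ∀ (j : Fin (N + 1)) (ε : Fin (N + 1) → Bool), b j = true → ε j = false → ε (j + 1) = true →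
    G ε = t * G (ε ∘ Equiv.swap j (j + 1))

/-- All cyclic runs of the word are sorted. -/
def CyclicSorted {N : ℕ} (b : Fin (N + 1) → Bool) (ε : Fin (N + 1) → Bool) : Prop :=
  ∀ j, b j = true → ε (j + 1) = true → ε j = true

instance {N : ℕ} (b : Fin (N + 1) → Bool) (ε : Fin (N + 1) → Bool) :
    Decidable (CyclicSorted b ε) := by
  unfold CyclicSorted
  infer_instance

/-- The cyclic bonds joining equal letters. -/
def cyclicEqualBonds {N : ℕ} (b : Fin (N + 1) → Bool) (ε : Fin (N + 1) → Bool) :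
    Fin (N + 1) → Bool := fun j => b j && (ε j == ε (j + 1))

lemma castSucc_add_one {N : ℕ} (j : Fin N) : j.castSucc + 1 = j.succ := by
  simp

lemma cyclicWeight_mul_sum_of_last (ht : ∀ h, qInt t (h + 1) ≠ 0) {N : ℕ}
    {b : Fin (N + 1) → Bool} (hb : b (Fin.last N) = false) {G : (Fin (N + 1) → Bool) → K}
    (hG : HasCyclicExchange t N b G) :
    cyclicWeight t N b * ∑ ε, G ε =
      ∑ ε, (if CyclicSorted b ε then cyclicWeight t N (cyclicEqualBonds b ε) else 0) * G ε := by
  set b' : ℕ → Bool := fun l => b (Fin.ofNat (N + 1) l)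
  have hcast : ∀ j : Fin N, b' j = b j.castSucc := by
    intro j
    simp only [b']
    congr 1
    ext
    simp
  have hG' : HasExchange t N b' G := by
    intro j ε h h0 h1
    have := hG j.castSucc ε (by rw [← hcast, h]) h0 (by rw [castSucc_add_one, h1])
    rwa [castSucc_add_one] at this
  rw [cyclicWeight_of_last hb, runWeight_mul_sum ht N b' G hG']
  refine Finset.sum_congr rfl fun ε _ => ?_
  congr 1
  rw [wordWeight_eq]
  have h1 : SortedOn N b' ε ↔ CyclicSorted b ε := by
    unfold SortedOn CyclicSorted
    rw [Fin.forall_fin_succ']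
    simp [hcast, hb]
  simp only [h1]
  refine if_congr Iff.rfl ?_ rfl
  rw [cyclicWeight_of_last (by simp [cyclicEqualBonds, hb])]
  refine runWeight_congr N fun l hl => ?_
  simp only [equalBonds, hl, dif_pos, cyclicEqualBonds, b']
  have e1 : (⟨l, by omega⟩ : Fin (N + 1)) = Fin.ofNat (N + 1) l := by
    ext
    simp [Nat.mod_eq_of_lt (show l < N + 1 by omega)]
  have e2 : (⟨l + 1, by omega⟩ : Fin (N + 1)) = Fin.ofNat (N + 1) l + 1 := by
    rw [← e1]
    exact (castSucc_add_one ⟨l, hl⟩).symm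
  rw [e2, e1]

/-- Every ingredient commutes with rotations of the ring, so some closed bond may be rotated to the
last position and the ring cut open there. -/
lemma cyclicWeight_mul_sum (ht : ∀ h, qInt t (h + 1) ≠ 0) {N : ℕ}
    {b : Fin (N + 1) → Bool} (hb : ∃ j, b j = false) {G : (Fin (N + 1) → Bool) → K}
    (hG : HasCyclicExchange t N b G) :
    cyclicWeight t N b * ∑ ε, G ε =
      ∑ ε, (if CyclicSorted b ε then cyclicWeight t N (cyclicEqualBonds b ε) else 0) * G ε := by
  obtain ⟨j₀, hj₀⟩ := hb
  set a : Fin (N + 1) := j₀ - Fin.last N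
  let e : (Fin (N + 1) → Bool) ≃ (Fin (N + 1) → Bool) :=
    (Equiv.addRight a).arrowCongr (Equiv.refl Bool)
  have he : ∀ (ε : Fin (N + 1) → Bool) i, e ε (i + a) = ε i := by
    intro ε i
    simp [e]
  have hswap : ∀ (ε : Fin (N + 1) → Bool) j, e (ε ∘ Equiv.swap j (j + 1)) =
      e ε ∘ Equiv.swap (j + a) (j + a + 1) := by
    intro ε j
    funext i
    obtain ⟨i, rfl⟩ := (Equiv.addRight a).surjective i
    have : Equiv.swap (j + a) (j + a + 1) (i + a) = Equiv.swap j (j + 1) i + a := by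
      have := (Function.Injective.map_swap (Equiv.addRight a).injective j (j + 1) i).symm
      simp only [Equiv.coe_addRight] at this
      rw [← this, add_right_comm j 1 a]
    simp only [Equiv.coe_addRight, he, Function.comp_apply, this]
  have hG' : HasCyclicExchange t N (fun j => b (j + a)) (fun ε => G (e ε)) := by
    intro j ε h h0 h1
    have := hG (j + a) (e ε) h (by rw [he, h0]) (by rw [add_right_comm, he, h1])
    simp only [hswap]
    exact this
  have h := cyclicWeight_mul_sum_of_last ht (b := fun j => b (j + a)) (by simp [a, hj₀]) hG'
  rw [cyclicWeight_rotate, e.sum_comp] at h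
  rw [h, ← e.sum_comp
    (fun ε => (if CyclicSorted b ε then cyclicWeight t N (cyclicEqualBonds b ε) else 0) * G ε)]
  refine Finset.sum_congr rfl fun ε _ => ?_
  congr 1
  have h1 : CyclicSorted (fun j => b (j + a)) ε ↔ CyclicSorted b (e ε) := by
    unfold CyclicSorted
    constructor
    · intro h j
      obtain ⟨j, rfl⟩ := (Equiv.addRight a).surjective j
      simp only [Equiv.coe_addRight]
      rw [add_right_comm, he, he]
      exact h j
    · intro h j
      have := h (j + a)
      rwa [add_right_comm, he, he] at this
  have h2 : cyclicEqualBonds (fun j => b (j + a)) ε =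
      fun j => cyclicEqualBonds b (e ε) (j + a) := by
    funext j
    simp only [cyclicEqualBonds]
    rw [add_right_comm, he, he]
  rw [h2, cyclicWeight_rotate]
  simp only [h1]

end CyclicSorting

/-! ### Relations satisfied by the lattice wave functions -/

/-- The coefficients of the lattice wave function. -/
def latticeCoeff (n : ℕ) (t : ℝ) (η : Fin n → ℝ) : ℂ :=
  ∏ p ∈ posRoots n, latticeFactor t (η p.1 - η p.2)

/-- The plane wave with exponents `x`. -/
def planeWave {n : ℕ} (x η : Fin n → ℝ) : ℂ := Complex.exp (Complex.I * ((∑ i, x i * η i : ℝ) : ℂ))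

lemma hallLittlewood_eq_sum (n : ℕ) (t : ℝ) (lam ξ : V n) :
    hallLittlewood n t lam ξ = ∑ σ : Equiv.Perm (Fin n),
      latticeCoeff n t (fun i => ξ (σ.symm i)) * planeWave lam (fun i => ξ (σ.symm i)) :=
  hallLittlewood_eq n t lam ξ

/-- A multiple of `(1, …, 1)` is orthogonal to `E`. This allows weights outside `E`, such as those
shifted by a binary word. -/
lemma hallLittlewood_add_const {n : ℕ} (t : ℝ) {ξ : V n} (hξ : ξ ∈ massPlane n) {x y : V n}
    {c : ℝ} (h : ∀ i, x i = y i + c) : hallLittlewood n t x ξ = hallLittlewood n t y ξ := by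
  rw [hallLittlewood_eq, hallLittlewood_eq]
  refine Finset.sum_congr rfl fun σ _ => ?_
  congr 4
  simp only [h, add_mul, Finset.sum_add_distrib, ← Finset.mul_sum]
  rw [Equiv.sum_comp σ.symm ξ.ofLp, mem_massPlane.1 hξ, mul_zero, add_zero]

lemma hallLittlewood_congr_gaps {N : ℕ} (t : ℝ) {ξ : V (N + 1)} (hξ : ξ ∈ massPlane (N + 1))
    {x y : V (N + 1)} (h : ∀ j : Fin N, x j.castSucc - x j.succ = y j.castSucc - y j.succ) :
    hallLittlewood (N + 1) t x ξ = hallLittlewood (N + 1) t y ξ := by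
  refine hallLittlewood_add_const t hξ (c := x 0 - y 0) fun i => ?_
  induction i using Fin.induction with
  | zero => ring
  | succ j ih => linarith [h j]

lemma latticeFactor_swap (t d : ℝ) :
    latticeFactor t (-d) * (1 - t * Complex.exp (-(Complex.I * d))) =
      -(latticeFactor t d * (Complex.exp (-(Complex.I * d)) - t)) := by
  have hq : Complex.exp (-(Complex.I * ((-d : ℝ) : ℂ))) = (Complex.exp (-(Complex.I * d)))⁻¹ := by
    rw [← Complex.exp_neg]
    congr 1
    push_cast
    ring
  unfold latticeFactor
  rw [hq]
  set q := Complex.exp (-(Complex.I * d))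
  have hq0 : q ≠ 0 := Complex.exp_ne_zero _
  by_cases h1 : q = 1
  -- Here both factors have denominator zero and hence the value `0`, so `d` need not be generic.
  · simp [h1]
  · have h2 : 1 - q ≠ 0 := fun h => h1 (sub_eq_zero.1 h).symm
    have h3 : 1 - q⁻¹ ≠ 0 := by
      intro h
      exact h1 (inv_eq_one.1 (sub_eq_zero.1 h).symm)
    have h4 : 1 - q⁻¹ = -(1 - q) / q := by field_simp; ring
    rw [h4]
    have h5 : -(1 - q) / q ≠ 0 := h4 ▸ h3
    field_simp

lemma swap_castSucc_succ_lt {N : ℕ} (j : Fin N) {p : Fin (N + 1) × Fin (N + 1)} (hp : p.1 < p.2)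
    (hne : p ≠ (j.castSucc, j.succ)) :
    Equiv.swap j.castSucc j.succ p.1 < Equiv.swap j.castSucc j.succ p.2 := by
  obtain ⟨a, b⟩ := p
  change a < b at hp
  change Equiv.swap j.castSucc j.succ a < Equiv.swap j.castSucc j.succ b
  simp only [ne_eq, Prod.mk.injEq] at hne
  simp only [Fin.ext_iff, Fin.lt_def, Equiv.swap_apply_def, Fin.val_castSucc, Fin.val_succ] at *
  split_ifs <;> (try simp only [Fin.val_castSucc, Fin.val_succ]) <;> omega

/-- A simple reflection permutes the positive roots other than its own. -/
lemma prod_posRoots_swap {N : ℕ} (j : Fin N) (h : Fin (N + 1) × Fin (N + 1) → ℂ) :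
    ∏ p ∈ (posRoots (N + 1)).erase (j.castSucc, j.succ),
        h (Equiv.swap j.castSucc j.succ p.1, Equiv.swap j.castSucc j.succ p.2) =
      ∏ p ∈ (posRoots (N + 1)).erase (j.castSucc, j.succ), h p := by
  set s := Equiv.swap j.castSucc j.succ
  have hmem : ∀ p ∈ (posRoots (N + 1)).erase (j.castSucc, j.succ),
      (s p.1, s p.2) ∈ (posRoots (N + 1)).erase (j.castSucc, j.succ) := by
    intro p hp
    simp only [posRoots, Finset.mem_erase, Finset.mem_filter, Finset.mem_univ, true_and] at hp ⊢
    refine ⟨?_, swap_castSucc_succ_lt j hp.2 hp.1⟩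
    intro he
    simp only [Prod.mk.injEq] at he
    have h1 : p.1 = j.succ := by
      have h3 : s (s p.1) = p.1 := Equiv.swap_apply_self _ _ _
      rw [← h3, he.1]
      exact Equiv.swap_apply_left _ _
    have h2 : p.2 = j.castSucc := by
      have h3 : s (s p.2) = p.2 := Equiv.swap_apply_self _ _ _
      rw [← h3, he.2]
      exact Equiv.swap_apply_right _ _
    have := hp.2
    rw [h1, h2] at this
    exact absurd this (not_lt.2 (Fin.castSucc_le_succ j))
  refine Finset.prod_nbij' (fun p => (s p.1, s p.2)) (fun p => (s p.1, s p.2)) hmem hmem ?_ ?_ ?_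
  · intro p _; simp [s]
  · intro p _; simp [s]
  · intro p _; rfl

lemma latticeCoeff_eq_mul {N : ℕ} (t : ℝ) (η : Fin (N + 1) → ℝ) (j : Fin N) :
    latticeCoeff (N + 1) t η = latticeFactor t (η j.castSucc - η j.succ) *
      ∏ p ∈ (posRoots (N + 1)).erase (j.castSucc, j.succ), latticeFactor t (η p.1 - η p.2) := by
  rw [latticeCoeff, ← Finset.mul_prod_erase _ _ (a := (j.castSucc, j.succ))]
  simp [posRoots]

/-- The exchange relation of the lattice wave function. -/
lemma hallLittlewood_exchange {N : ℕ} (t : ℝ) (ξ : V (N + 1)) (j : Fin N) {x x' : V (N + 1)}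
    (hx : x j.succ = x j.castSucc + 1) (hx' : ∀ i, x' i = x (Equiv.swap j.castSucc j.succ i)) :
    hallLittlewood (N + 1) t x ξ = t * hallLittlewood (N + 1) t x' ξ := by
  set s := Equiv.swap j.castSucc j.succ with hs
  have hss : ∀ i, s (s i) = i := fun i => Equiv.swap_apply_self _ _ _
  let f : Equiv.Perm (Fin (N + 1)) → ℂ := fun σ =>
    latticeCoeff (N + 1) t (fun i => ξ (σ.symm i)) *
      (planeWave x (fun i => ξ (σ.symm i)) - t * planeWave x' (fun i => ξ (σ.symm i)))
  have hf : hallLittlewood (N + 1) t x ξ - t * hallLittlewood (N + 1) t x' ξ = ∑ σ, f σ := by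
    rw [hallLittlewood_eq_sum, hallLittlewood_eq_sum, Finset.mul_sum, ← Finset.sum_sub_distrib]
    refine Finset.sum_congr rfl fun σ _ => ?_
    simp only [f]
    ring
  have hanti : ∀ σ, f (s * σ) = -f σ := by
    intro σ
    set η : Fin (N + 1) → ℝ := fun i => ξ (σ.symm i) with hη
    have e0 : (fun i => ξ ((s * σ).symm i)) = fun i => η (s i) := by
      funext i
      simp [hη, hs, Equiv.Perm.mul_def]
    have e1 : planeWave x' η = planeWave x (fun i => η (s i)) := by
      unfold planeWave
      rw [← Equiv.sum_comp s (fun i => x' i * η i)]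
      simp only [hx', hss]
    have e2 : planeWave x' (fun i => η (s i)) = planeWave x η := by
      unfold planeWave
      rw [← Equiv.sum_comp s (fun i => x' i * η (s i))]
      simp only [hx', hss]
    have e3 : planeWave x η = planeWave x (fun i => η (s i)) *
        Complex.exp (-(Complex.I * ((η j.castSucc - η j.succ : ℝ) : ℂ))) := by
      unfold planeWave
      rw [← Complex.exp_add]
      congr 1
      have : ∑ i, x i * η i - ∑ i, x i * η (s i) = -(η j.castSucc - η j.succ) := by
        rw [← Finset.sum_sub_distrib, Fintype.sum_eq_add j.castSucc j.succ
          (Fin.castSucc_lt_succ (i := j)).ne]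
        · rw [hs, Equiv.swap_apply_left, Equiv.swap_apply_right, hx]
          ring
        · rintro i ⟨h1, h2⟩
          rw [hs, Equiv.swap_apply_of_ne_of_ne h1 h2, sub_self]
      have this' := congrArg (fun r : ℝ => (r : ℂ)) this
      simp only [Complex.ofReal_sub, Complex.ofReal_neg] at this'
      push_cast at this' ⊢
      linear_combination Complex.I * this'
    -- With `q = e^{-i(η_j - η_{j+1})}`, the difference of plane waves is a common factor times `q -
    -- t` at `η` and times `1 - tq` at the reflected point. The relation below exchanges these up to
    -- sign, so the summand is antisymmetric and the sum vanishes.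
    have e4 := latticeFactor_swap t (η j.castSucc - η j.succ)
    simp only [f]
    rw [e0, e1, e2, e3, latticeCoeff_eq_mul t η j, latticeCoeff_eq_mul t _ j]
    rw [prod_posRoots_swap j (fun p => latticeFactor t (η p.1 - η p.2))]
    rw [hs, Equiv.swap_apply_left, Equiv.swap_apply_right, ← hs, ← neg_sub (η j.castSucc)]
    linear_combination (planeWave x (fun i => η (s i)) *
      ∏ p ∈ (posRoots (N + 1)).erase (j.castSucc, j.succ), latticeFactor t (η p.1 - η p.2)) * e4
  have hsum : ∑ σ, f σ = -∑ σ, f σ := by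
    conv_lhs => rw [← Equiv.sum_comp (Equiv.mulLeft s) f]
    simp only [Equiv.coe_mulLeft, hanti, Finset.sum_neg_distrib]
  have h0 : ∑ σ, f σ = 0 := by
    have : (2 : ℂ) * ∑ σ, f σ = 0 := by linear_combination hsum
    simpa using this
  rw [h0] at hf
  exact sub_eq_zero.1 hf

lemma prod_posRoots_eq {n : ℕ} (h : Fin n → Fin n → ℂ) :
    ∏ p ∈ posRoots n, h p.1 p.2 = ∏ i, ∏ j, if i < j then h i j else 1 := by
  rw [posRoots, Finset.prod_filter, Fintype.prod_prod_type]

lemma prod_posRoots_first {N : ℕ} (h : Fin (N + 1) → Fin (N + 1) → ℂ) :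
    ∏ p ∈ posRoots (N + 1), h p.1 p.2 =
      (∏ j : Fin N, h 0 j.succ) * ∏ p ∈ posRoots N, h p.1.succ p.2.succ := by
  rw [prod_posRoots_eq, prod_posRoots_eq (fun i j : Fin N => h i.succ j.succ)]
  simp [Fin.prod_univ_succ]

lemma prod_posRoots_last {N : ℕ} (h : Fin (N + 1) → Fin (N + 1) → ℂ) :
    ∏ p ∈ posRoots (N + 1), h p.1 p.2 =
      (∏ j : Fin N, h j.castSucc (Fin.last N)) *
        ∏ p ∈ posRoots N, h p.1.castSucc p.2.castSucc := by
  rw [prod_posRoots_eq, prod_posRoots_eq (fun i j : Fin N => h i.castSucc j.castSucc)]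
  simp [Fin.prod_univ_castSucc, Finset.prod_mul_distrib, mul_comm, Fin.castSucc_lt_last,
    not_lt.2 (Fin.le_last _)]

lemma latticeFactor_neg_eq {t : ℝ} (ht0 : 0 < t) (ht1 : t < 1) (d : ℝ) :
    latticeFactor t (-d) =
      -(latticeFactor t d * Complex.exp (-(Complex.I * latticeTheta t d))) := by
  have h := latticeFactor_swap t d
  have h1 : 1 - t * Complex.exp (-(Complex.I * d)) ≠ 0 := by
    have := one_sub_mul_exp_ne_zero ht0 ht1 (-d)
    rwa [Complex.ofReal_neg, mul_neg] at this
  have h2 := exp_sub_ne_zero ht0 ht1 d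
  rw [exp_neg_latticeTheta ht0 ht1]
  have hq : Complex.exp (-(Complex.I * d)) = (Complex.exp (Complex.I * d))⁻¹ :=
    Complex.exp_neg _
  have hp : Complex.exp (Complex.I * d) ≠ 0 := Complex.exp_ne_zero _
  rw [hq] at h h1
  set p := Complex.exp (Complex.I * d)
  refine mul_right_cancel₀ h1 (h.trans ?_)
  field_simp

/-- The quasi-periodicity of the lattice wave function at a Bethe vector. -/
lemma exists_hallLittlewood_rotate {N m : ℕ} {t : ℝ} (ht0 : 0 < t) (ht1 : t < 1) {ξ : V (N + 1)}
    {r : Fin (N + 1) → ℝ}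
    (hξ : ∀ a, m * ξ a + ∑ l, latticeTheta t (ξ a - ξ l) = 2 * Real.pi * r a)
    (hr : ∀ a b, ∃ z : ℤ, r a - r b = z) :
    ∃ c : ℂ, c ≠ 0 ∧ ∀ x x' : V (N + 1), (∀ j : Fin N, x' j.castSucc = x j.succ) →
      x' (Fin.last N) = x 0 - m →
      hallLittlewood (N + 1) t x' ξ = c * hallLittlewood (N + 1) t x ξ := by
  -- The rotation carries the last particle past the `N` others: each passage gives a sign and a
  -- scattering phase. The Bethe equation of that particle cancels the phases against its shift by
  -- `m` and leaves `e^{-2πi r_a}`, which is independent of `a` since the `r_a` differ by integers.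
  refine ⟨(-1) ^ N * Complex.exp (-(Complex.I * ((2 * Real.pi * r 0 : ℝ) : ℂ))),
    mul_ne_zero (by simp) (Complex.exp_ne_zero _), fun x x' h1 h2 => ?_⟩
  rw [hallLittlewood_eq_sum, hallLittlewood_eq_sum,
    ← Equiv.sum_comp (Equiv.mulLeft (finRotate (N + 1)))
      (fun σ => latticeCoeff (N + 1) t (fun i => ξ (σ.symm i)) *
        planeWave x (fun i => ξ (σ.symm i))), Finset.mul_sum]
  refine Finset.sum_congr rfl fun σ _ => ?_
  set η : Fin (N + 1) → ℝ := fun i => ξ (σ.symm i) with hη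
  set η' : Fin (N + 1) → ℝ := fun i => ξ ((Equiv.mulLeft (finRotate (N + 1)) σ).symm i) with hη'
  have e0 : ∀ i, η' (finRotate (N + 1) i) = η i := by
    intro i
    simp [hη, hη', Equiv.Perm.mul_def]
  have e1 : η' 0 = η (Fin.last N) := by rw [← e0, finRotate_last]
  have e2 : ∀ j : Fin N, η' j.succ = η j.castSucc := by
    intro j
    have h3 : finRotate (N + 1) j.castSucc = j.succ := finRotate_of_lt j.isLt
    rw [← e0, h3]
  have hwave : planeWave x' η =
      Complex.exp (-(Complex.I * ((m * η (Fin.last N) : ℝ) : ℂ))) * planeWave x η' := by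
    unfold planeWave
    rw [← Complex.exp_add]
    congr 1
    rw [Fin.sum_univ_castSucc, Fin.sum_univ_succ]
    simp only [h1, h2, e1, e2]
    push_cast
    ring
  have hsum : ∑ j : Fin N, latticeTheta t (η (Fin.last N) - η j.castSucc) =
      2 * Real.pi * r (σ.symm (Fin.last N)) - m * η (Fin.last N) := by
    have h3 := hξ (σ.symm (Fin.last N))
    rw [← Equiv.sum_comp σ.symm (fun l => latticeTheta t (ξ (σ.symm (Fin.last N)) - ξ l)),
      Fin.sum_univ_castSucc, sub_self, latticeTheta_zero, add_zero] at h3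
    linarith
  have hcoeff : latticeCoeff (N + 1) t η = (-1) ^ N *
      Complex.exp (-(Complex.I *
        ((2 * Real.pi * r (σ.symm (Fin.last N)) - m * η (Fin.last N) : ℝ) : ℂ))) *
      latticeCoeff (N + 1) t η' := by
    unfold latticeCoeff
    rw [prod_posRoots_last (fun i j => latticeFactor t (η i - η j)),
      prod_posRoots_first (fun i j => latticeFactor t (η' i - η' j))]
    simp only [e1, e2]
    rw [← mul_assoc]
    congr 1
    have h4 : ∀ j : Fin N, latticeFactor t (η j.castSucc - η (Fin.last N)) =
        -(latticeFactor t (η (Fin.last N) - η j.castSucc) *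
          Complex.exp (-(Complex.I * latticeTheta t (η (Fin.last N) - η j.castSucc)))) := by
      intro j
      rw [← latticeFactor_neg_eq ht0 ht1, neg_sub]
    rw [Finset.prod_congr rfl fun j _ => h4 j, ← hsum]
    simp only [← neg_one_mul (_ * _), Finset.prod_mul_distrib, Finset.prod_const,
      Finset.card_univ, Fintype.card_fin]
    rw [← Complex.exp_sum, ← Finset.mul_sum, ← Finset.mul_sum]
    push_cast
    ring
  have hphase : Complex.exp (-(Complex.I * ((2 * Real.pi * r 0 : ℝ) : ℂ))) =
      Complex.exp (-(Complex.I *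
        ((2 * Real.pi * r (σ.symm (Fin.last N)) - m * η (Fin.last N) : ℝ) : ℂ))) *
      Complex.exp (-(Complex.I * ((m * η (Fin.last N) : ℝ) : ℂ))) := by
    obtain ⟨z, hz⟩ := hr (σ.symm (Fin.last N)) 0
    rw [← Complex.exp_add, Complex.exp_eq_exp_iff_exists_int]
    refine ⟨z, ?_⟩
    have hz' : ((r (σ.symm (Fin.last N)) : ℝ) : ℂ) - (r 0 : ℂ) = z := by exact_mod_cast hz
    push_cast
    linear_combination 2 * Real.pi * Complex.I * hz'
  rw [hwave, hcoeff, hphase]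
  ring

/-- The vector of zeros and ones of a binary word. -/
def wordVec {n : ℕ} (ε : Fin n → Bool) : V n := WithLp.toLp 2 fun i => if ε i then 1 else 0

lemma wordVec_apply {n : ℕ} (ε : Fin n → Bool) (i : Fin n) :
    wordVec ε i = if ε i then 1 else 0 := rfl

/-- The eigenvalue equation for the generating function of the hopping operators. -/
lemma sum_hallLittlewood_add_wordVec {n : ℕ} (t : ℝ) (ξ lam : V n) (a : Bool → ℂ) :
    ∑ ε : Fin n → Bool, (∏ i, a (ε i)) * hallLittlewood n t (lam + wordVec ε) ξ =
      (∏ j, (a true * Complex.exp (Complex.I * ξ j) + a false)) * hallLittlewood n t lam ξ := by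
  simp only [hallLittlewood_eq_sum, Finset.mul_sum]
  rw [Finset.sum_comm]
  refine Finset.sum_congr rfl fun σ _ => ?_
  rw [← Equiv.prod_comp σ.symm (fun j => a true * Complex.exp (Complex.I * ξ j) + a false)]
  have h : ∀ i : Fin n, a true * Complex.exp (Complex.I * ξ (σ.symm i)) + a false =
      ∑ x : Bool, a x * if x then Complex.exp (Complex.I * ξ (σ.symm i)) else 1 := by
    intro i
    simp
  -- Expanding the product of two-term sums produces one term for each word.
  rw [Finset.prod_congr rfl fun i _ => h i, Fintype.prod_sum, Finset.sum_mul]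
  refine Finset.sum_congr rfl fun ε _ => ?_
  have hw : planeWave (lam + wordVec ε).ofLp (fun i => ξ (σ.symm i)) =
      planeWave lam (fun i => ξ (σ.symm i)) *
        ∏ i, if ε i then Complex.exp (Complex.I * ξ (σ.symm i)) else 1 := by
    have h1 : ∀ i, (if ε i then Complex.exp (Complex.I * ξ (σ.symm i)) else 1) =
        Complex.exp (Complex.I * ((wordVec ε i * ξ (σ.symm i) : ℝ) : ℂ)) := by
      intro i
      rw [wordVec_apply]
      split_ifs <;> simp
    rw [Finset.prod_congr rfl fun i _ => h1 i, ← Complex.exp_sum, ← Finset.mul_sum]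
    unfold planeWave
    rw [← Complex.exp_add, ← mul_add, ← Complex.ofReal_sum, ← Complex.ofReal_add,
      ← Finset.sum_add_distrib]
    simp only [PiLp.add_apply, add_mul]
  rw [hw, Finset.prod_mul_distrib]
  ring

/-! ### Orthogonality of the lattice wave functions -/

/-- The relations on functions of the weights from which orthogonality follows: `t`-exchange,
quasi-periodicity, translation invariance, and an eigenvalue equation for the generating function
of the hopping operators. -/
structure IsBetheFunction (N m : ℕ) (t : ℝ) (z : Fin (N + 1) → ℂ) (F : V (N + 1) → ℂ) :
    Prop where
  exchange : ∀ (j : Fin N) (x x' : V (N + 1)), x j.succ = x j.castSucc + 1 →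
    (∀ i, x' i = x (Equiv.swap j.castSucc j.succ i)) → F x = t * F x'
  rotate : ∃ c : ℂ, c ≠ 0 ∧ ∀ x x' : V (N + 1), (∀ j : Fin N, x' j.castSucc = x j.succ) →
    x' (Fin.last N) = x 0 - m → F x' = c * F x
  congr_gaps : ∀ x y : V (N + 1), (∀ j : Fin N, x j.castSucc - x j.succ = y j.castSucc - y j.succ) →
    F x = F y
  eigen : ∀ (lam : V (N + 1)) (a : Bool → ℂ),
    ∑ ε : Fin (N + 1) → Bool, (∏ i, a (ε i)) * F (lam + wordVec ε) =
      (∏ j, (a true * z j + a false)) * F lam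

lemma isBetheFunction_hallLittlewood {N m : ℕ} {t : ℝ} (ht0 : 0 < t) (ht1 : t < 1)
    {k : Fin N → ℕ} {ξ : V (N + 1)}
    (hξ : IsLatticeBetheVector (N + 1) m t (ofGaps N fun j => (k j : ℝ)) ξ) :
    IsBetheFunction N m t (fun j => Complex.exp (Complex.I * ξ j))
      (fun lam => hallLittlewood (N + 1) t lam ξ) where
  exchange j _ _ h h' := hallLittlewood_exchange t ξ j h h'
  rotate := exists_hallLittlewood_rotate ht0 ht1 hξ.phase_eq (label_sub_int k)
  congr_gaps _ _ h := hallLittlewood_congr_gaps t hξ.1 h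
  eigen lam a := sum_hallLittlewood_add_wordVec t ξ lam a

lemma IsBetheFunction.conj {N m : ℕ} {t : ℝ} {z : Fin (N + 1) → ℂ} {F : V (N + 1) → ℂ}
    (h : IsBetheFunction N m t z F) :
    IsBetheFunction N m t (fun j => (starRingEnd ℂ) (z j)) (fun x => (starRingEnd ℂ) (F x)) where
  exchange j x x' h1 h2 := by
    rw [h.exchange j x x' h1 h2, map_mul, Complex.conj_ofReal]
  rotate := by
    obtain ⟨c, hc, h1⟩ := h.rotate
    refine ⟨(starRingEnd ℂ) c, (map_ne_zero _).2 hc, fun x x' h2 h3 => ?_⟩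
    rw [h1 x x' h2 h3, map_mul]
  congr_gaps x y h1 := by rw [h.congr_gaps x y h1]
  eigen lam a := by
    have := congrArg (starRingEnd ℂ) (h.eigen lam (fun b => (starRingEnd ℂ) (a b)))
    simpa only [map_sum, map_mul, map_prod, map_add, Complex.conj_conj] using this

/-- The weight with given gaps. -/
def stateVec {N : ℕ} (κ : Fin (N + 1) → ℕ) : V (N + 1) :=
  ofGaps N fun j => (κ j.castSucc : ℝ)

/-- The bonds between coinciding particles. -/
def openBonds {N : ℕ} (κ : Fin (N + 1) → ℕ) : Fin (N + 1) → Bool := fun j => decide (κ j = 0)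

lemma openBonds_eq_true {N : ℕ} {κ : Fin (N + 1) → ℕ} {j : Fin (N + 1)} :
    openBonds κ j = true ↔ κ j = 0 := by
  simp [openBonds]

lemma stateVec_gap {N : ℕ} (κ : Fin (N + 1) → ℕ) (j : Fin N) :
    stateVec κ j.castSucc - stateVec κ j.succ = κ j.castSucc := ofGaps_gap _ j

lemma stateVec_zero_sub_last {N : ℕ} (κ : Fin (N + 1) → ℕ) :
    stateVec κ 0 - stateVec κ (Fin.last N) + κ (Fin.last N) = (∑ j, κ j : ℕ) := by
  rw [stateVec, ofGaps_zero_sub_last, Fin.sum_univ_castSucc]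
  push_cast
  rfl

lemma prod_comp_word_swap {N : ℕ} (a : Bool → ℂ) (ε : Fin (N + 1) → Bool)
    (s : Equiv.Perm (Fin (N + 1))) : ∏ i, a ((ε ∘ s) i) = ∏ i, a (ε i) :=
  Equiv.prod_comp s fun i => a (ε i)

/-- An open bond joins particles at equal positions, where the letters `0, 1` create the unit step
of the exchange relation. For the bond from last to first, the coincidence is that of `x_last` with
`x_0 - m`; rotation turns this pair into neighbours. -/
lemma IsBetheFunction.hasCyclicExchange {N m : ℕ} {t : ℝ} {z : Fin (N + 1) → ℂ}
    {F : V (N + 1) → ℂ} (h : IsBetheFunction N m t z F) {κ : Fin (N + 1) → ℕ} (hκ : ∑ j, κ j = m)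
    (a : Bool → ℂ) :
    HasCyclicExchange (t : ℂ) N (openBonds κ)
      (fun ε => (∏ i, a (ε i)) * F (stateVec κ + wordVec ε)) := by
  intro j ε hj h0 h1
  rw [openBonds_eq_true] at hj
  simp only [prod_comp_word_swap]
  rw [mul_left_comm]
  congr 1
  induction j using Fin.lastCases with
  | cast i =>
    rw [castSucc_add_one] at h1 ⊢
    have hg := stateVec_gap κ i
    rw [hj, Nat.cast_zero, sub_eq_zero] at hg
    refine h.exchange i _ _ ?_ fun l => ?_
    · simp only [PiLp.add_apply, wordVec_apply, h0, h1, if_true, hg]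
      simp
    · simp only [PiLp.add_apply, wordVec_apply, Function.comp_apply]
      congr 1
      rcases eq_or_ne l i.castSucc with rfl | h2
      · rw [Equiv.swap_apply_left, hg]
      rcases eq_or_ne l i.succ with rfl | h3
      · rw [Equiv.swap_apply_right, hg]
      · rw [Equiv.swap_apply_of_ne_of_ne h2 h3]
  | last =>
    rw [Fin.last_add_one] at h1 ⊢
    cases N with
    -- With a single particle `j + 1 = j`, and the two hypotheses on the letter contradict each
    -- other.
    | zero => exact absurd (h0.symm.trans h1) (by simp)
    | succ M =>
      obtain ⟨c, hc, hrot⟩ := h.rotate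
      have hw := stateVec_zero_sub_last κ
      rw [hj, hκ, Nat.cast_zero, add_zero] at hw
      set s := Equiv.swap (Fin.last (M + 1)) 0
      set x := stateVec κ + wordVec ε with hx
      set x' := stateVec κ + wordVec (ε ∘ s) with hx'
      -- The rotation that moves the first particle to the end, shifted by `-m`. Its common factor
      -- `c` cancels at the end because it is nonzero.
      let R : V (M + 2) → V (M + 2) := fun v =>
        WithLp.toLp 2 (Fin.snoc (fun j : Fin (M + 1) => v j.succ) (v 0 - m))
      have hR1 : ∀ v (j : Fin (M + 1)), R v j.castSucc = v j.succ := fun v j => by simp [R]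
      have hR2 : ∀ v, R v (Fin.last (M + 1)) = v 0 - m := fun v => by simp [R]
      have hx0 : x 0 = stateVec κ 0 + 1 := by simp [hx, wordVec_apply, h1]
      have hxl : x (Fin.last (M + 1)) = stateVec κ (Fin.last (M + 1)) := by
        simp [hx, wordVec_apply, h0]
      have hx'0 : x' 0 = stateVec κ 0 := by
        simp [hx', wordVec_apply, s, Equiv.swap_apply_right, h0]
      have hx'l : x' (Fin.last (M + 1)) = stateVec κ (Fin.last (M + 1)) + 1 := by
        simp [hx', wordVec_apply, s, Equiv.swap_apply_left, h1]
      have hxx : ∀ l, l ≠ 0 → l ≠ Fin.last (M + 1) → x' l = x l := by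
        intro l h2 h3
        simp [hx, hx', wordVec_apply, s, Equiv.swap_apply_of_ne_of_ne h3 h2]
      have h3 := hrot x (R x) (hR1 x) (hR2 x)
      have h4 := hrot x' (R x') (hR1 x') (hR2 x')
      have h5 : F (R x) = t * F (R x') := by
        refine h.exchange (Fin.last M) _ _ ?_ fun l => ?_
        · rw [hR1, Fin.succ_last, hR2, hx0, hxl]
          linarith
        · rw [Fin.succ_last]
          induction l using Fin.lastCases with
          | last =>
            rw [Equiv.swap_apply_right, hR1, hR2, Fin.succ_last, hx'0, hxl]
            linarith
          | cast l =>
            rcases eq_or_ne l (Fin.last M) with rfl | h6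
            · rw [Equiv.swap_apply_left, hR1, hR2, Fin.succ_last, hx'l, hx0]
              linarith
            · rw [Equiv.swap_apply_of_ne_of_ne (fun h => h6 (Fin.castSucc_injective _ h))
                (Fin.castSucc_lt_last l).ne, hR1, hR1]
              refine hxx _ (Fin.succ_ne_zero l) fun h => h6 ?_
              rw [← Fin.succ_last] at h
              exact Fin.succ_injective _ h
      rw [h3, h4] at h5
      exact mul_left_cancel₀ hc (by rw [h5]; ring)

/-- The gaps after a hop of the particles marked by a word. -/
def hop {N : ℕ} (κ : Fin (N + 1) → ℕ) (ε : Fin (N + 1) → Bool) : Fin (N + 1) → ℕ := fun j =>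
  κ j + (if ε j then 1 else 0) - if ε (j + 1) then 1 else 0

/-! ### Hops between lattice states and their reversal -/

section hop

variable {N : ℕ} {κ : Fin (N + 1) → ℕ} {ε : Fin (N + 1) → Bool}

/-- Sortedness excludes `κ_j = 0`, `ε_j = 0`, `ε_{j+1} = 1`, the only case in which the subtraction
of natural numbers in `hop` truncates. -/
lemma hop_add (h : CyclicSorted (openBonds κ) ε) (j : Fin (N + 1)) :
    hop κ ε j + (if ε (j + 1) then 1 else 0) = κ j + if ε j then 1 else 0 := by
  have := h j
  rw [openBonds_eq_true] at this
  unfold hop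
  rcases Nat.eq_zero_or_pos (κ j) with h0 | h0
  · have := this h0
    cases h1 : ε (j + 1) <;> simp_all
  · split_ifs <;> omega

lemma sum_hop (h : CyclicSorted (openBonds κ) ε) : ∑ j, hop κ ε j = ∑ j, κ j := by
  have h1 := Finset.sum_congr rfl fun j (_ : j ∈ Finset.univ) => hop_add h j
  have h2 : ∑ j, (if ε (j + 1) then 1 else 0) = ∑ j, if ε j then 1 else 0 :=
    Equiv.sum_comp (Equiv.addRight (1 : Fin (N + 1))) (fun j => if ε j then 1 else 0)
  rw [Finset.sum_add_distrib, Finset.sum_add_distrib, h2] at h1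
  exact Nat.add_right_cancel h1

/-- A word and its complement together move every particle by one step, which changes no gap. -/
lemma hop_hop (h : CyclicSorted (openBonds κ) ε)
    (h' : CyclicSorted (openBonds (hop κ ε)) fun j => !ε j) :
    hop (hop κ ε) (fun j => !ε j) = κ := by
  funext j
  have h1 := hop_add h j
  have h2 := hop_add h' j
  cases h3 : ε j <;> cases h4 : ε (j + 1) <;> simp_all

lemma cyclicSorted_hop (h : CyclicSorted (openBonds κ) ε) :
    CyclicSorted (openBonds (hop κ ε)) fun j => !ε j := by
  intro j hj h1
  have h2 := hop_add h j
  rw [openBonds_eq_true] at hj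
  cases h3 : ε j <;> simp_all

/-- Between equal letters the gap is unchanged by the hop; between distinct letters the bond is
discarded on both sides. -/
lemma cyclicEqualBonds_hop (h : CyclicSorted (openBonds κ) ε) :
    cyclicEqualBonds (openBonds (hop κ ε)) (fun j => !ε j) =
      cyclicEqualBonds (openBonds κ) ε := by
  funext j
  have h2 := hop_add h j
  simp only [cyclicEqualBonds, openBonds]
  cases h3 : ε j <;> cases h4 : ε (j + 1) <;> simp_all

lemma stateVec_add_wordVec_gap (h : CyclicSorted (openBonds κ) ε) (j : Fin N) :
    (stateVec κ + wordVec ε) j.castSucc - (stateVec κ + wordVec ε) j.succ =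
      stateVec (hop κ ε) j.castSucc - stateVec (hop κ ε) j.succ := by
  have h1 := hop_add h j.castSucc
  rw [castSucc_add_one] at h1
  have h2 := stateVec_gap κ j
  have h3 : (hop κ ε j.castSucc : ℝ) + (if ε j.succ then 1 else 0) =
      κ j.castSucc + if ε j.castSucc then 1 else 0 := by exact_mod_cast h1
  simp only [PiLp.add_apply, wordVec_apply]
  rw [stateVec_gap]
  linarith

end hop

/-- The states of the lattice gas on `m` sites. -/
def latticeStates (N m : ℕ) : Finset (Fin (N + 1) → ℕ) := Finset.piAntidiag Finset.univ m

lemma mem_latticeStates {N m : ℕ} {κ : Fin (N + 1) → ℕ} :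
    κ ∈ latticeStates N m ↔ ∑ j, κ j = m := by
  simp [latticeStates, Finset.mem_piAntidiag]

/-- The scalar product of lattice functions. -/
def latticePairing (N m : ℕ) (t : ℝ) (F H : V (N + 1) → ℂ) : ℂ :=
  ∑ κ ∈ latticeStates N m, cyclicWeight (t : ℂ) N (openBonds κ) * F (stateVec κ) * H (stateVec κ)

lemma qInt_succ_ne_zero {t : ℝ} (ht0 : 0 < t) (h : ℕ) : qInt (t : ℂ) (h + 1) ≠ 0 := by
  have h1 : qInt (t : ℂ) (h + 1) = ((∑ i ∈ Finset.range (h + 1), t ^ i : ℝ) : ℂ) := by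
    simp [qInt]
  have h2 : 0 < ∑ i ∈ Finset.range (h + 1), t ^ i :=
    Finset.sum_pos (fun i _ => pow_pos ht0 i) (by simp)
  rw [h1]
  exact_mod_cast h2.ne'

/-- The eigenvalue equation, followed by sorting. Since the gaps add up to `m ≥ 1`, some bond is
closed, as the cyclic sorting identity requires. -/
lemma IsBetheFunction.weight_mul_eigen {N m : ℕ} (hm : 1 ≤ m) {t : ℝ} (ht0 : 0 < t)
    {z : Fin (N + 1) → ℂ} {F : V (N + 1) → ℂ} (h : IsBetheFunction N m t z F)
    {κ : Fin (N + 1) → ℕ} (hκ : ∑ j, κ j = m) (a : Bool → ℂ) :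
    (∏ j, (a true * z j + a false)) * (cyclicWeight (t : ℂ) N (openBonds κ) * F (stateVec κ)) =
      ∑ ε, if CyclicSorted (openBonds κ) ε then
        cyclicWeight (t : ℂ) N (cyclicEqualBonds (openBonds κ) ε) * ((∏ i, a (ε i)) *
          F (stateVec (hop κ ε))) else 0 := by
  have hb : ∃ j, openBonds κ j = false := by
    by_contra! hc
    have h0 : ∀ j, κ j = 0 := fun j => openBonds_eq_true.1 (Bool.eq_true_of_not_eq_false (hc j))
    simp only [h0, Finset.sum_const_zero] at hκ
    omega
  rw [mul_left_comm, ← h.eigen, cyclicWeight_mul_sum (qInt_succ_ne_zero ht0) hb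
    (h.hasCyclicExchange hκ a)]
  refine Finset.sum_congr rfl fun ε _ => ?_
  split_ifs with hε
  · rw [h.congr_gaps _ _ (stateVec_add_wordVec_gap hε)]
  · rw [zero_mul]

/-- The hopping operators and their adjoints. -/
lemma latticePairing_adjoint {N m : ℕ} (hm : 1 ≤ m) {t : ℝ} (ht0 : 0 < t)
    {z w : Fin (N + 1) → ℂ} {F H : V (N + 1) → ℂ} (hF : IsBetheFunction N m t z F)
    (hH : IsBetheFunction N m t w H) (u : ℂ) :
    (∏ j, (u * z j + 1)) * latticePairing N m t F H =
      (∏ j, (w j + u)) * latticePairing N m t F H := by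
  -- Moving particles are marked by `u`. On the side of `H` the letters are complemented, so there
  -- the particles at rest carry `u` and the eigenvalue is `∏ (w_j + u)`.
  let a : Bool → ℂ := fun b => if b then u else 1
  let T : Finset ((Fin (N + 1) → ℕ) × (Fin (N + 1) → Bool)) :=
    (latticeStates N m ×ˢ Finset.univ).filter fun p => CyclicSorted (openBonds p.1) p.2
  have hA : (∏ j, (u * z j + 1)) * latticePairing N m t F H =
      ∑ p ∈ T, cyclicWeight (t : ℂ) N (cyclicEqualBonds (openBonds p.1) p.2) *
        (∏ i, a (p.2 i)) * F (stateVec (hop p.1 p.2)) * H (stateVec p.1) := by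
    rw [latticePairing, Finset.mul_sum, Finset.sum_filter, Finset.sum_product]
    refine Finset.sum_congr rfl fun κ hκ => ?_
    have h1 := hF.weight_mul_eigen hm ht0 (mem_latticeStates.1 hκ) a
    simp only [a, if_true, Bool.false_eq_true, if_false] at h1
    rw [← mul_assoc, h1, Finset.sum_mul]
    refine Finset.sum_congr rfl fun ε _ => ?_
    simp only [a]
    split_ifs
    · ring
    · rw [zero_mul]
  have hB : (∏ j, (w j + u)) * latticePairing N m t F H =
      ∑ p ∈ T, cyclicWeight (t : ℂ) N (cyclicEqualBonds (openBonds p.1) p.2) *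
        (∏ i, a (!p.2 i)) * H (stateVec (hop p.1 p.2)) * F (stateVec p.1) := by
    rw [latticePairing, Finset.mul_sum, Finset.sum_filter, Finset.sum_product]
    refine Finset.sum_congr rfl fun κ hκ => ?_
    have h1 := hH.weight_mul_eigen hm ht0 (mem_latticeStates.1 hκ) (fun b => a (!b))
    simp only [a, Bool.not_true, Bool.not_false, if_true, Bool.false_eq_true, if_false,
      one_mul] at h1
    rw [mul_assoc (cyclicWeight _ _ _), mul_comm (F _), ← mul_assoc (cyclicWeight _ _ _),
      ← mul_assoc, h1, Finset.sum_mul]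
    refine Finset.sum_congr rfl fun ε _ => ?_
    simp only [a]
    split_ifs
    · ring
    · rw [zero_mul]
  rw [hA, hB]
  -- The involution `(κ, ε) ↦ (hop κ ε, ¬ε)` preserves the weight and exchanges the arguments of `F`
  -- and `H`, so it matches the two sums term by term.
  have hmem : ∀ p ∈ T, ((hop p.1 p.2, fun j => !p.2 j) :
      (Fin (N + 1) → ℕ) × (Fin (N + 1) → Bool)) ∈ T := by
    intro p hp
    simp only [T, Finset.mem_filter, Finset.mem_product, Finset.mem_univ, and_true,
      mem_latticeStates] at hp ⊢
    exact ⟨(sum_hop hp.2).trans hp.1, cyclicSorted_hop hp.2⟩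
  have hinv : ∀ p ∈ T, hop (hop p.1 p.2) (fun j => !p.2 j) = p.1 := by
    intro p hp
    have hp' : CyclicSorted (openBonds p.1) p.2 := (Finset.mem_filter.1 hp).2
    exact hop_hop hp' (cyclicSorted_hop hp')
  refine Finset.sum_nbij' (fun p => (hop p.1 p.2, fun j => !p.2 j))
    (fun p => (hop p.1 p.2, fun j => !p.2 j)) hmem hmem ?_ ?_ ?_
  · intro p hp
    refine Prod.ext (hinv p hp) ?_
    simp
  · intro p hp
    refine Prod.ext (hinv p hp) ?_
    simp
  · intro p hp
    have hp' : CyclicSorted (openBonds p.1) p.2 := (Finset.mem_filter.1 hp).2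
    simp only [hinv p hp, Bool.not_not, cyclicEqualBonds_hop hp']
    ring

/-! ### The weight function as a product over runs -/

lemma one_le_firstRun : ∀ (n : ℕ) (b : ℕ → Bool), 1 ≤ firstRun n b
  | 0, _ => le_rfl
  | n + 1, b => by
    unfold firstRun
    split_ifs <;> omega

lemma firstRun_le : ∀ (n : ℕ) (b : ℕ → Bool), firstRun n b ≤ n + 1
  | 0, _ => le_rfl
  | n + 1, b => by
    have := firstRun_le n fun l => b (l + 1)
    unfold firstRun
    split_ifs <;> omega

lemma lt_firstRun_iff : ∀ (n : ℕ) (b : ℕ → Bool) (h : ℕ), h < n →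
    (h + 1 < firstRun n b ↔ ∀ l, l < h + 1 → b l = true)
  | 0, _, _, hh => absurd hh (Nat.not_lt_zero _)
  | n + 1, b, h, hh => by
    unfold firstRun
    split_ifs with hb
    · cases h with
      | zero =>
        have := one_le_firstRun n fun l => b (l + 1)
        refine ⟨fun _ l hl => ?_, fun _ => by omega⟩
        rwa [Nat.lt_one_iff.1 (by omega : l < 1)]
      | succ h =>
        rw [add_comm 1, Nat.add_lt_add_iff_right, lt_firstRun_iff n _ h (by omega)]
        refine ⟨fun H l hl => ?_, fun H l hl => H (l + 1) (by omega)⟩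
        cases l with
        | zero => exact hb
        | succ l => exact H l (by omega)
    · refine ⟨fun H => by omega, fun H => absurd (H 0 (by omega)) hb⟩

/-- The contribution of a pair of particles at distance `h` to the weight function. -/
def pairWeight (t : ℝ) (h : ℕ) : ℝ := (1 - t ^ h) / (1 - t ^ (1 + h))

/-- The product over distances telescopes to `(1 - t)/(1 - t^r)`. It turns the weight per site into
a weight per pair, as in `latticeWeight`. -/
lemma inv_qInt_eq_prod {t : ℝ} (ht0 : 0 < t) (ht1 : t < 1) {N r : ℕ} (h1 : 1 ≤ r)
    (h2 : r ≤ N + 1) :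
    (qInt t r)⁻¹ = ∏ h : Fin N, if h.val + 1 < r then pairWeight t (h.val + 1) else 1 := by
  obtain ⟨s, rfl⟩ := Nat.exists_eq_add_of_le' h1
  rw [Fin.prod_univ_eq_prod_range (fun h => if h + 1 < s + 1 then pairWeight t (h + 1) else 1),
    ← Finset.prod_filter]
  have h3 : (Finset.range N).filter (fun h => h + 1 < s + 1) = Finset.range s := by
    ext h
    simp only [Finset.mem_filter, Finset.mem_range]
    omega
  have h4 : ∀ h, pairWeight t (h + 1) = (1 - t ^ (h + 1)) / (1 - t ^ (h + 1 + 1)) := by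
    intro h
    rw [pairWeight, add_comm 1]
  have hne : ∀ i, 1 - t ^ (i + 1) ≠ 0 := fun i =>
    (sub_pos.2 (pow_lt_one₀ ht0.le ht1 (Nat.succ_ne_zero i))).ne'
  have h5 : ∀ s, ∏ h ∈ Finset.range s, (1 - t ^ (h + 1)) / (1 - t ^ (h + 1 + 1)) =
      (1 - t) / (1 - t ^ (s + 1)) := by
    intro s
    induction s with
    | zero => simpa using (div_self (by simpa using hne 0)).symm
    | succ s ih =>
      rw [Finset.prod_range_succ, ih]
      have := hne s
      field_simp
  rw [h3]
  simp only [h4]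
  rw [h5, qInt, geom_sum_eq ht1.ne, inv_div, ← neg_sub, ← neg_sub (1 : ℝ), neg_div_neg_eq]

lemma fin_sub_val {n : ℕ} (a b : Fin n) :
    (a - b).val = if b.val ≤ a.val then a.val - b.val else n + a.val - b.val := by
  split_ifs with h
  · exact Fin.coe_sub_iff_le.2 h
  · exact Fin.coe_sub_iff_lt.2 (not_le.1 h)

lemma stateVec_sub {N : ℕ} (κ : Fin (N + 1) → ℕ) {i j : Fin (N + 1)} (hij : i ≤ j) :
    stateVec κ i - stateVec κ j =
      ((∑ l : Fin (N + 1), if i.val ≤ l.val ∧ l.val < j.val then κ l else 0 : ℕ) : ℝ) := by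
  rw [stateVec, ofGaps_sub _ hij, Fin.sum_univ_castSucc]
  rw [if_neg (c := i.val ≤ (Fin.last N).val ∧ (Fin.last N).val < j.val)]
  · push_cast
    simp
  · intro h
    have := j.isLt
    have h2 := h.2
    rw [Fin.val_last] at h2
    omega

lemma stateVec_sub_eq_zero {N : ℕ} (κ : Fin (N + 1) → ℕ) {i j : Fin (N + 1)} (hij : i < j) :
    stateVec κ i - stateVec κ j = 0 ↔ ∀ l : Fin (N + 1), (l - i).val < (j - i).val → κ l = 0 := by
  rw [stateVec_sub κ hij.le, Nat.cast_eq_zero, Finset.sum_eq_zero_iff]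
  refine forall_congr' fun l => ?_
  have h : (l - i).val < (j - i).val ↔ i.val ≤ l.val ∧ l.val < j.val := by
    rw [fin_sub_val, fin_sub_val]
    have := Fin.lt_def.1 hij
    have := j.isLt
    have := l.isLt
    split_ifs <;> omega
  rw [h]
  simp

/-- All gaps on the ring add up to `m`, so the value `m` is attained exactly when the gaps on the
complementary arc, from `j` around to `i`, vanish. -/
lemma stateVec_sub_eq {N m : ℕ} {κ : Fin (N + 1) → ℕ} (hκ : ∑ j, κ j = m) {i j : Fin (N + 1)}
    (hij : i < j) :
    stateVec κ i - stateVec κ j = m ↔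
      ∀ l : Fin (N + 1), (l - j).val < (i - j).val → κ l = 0 := by
  have hsplit : ∑ l : Fin (N + 1), (if i.val ≤ l.val ∧ l.val < j.val then κ l else 0) +
      ∑ l : Fin (N + 1), (if i.val ≤ l.val ∧ l.val < j.val then 0 else κ l) = m := by
    rw [← Finset.sum_add_distrib, ← hκ]
    refine Finset.sum_congr rfl fun l _ => ?_
    split_ifs <;> simp
  have hz : stateVec κ i - stateVec κ j = m ↔
      ∑ l : Fin (N + 1), (if i.val ≤ l.val ∧ l.val < j.val then 0 else κ l) = 0 := by
    rw [stateVec_sub κ hij.le, Nat.cast_inj]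
    omega
  rw [hz, Finset.sum_eq_zero_iff]
  refine forall_congr' fun l => ?_
  have h : (l - j).val < (i - j).val ↔ ¬(i.val ≤ l.val ∧ l.val < j.val) := by
    rw [fin_sub_val, fin_sub_val]
    have := Fin.lt_def.1 hij
    have := j.isLt
    have := l.isLt
    split_ifs <;> omega
  rw [h]
  simp

lemma firstRun_openBonds_iff {N : ℕ} (κ : Fin (N + 1) → ℕ) (i : Fin (N + 1)) (h : Fin N) :
    h.val + 1 < firstRun N (fun l => openBonds κ (i + Fin.ofNat (N + 1) l)) ↔
      ∀ l : Fin (N + 1), (l - i).val < h.succ.val → κ l = 0 := by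
  rw [lt_firstRun_iff N _ h.val h.isLt]
  simp only [openBonds_eq_true, Fin.val_succ]
  refine ⟨fun H l hl => ?_, fun H l hl => H _ ?_⟩
  · have := H _ hl
    rwa [Fin.ofNat_eq_cast, Fin.cast_val_eq_self, add_sub_cancel] at this
  · rw [add_sub_cancel_left, Fin.ofNat_eq_cast, Fin.val_natCast]
    exact lt_of_le_of_lt (Nat.mod_le _ _) hl

open Classical in
/-- The contribution of the arc from `i` to `j` to the weight function. -/
def arcWeight {N : ℕ} (t : ℝ) (κ : Fin (N + 1) → ℕ) (i j : Fin (N + 1)) : ℝ :=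
  if ∀ l : Fin (N + 1), (l - i).val < (j - i).val → κ l = 0 then pairWeight t (j - i).val else 1

lemma cyclicWeight_openBonds_eq {N : ℕ} {t : ℝ} (ht0 : 0 < t) (ht1 : t < 1)
    (κ : Fin (N + 1) → ℕ) :
    cyclicWeight t N (openBonds κ) = ∏ i, ∏ j, if i = j then 1 else arcWeight t κ i j := by
  unfold cyclicWeight
  refine Finset.prod_congr rfl fun i _ => ?_
  rw [inv_qInt_eq_prod ht0 ht1 (one_le_firstRun _ _) (firstRun_le _ _),
    ← Equiv.prod_comp (Equiv.addLeft i), Fin.prod_univ_succ]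
  simp only [Equiv.coe_addLeft, add_zero, if_true, one_mul]
  refine Finset.prod_congr rfl fun h _ => ?_
  have h1 : ¬ i = i + h.succ := fun h2 => Fin.succ_ne_zero h (left_eq_add.1 h2)
  refine Eq.trans ?_ (if_neg h1).symm
  rw [arcWeight, add_sub_cancel_left]
  simp only [firstRun_openBonds_iff, Fin.val_succ]

/-- The weight function of the lattice Hilbert space in terms of runs. -/
lemma latticeWeight_stateVec {N m : ℕ} {t : ℝ} (ht0 : 0 < t) (ht1 : t < 1)
    {κ : Fin (N + 1) → ℕ} (hκ : ∑ j, κ j = m) :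
    latticeWeight (N + 1) m t (stateVec κ) = cyclicWeight t N (openBonds κ) := by
  classical
  have h1 : ∏ p ∈ (posRoots (N + 1)).filter
      (fun p => inner ℝ (stateVec κ) (root p) = (0 : ℝ)),
      (1 - t ^ height p) / (1 - t ^ (1 + height p)) =
      ∏ i : Fin (N + 1), ∏ j, if i < j then arcWeight t κ i j else 1 := by
    rw [posRoots, Finset.filter_filter, Finset.prod_filter, Fintype.prod_prod_type]
    refine Finset.prod_congr rfl fun i _ => Finset.prod_congr rfl fun j _ => ?_
    by_cases hij : i < j
    · have hv : height (i, j) = (j - i).val := by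
        rw [fin_sub_val, if_pos (Fin.lt_def.1 hij).le, height]
      simp only [hij, true_and, if_true, inner_root, arcWeight, pairWeight,
        stateVec_sub_eq_zero κ hij, hv]
    · simp [hij]
  have h2 : ∏ p ∈ (posRoots (N + 1)).filter
      (fun p => inner ℝ (stateVec κ) (root p) = (m : ℝ)),
      (1 - t ^ (N + 1 - height p)) / (1 - t ^ (1 + (N + 1) - height p)) =
      ∏ i : Fin (N + 1), ∏ j, if i < j then arcWeight t κ j i else 1 := by
    rw [posRoots, Finset.filter_filter, Finset.prod_filter, Fintype.prod_prod_type]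
    refine Finset.prod_congr rfl fun i _ => Finset.prod_congr rfl fun j _ => ?_
    by_cases hij : i < j
    · have hij' := Fin.lt_def.1 hij
      have hj := j.isLt
      -- `n - height` is the length of the complementary arc, so roots with value `m` supply the
      -- ordered pairs that wrap around the ring.
      have hv : N + 1 - height (i, j) = (i - j).val := by
        rw [fin_sub_val, if_neg (by omega), height]
        simp only
        omega
      have hv' : 1 + (N + 1) - height (i, j) = 1 + (i - j).val := by
        rw [← hv, height]
        simp only
        omega
      simp only [hij, true_and, if_true, inner_root, arcWeight, pairWeight,
        stateVec_sub_eq hκ hij, hv, hv']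
    · simp [hij]
  rw [latticeWeight, h1, h2, cyclicWeight_openBonds_eq ht0 ht1,
    Finset.prod_comm (f := fun i j : Fin (N + 1) => if i < j then arcWeight t κ j i else 1),
    ← Finset.prod_mul_distrib]
  refine Finset.prod_congr rfl fun i _ => ?_
  rw [← Finset.prod_mul_distrib]
  refine Finset.prod_congr rfl fun j _ => ?_
  rcases lt_trichotomy i j with h | h | h
  · rw [if_pos h, if_neg h.asymm, if_neg h.ne, mul_one]
  · simp [h]
  · rw [if_pos h, if_neg h.asymm, if_neg h.ne', one_mul]

lemma cyclicWeight_ofReal {N : ℕ} (t : ℝ) (b : Fin (N + 1) → Bool) :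
    cyclicWeight (t : ℂ) N b = ((cyclicWeight t N b : ℝ) : ℂ) := by
  simp [cyclicWeight, qInt]

/-! ### The scalar product of staircase functions -/

lemma volume_floor_cell {m : ℕ} (hm : 1 ≤ m) (k : ℕ) :
    volume {x : ℝ | 0 < x ∧ ⌊(m : ℝ) * x⌋₊ = k} = ENNReal.ofReal (1 / m) := by
  have hm0 : (0 : ℝ) < m := by exact_mod_cast hm
  -- The two sets differ at most in the point `x = 0`, which matters only for `k = 0`.
  have h : {x : ℝ | 0 < x ∧ ⌊(m : ℝ) * x⌋₊ = k} =ᵐ[volume] Set.Ico ((k : ℝ) / m) ((k + 1) / m) := by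
    have h0 : ∀ᵐ x : ℝ, x ≠ 0 := by simp [ae_iff]
    filter_upwards [h0] with x hx
    refine propext ?_
    change (0 < x ∧ ⌊(m : ℝ) * x⌋₊ = k) ↔ (k : ℝ) / m ≤ x ∧ x < (k + 1) / m
    rw [div_le_iff₀ hm0, lt_div_iff₀ hm0, mul_comm x]
    constructor
    · rintro ⟨h1, h2⟩
      exact (Nat.floor_eq_iff (by positivity)).1 h2
    · rintro ⟨h1, h2⟩
      have h3 : 0 ≤ (m : ℝ) * x := (Nat.cast_nonneg k).trans h1
      have h4 : 0 ≤ x := nonneg_of_mul_nonneg_right h3 hm0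
      exact ⟨lt_of_le_of_ne h4 hx.symm, (Nat.floor_eq_iff h3).2 ⟨h1, h2⟩⟩
  rw [measure_congr h, Real.volume_Ico]
  congr 1
  ring

/-- The gap vectors whose scaled integral parts are given. -/
def floorCell {N : ℕ} (m : ℕ) (k : Fin N → ℕ) : Set (Fin N → ℝ) :=
  {y | ∀ j, 0 < y j ∧ ⌊(m : ℝ) * y j⌋₊ = k j}

lemma volume_floorCell {N m : ℕ} (hm : 1 ≤ m) (k : Fin N → ℕ) :
    volume (floorCell m k) = ENNReal.ofReal (1 / m) ^ N := by
  have h : floorCell m k = Set.pi Set.univ fun j => {x : ℝ | 0 < x ∧ ⌊(m : ℝ) * x⌋₊ = k j} := by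
    ext y
    simp only [floorCell, Set.mem_univ_pi]
    rfl
  rw [h, volume_pi_pi]
  simp only [volume_floor_cell hm, Finset.prod_const, Finset.card_univ, Fintype.card_fin]

lemma measurableSet_floorCell {N : ℕ} (m : ℕ) (k : Fin N → ℕ) :
    MeasurableSet (floorCell m k) := by
  have h : floorCell m k = {y : Fin N → ℝ | ∀ j, 0 < y j} ∩
      (fun (y : Fin N → ℝ) (j : Fin N) => ⌊(m : ℝ) * y j⌋₊) ⁻¹' {k} := by
    ext y
    simp only [Set.mem_inter_iff, Set.mem_preimage, Set.mem_singleton_iff, funext_iff]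
    exact forall_and
  rw [h]
  exact (measurableSet_gaps_pos N).inter (measurable_floor_gaps m (measurableSet_singleton k))

/-- Functions of the integral parts are integrated by summation over the lattice states. -/
lemma integral_gaps_of_floor {N m : ℕ} (hm : 1 ≤ m) (Φ : (Fin N → ℕ) → ℂ) :
    ∫ y in {y : Fin N → ℝ | ∀ j, 0 < y j},
        (if ∑ j, ⌊(m : ℝ) * y j⌋₊ ≤ m then Φ fun j => ⌊(m : ℝ) * y j⌋₊ else 0) =
      (1 / m : ℝ) ^ N * ∑ κ ∈ latticeStates N m, Φ fun j => κ j.castSucc := by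
  have h1 : ∀ y ∈ {y : Fin N → ℝ | ∀ j, 0 < y j},
      (if ∑ j, ⌊(m : ℝ) * y j⌋₊ ≤ m then Φ fun j => ⌊(m : ℝ) * y j⌋₊ else 0) =
      ∑ κ ∈ latticeStates N m, (floorCell m fun j => κ j.castSucc).indicator
        (fun _ => Φ fun j => κ j.castSucc) y := by
    intro y hy
    have hmem : ∀ k : Fin N → ℕ, y ∈ floorCell m k ↔ ∀ j, ⌊(m : ℝ) * y j⌋₊ = k j := fun k =>
      ⟨fun h j => (h j).2, fun h j => ⟨hy j, h j⟩⟩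
    split_ifs with h
    -- The last gap is determined by the total `m`, so exactly one state belongs to the given
    -- floors.
    · set κ₀ : Fin (N + 1) → ℕ :=
        Fin.snoc (fun j => ⌊(m : ℝ) * y j⌋₊) (m - ∑ j, ⌊(m : ℝ) * y j⌋₊) with hκ₀
      have hc : ∀ j : Fin N, κ₀ j.castSucc = ⌊(m : ℝ) * y j⌋₊ := fun j => by simp [hκ₀]
      have hl : κ₀ (Fin.last N) = m - ∑ j, ⌊(m : ℝ) * y j⌋₊ := by simp [hκ₀]
      rw [Finset.sum_eq_single κ₀]
      · rw [Set.indicator_of_mem ((hmem _).2 fun j => (hc j).symm)]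
        simp only [hc]
      · intro κ hκ hne
        refine Set.indicator_of_notMem (fun hy' => hne ?_) _
        rw [hmem] at hy'
        rw [mem_latticeStates, Fin.sum_univ_castSucc] at hκ
        funext l
        induction l using Fin.lastCases with
        | cast j => rw [hc, hy']
        | last =>
          simp only [← hy'] at hκ
          omega
      · intro h'
        refine absurd (mem_latticeStates.2 ?_) h'
        rw [Fin.sum_univ_castSucc]
        simp only [hc, hl]
        omega
    · refine (Finset.sum_eq_zero fun κ hκ => Set.indicator_of_notMem (fun hy' => h ?_) _).symm
      rw [hmem] at hy'
      rw [mem_latticeStates, Fin.sum_univ_castSucc] at hκ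
      simp only [hy']
      omega
  have hP := measurableSet_gaps_pos N
  rw [setIntegral_congr_fun hP h1, integral_finsetSum, Finset.mul_sum]
  · refine Finset.sum_congr rfl fun κ _ => ?_
    rw [integral_indicator_const _ (measurableSet_floorCell m _), Measure.real,
      Measure.restrict_eq_self _ (fun y hy j => (hy j).1), volume_floorCell hm, ENNReal.toReal_pow,
      ENNReal.toReal_ofReal (by positivity), Complex.real_smul]
    push_cast
    rfl
  · intro κ _
    refine (integrable_indicator_iff (measurableSet_floorCell m _)).2 (integrableOn_const ?_)
    refine ((Measure.restrict_apply_le _ _).trans_lt ?_).ne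
    rw [volume_floorCell hm]
    exact ENNReal.pow_lt_top ENNReal.ofReal_lt_top

/-- The two square roots multiply to the weight, and every cell has volume `m^{-N}`. That the
constant is nonzero is not recorded, since only the vanishing of the inner product is deduced. -/
lemma exists_innerOn_staircaseWave_eq {N m : ℕ} (hm : 1 ≤ m) {g : ℝ} (hg : 0 < g)
    (ξ ξ' : V (N + 1)) :
    ∃ c : ℂ, innerOn (chamber (N + 1)) (staircaseWave (N + 1) m g ξ)
      (staircaseWave (N + 1) m g ξ') =
      c * latticePairing N m (coupling g m)
        (fun lam => hallLittlewood (N + 1) (coupling g m) lam ξ)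
        (fun lam => (starRingEnd ℂ) (hallLittlewood (N + 1) (coupling g m) lam ξ')) := by
  have ht0 := coupling_pos g m
  have ht1 := coupling_lt_one hg hm
  obtain ⟨c, -, hc⟩ := innerOn_eq N
  refine ⟨c * (1 / m : ℝ) ^ N, ?_⟩
  rw [hc, preimage_chamber, latticePairing, mul_assoc]
  congr 1
  set Φ : (Fin N → ℕ) → ℂ := fun k =>
    (latticeWeight (N + 1) m (coupling g m) (ofGaps N fun j => (k j : ℝ)) : ℂ) *
      hallLittlewood (N + 1) (coupling g m) (ofGaps N fun j => (k j : ℝ)) ξ *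
      (starRingEnd ℂ) (hallLittlewood (N + 1) (coupling g m) (ofGaps N fun j => (k j : ℝ)) ξ')
    with hΦ
  have h1 : ∀ y : Fin N → ℝ, staircaseWave (N + 1) m g ξ (ofGaps N y) *
      (starRingEnd ℂ) (staircaseWave (N + 1) m g ξ' (ofGaps N y)) =
      if ∑ j, ⌊(m : ℝ) * y j⌋₊ ≤ m then Φ fun j => ⌊(m : ℝ) * y j⌋₊ else 0 := by
    intro y
    rw [staircaseWave_ofGaps, staircaseWave_ofGaps]
    split_ifs
    · have h2 := Real.mul_self_sqrt (latticeWeight_mem (n := N + 1) (m := m) ht0 ht1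
        (ofGaps N fun j => (⌊(m : ℝ) * y j⌋₊ : ℝ))).1
      rw [map_mul, Complex.conj_ofReal]
      simp only [hΦ]
      conv_rhs => rw [← h2]
      push_cast
      ring
    · simp
  simp only [h1]
  rw [integral_gaps_of_floor hm]
  congr 1
  refine Finset.sum_congr rfl fun κ hκ => ?_
  rw [cyclicWeight_ofReal, ← latticeWeight_stateVec ht0 ht1 (mem_latticeStates.1 hκ)]
  rfl

/-! ### Separation of the Bethe vectors -/

/-- As the spread of `ξ` is less than `2π`, its coordinates are distinct modulo `2π`, so matching
them with those of `ξ'` gives a permutation with integer winding numbers. These differ by at most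
one and add up to zero, hence all vanish; two decreasing vectors with the same entries are equal. -/
lemma eq_of_exp_eq_exp {N : ℕ} {ξ ξ' : V (N + 1)} (hξ : ξ ∈ chamber (N + 1))
    (hξ' : ξ' ∈ chamber (N + 1)) (h : ξ 0 - ξ (Fin.last N) < 2 * Real.pi)
    (h' : ξ' 0 - ξ' (Fin.last N) < 2 * Real.pi)
    (hex : ∀ j, ∃ i, Complex.exp (Complex.I * ξ j) = Complex.exp (Complex.I * ξ' i)) :
    ξ = ξ' := by
  have hanti := strictAnti_of_mem_chamber hξ
  have hanti' := strictAnti_of_mem_chamber hξ'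
  have hlt : ∀ i j, ξ i - ξ j < 2 * Real.pi := fun i j => by
    have h1 := hanti.antitone (Fin.zero_le i)
    have h2 := hanti.antitone (Fin.le_last j)
    linarith
  have hlt' : ∀ i j, ξ' i - ξ' j < 2 * Real.pi := fun i j => by
    have h1 := hanti'.antitone (Fin.zero_le i)
    have h2 := hanti'.antitone (Fin.le_last j)
    linarith
  have hex' : ∀ j, ∃ (i : Fin (N + 1)) (a : ℤ), ξ j = ξ' i + 2 * Real.pi * a := by
    intro j
    obtain ⟨i, hi⟩ := hex j
    obtain ⟨a, ha⟩ := Complex.exp_eq_exp_iff_exists_int.1 hi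
    refine ⟨i, a, ?_⟩
    have h1 : Complex.I * (ξ j : ℂ) = Complex.I * ((ξ' i + 2 * Real.pi * a : ℝ) : ℂ) := by
      rw [ha]
      push_cast
      ring
    exact_mod_cast mul_left_cancel₀ Complex.I_ne_zero h1
  choose π a hπ using hex'
  have hp := Real.pi_pos
  have hinj : Function.Injective π := by
    intro i j hij
    by_contra hne
    have h1 : ξ i - ξ j = 2 * Real.pi * (a i - a j : ℤ) := by
      rw [hπ i, hπ j, hij]
      push_cast
      ring
    have h2 : (a i - a j : ℤ) ≠ 0 := by
      intro h0
      rw [h0, Int.cast_zero, mul_zero, sub_eq_zero] at h1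
      exact hne (hanti.injective h1)
    rcases lt_or_gt_of_ne h2 with h3 | h3
    · have h4 : ((a i - a j : ℤ) : ℝ) ≤ -1 := by exact_mod_cast Int.le_sub_one_of_lt h3
      have := hlt j i
      nlinarith
    · have h4 : (1 : ℝ) ≤ ((a i - a j : ℤ) : ℝ) := by exact_mod_cast h3
      have := hlt i j
      nlinarith
  have hbij : Function.Bijective π := Finite.injective_iff_bijective.1 hinj
  -- A difference of two or more would give `ξ_i - ξ_j > 4π - 2π`, contrary to the spread of `ξ`.
  have hdiff : ∀ i j, a i - a j ≤ 1 := by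
    intro i j
    by_contra! h1
    have h2 : (2 : ℝ) ≤ ((a i - a j : ℤ) : ℝ) := by exact_mod_cast h1
    have h3 := hlt i j
    have h4 := hlt' (π j) (π i)
    rw [hπ i, hπ j] at h3
    push_cast at h2
    nlinarith
  have hsum : ∑ j, a j = 0 := by
    have h1 : ∑ j, ξ j = ∑ j, ξ' (π j) + 2 * Real.pi * ∑ j, (a j : ℝ) := by
      rw [Finset.mul_sum, ← Finset.sum_add_distrib]
      exact Finset.sum_congr rfl fun j _ => hπ j
    rw [hbij.sum_comp (fun j => ξ' j), mem_massPlane.1 hξ.1, mem_massPlane.1 hξ'.1, zero_add] at h1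
    have h2 : ∑ j, (a j : ℝ) = 0 := by
      rcases mul_eq_zero.1 h1.symm with h3 | h3
      · linarith
      · exact h3
    exact_mod_cast h2
  have hzero : ∀ j, a j = 0 := by
    intro j
    by_contra hne
    rcases lt_or_gt_of_ne hne with h1 | h1
    · have h2 : ∀ i ∈ Finset.univ, a i ≤ 0 := fun i _ => by have := hdiff i j; omega
      have h3 := Finset.sum_lt_sum h2 ⟨j, Finset.mem_univ j, h1⟩
      rw [hsum] at h3
      simp at h3
    · have h2 : ∀ i ∈ Finset.univ, 0 ≤ a i := fun i _ => by have := hdiff j i; omega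
      have h3 := Finset.sum_lt_sum h2 ⟨j, Finset.mem_univ j, h1⟩
      rw [hsum] at h3
      simp at h3
  have heq : ∀ j, ξ j = ξ' (π j) := fun j => by rw [hπ j, hzero j]; simp
  have hcomp : ξ.ofLp = ξ'.ofLp ∘ π := funext heq
  have hfun := (hanti.range_inj hanti').1 (by rw [hcomp, hbij.surjective.range_comp])
  ext j
  exact congrFun hfun j

lemma IsLatticeBetheVector.label_injective {N m : ℕ} {t : ℝ} {k k' : Fin N → ℕ} {ξ : V (N + 1)}
    (h : IsLatticeBetheVector (N + 1) m t (ofGaps N fun j => (k j : ℝ)) ξ)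
    (h' : IsLatticeBetheVector (N + 1) m t (ofGaps N fun j => (k' j : ℝ)) ξ) : k = k' := by
  have h1 : ofGaps N (fun j => (1 + k j : ℝ)) = ofGaps N (fun j => (1 + k' j : ℝ)) := by
    ext j
    have h2 := (h.phase_eq j).symm.trans (h'.phase_eq j)
    exact mul_left_cancel₀ (by have := Real.pi_pos; positivity) h2
  funext j
  have h2 := congrFun (ofGaps_injective N h1) j
  exact_mod_cast add_left_cancel h2

lemma innerOn_staircaseWave_eq_zero {N m : ℕ} (hm : 1 ≤ m) {g : ℝ} (hg : 0 < g)
    {k k' : Fin N → ℕ} (hk : ∑ j, k j ≤ m) (hk' : ∑ j, k' j ≤ m) (hne : k ≠ k') {ξ ξ' : V (N + 1)}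
    (h : IsLatticeBetheVector (N + 1) m (coupling g m) (ofGaps N fun j => (k j : ℝ)) ξ)
    (h' : IsLatticeBetheVector (N + 1) m (coupling g m) (ofGaps N fun j => (k' j : ℝ)) ξ') :
    innerOn (chamber (N + 1)) (staircaseWave (N + 1) m g ξ) (staircaseWave (N + 1) m g ξ') = 0 := by
  have ht0 := coupling_pos g m
  have ht1 := coupling_lt_one hg hm
  obtain ⟨c, hc⟩ := exists_innerOn_staircaseWave_eq hm hg ξ ξ'
  rw [hc]
  by_contra hS
  have hS' := right_ne_zero_of_mul hS
  have hF := isBetheFunction_hallLittlewood ht0 ht1 h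
  have hH := (isBetheFunction_hallLittlewood ht0 ht1 h').conj
  have hconj : ∀ j, (starRingEnd ℂ) (Complex.exp (Complex.I * ξ' j)) =
      (Complex.exp (Complex.I * ξ' j))⁻¹ := by
    intro j
    rw [← Complex.exp_conj, ← Complex.exp_neg]
    simp
  have hex : ∀ j, ∃ i, Complex.exp (Complex.I * ξ j) = Complex.exp (Complex.I * ξ' i) := by
    intro j
    -- The chosen `u` is a root of the left eigenvalue polynomial, hence of the right one.
    have h1 := mul_right_cancel₀ hS'
      (latticePairing_adjoint hm ht0 hF hH (-(Complex.exp (Complex.I * ξ j))⁻¹))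
    have h2 : ∏ i, (-(Complex.exp (Complex.I * ξ j))⁻¹ * Complex.exp (Complex.I * ξ i) + 1) = 0 :=
      Finset.prod_eq_zero (Finset.mem_univ j) (by
        rw [neg_mul, inv_mul_cancel₀ (Complex.exp_ne_zero _)]
        ring)
    rw [h2] at h1
    obtain ⟨i, -, hi⟩ := Finset.prod_eq_zero_iff.1 h1.symm
    refine ⟨i, ?_⟩
    rw [hconj, ← sub_eq_add_neg, sub_eq_zero] at hi
    exact inv_injective hi.symm
  have heq := eq_of_exp_eq_exp (h.mem_chamber ht0 ht1 hm) (h'.mem_chamber ht0 ht1 hm)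
    (h.sub_lt ht0 ht1 hk) (h'.sub_lt ht0 ht1 hk') hex
  subst heq
  exact hne (h.label_injective h')

/-! ### Positivity of the norms -/

/-- The coefficient of the dominant exponential of a vanishing exponential sum is zero. -/
lemma coeff_eq_zero_of_exp_sum_eq_zero {ι : Type*} [Fintype ι] [DecidableEq ι] {d : ι → ℂ}
    {A : ι → ℝ} {i₀ : ι} (hA : ∀ i, i ≠ i₀ → A i < A i₀)
    (h : ∀ᶠ s : ℝ in 𝓝 0, ∑ i, d i * Complex.exp (Complex.I * ((s * A i : ℝ) : ℂ)) = 0) :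
    d i₀ = 0 := by
  -- The sum is the restriction to the imaginary axis of an entire function, which therefore
  -- vanishes on the real axis too. There, after division by the dominant exponential, only the
  -- coefficient `d i₀` survives as `r → ∞`.
  set f : ℂ → ℂ := fun z => ∑ i, d i * Complex.exp (z * A i) with hf
  have hd : Differentiable ℂ f := by
    intro z
    simp only [hf]
    fun_prop
  have ha : AnalyticOnNhd ℂ f Set.univ := fun z _ => hd.analyticAt z
  have ht : Tendsto (fun s : ℝ => Complex.I * (s : ℂ)) (𝓝[≠] 0) (𝓝[≠] 0) := by
    refine tendsto_nhdsWithin_of_tendsto_nhds_of_eventually_within _ ?_ ?_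
    · have : Continuous fun s : ℝ => Complex.I * (s : ℂ) := by fun_prop
      have h0 := this.tendsto 0
      rw [Complex.ofReal_zero, mul_zero] at h0
      exact h0.mono_left nhdsWithin_le_nhds
    · filter_upwards [self_mem_nhdsWithin] with s hs
      exact mul_ne_zero Complex.I_ne_zero (by exact_mod_cast hs)
  have hfreq : ∃ᶠ z in 𝓝[≠] (0 : ℂ), f z = 0 := by
    refine ht.frequently (Eventually.frequently ?_)
    filter_upwards [h.filter_mono nhdsWithin_le_nhds] with s hs
    rw [← hs, hf]
    refine Finset.sum_congr rfl fun i _ => ?_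
    push_cast
    rw [mul_assoc]
  have hz := ha.eqOn_zero_of_preconnected_of_frequently_eq_zero isPreconnected_univ
    (Set.mem_univ 0) hfreq
  have h1 : ∀ r : ℝ, ∑ i, d i * ((Real.exp (r * (A i - A i₀)) : ℝ) : ℂ) = 0 := by
    intro r
    have h2 : f r = 0 := hz (Set.mem_univ (r : ℂ))
    have h3 : ∑ i, d i * ((Real.exp (r * (A i - A i₀)) : ℝ) : ℂ) =
        f r * Complex.exp (-(r * A i₀)) := by
      rw [hf, Finset.sum_mul]
      refine Finset.sum_congr rfl fun i _ => ?_
      rw [mul_assoc, ← Complex.exp_add, Complex.ofReal_exp]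
      congr 2
      push_cast
      ring
    rw [h3, h2, zero_mul]
  have h2 : Tendsto (fun r : ℝ => ∑ i, d i * ((Real.exp (r * (A i - A i₀)) : ℝ) : ℂ)) atTop
      (𝓝 (∑ i, d i * if i = i₀ then 1 else 0)) := by
    refine tendsto_finsetSum _ fun i _ => Tendsto.const_mul _ ?_
    split_ifs with hi
    · subst hi
      simp
    · have h3 : Tendsto (fun r : ℝ => Real.exp (r * (A i - A i₀))) atTop (𝓝 0) :=
        Real.tendsto_exp_atBot.comp
          (tendsto_id.atTop_mul_const_of_neg (sub_neg.2 (hA i hi)))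
      have h4 := (Complex.continuous_ofReal.tendsto 0).comp h3
      rwa [Complex.ofReal_zero] at h4
  simp only [h1] at h2
  have h3 := tendsto_nhds_unique h2 tendsto_const_nhds
  simpa using h3

/-- The rearrangement inequality. Equality would make the rearranged `b` strictly decreasing again,
hence equal to `b`. -/
lemma sum_mul_comp_symm_lt {n : ℕ} {a b : Fin n → ℝ} (ha : StrictAnti a) (hb : StrictAnti b)
    {σ : Equiv.Perm (Fin n)} (hσ : σ ≠ 1) : ∑ i, a i * b (σ.symm i) < ∑ i, a i * b i := by
  have hmono : Monovary a b := fun i j h => ha.antitone (hb.lt_iff_gt.1 h).le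
  refine hmono.sum_mul_comp_perm_lt_sum_mul_iff.2 fun h => hσ ?_
  have hanti : StrictAnti (b ∘ σ.symm) := by
    intro i j hij
    refine lt_of_le_of_ne (not_lt.1 fun h1 => ?_) fun h1 => ?_
    · exact absurd (h h1) (not_le.2 (ha hij))
    · exact hij.ne' (σ.symm.injective (hb.injective h1))
  have h1 := (hanti.range_inj hb).1 (by rw [σ.symm.surjective.range_comp])
  refine Equiv.ext fun i => ?_
  have h2 := hb.injective (congrFun h1 (σ i))
  simpa using h2.symm

lemma liebLinigerFactor_ne_zero {g d : ℝ} (hd : d ≠ 0) : liebLinigerFactor g d ≠ 0 := by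
  refine div_ne_zero (fun h => hd ?_) (by exact_mod_cast hd)
  have := congrArg Complex.re h
  simpa using this

lemma strictAnti_ofGaps_one (N : ℕ) : StrictAnti (ofGaps N fun _ => (1 : ℝ)).ofLp :=
  strictAnti_of_mem_chamber (ofGaps_mem_chamber.2 fun _ => one_pos)

/-- The interior of the alcove, in gap coordinates. -/
def openGapAlcove (N : ℕ) : Set (Fin N → ℝ) := {y | ∑ j, y j < 1 ∧ ∀ j, 0 < y j}

lemma isOpen_openGapAlcove (N : ℕ) : IsOpen (openGapAlcove N) := by
  refine (isOpen_lt (f := fun y : Fin N → ℝ => ∑ j, y j) (by fun_prop) continuous_const).inter ?_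
  change IsOpen {y : Fin N → ℝ | ∀ j, 0 < y j}
  simp only [Set.ofPred_forall]
  exact isOpen_iInter_of_finite fun j => isOpen_lt continuous_const (continuous_apply j)

lemma center_mem_openGapAlcove (N : ℕ) :
    (fun _ => 1 / (N + 1 : ℝ) : Fin N → ℝ) ∈ openGapAlcove N := by
  refine ⟨?_, fun j => by positivity⟩
  have : (0 : ℝ) < N + 1 := by positivity
  simp only [Finset.sum_const, Finset.card_univ, Fintype.card_fin, nsmul_eq_mul]
  rw [mul_one_div, div_lt_one this]
  linarith

lemma openGapAlcove_subset (N : ℕ) : openGapAlcove N ⊆ ofGaps N ⁻¹' alcove (N + 1) := by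
  rw [preimage_alcove]
  exact fun y hy => ⟨hy.1.le, fun j => (hy.2 j).le⟩

/-- On the line through an interior point in the direction `ρ` the wave function is an exponential
sum with frequencies `⟨ρ, ξ_σ⟩`. By rearrangement the identity alone attains the largest one, and
its coefficient is a product of nonzero factors. -/
lemma exists_liebLinigerWave_ne_zero {N : ℕ} {g : ℝ} {ξ : V (N + 1)} (hξ : ξ ∈ chamber (N + 1)) :
    ∃ y ∈ openGapAlcove N, liebLinigerWave (N + 1) g ξ (ofGaps N y) ≠ 0 := by
  by_contra! h
  have hanti := strictAnti_of_mem_chamber hξ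
  set y₀ : Fin N → ℝ := fun _ => 1 / (N + 1 : ℝ)
  set e : Fin N → ℝ := fun _ => 1
  set C : Equiv.Perm (Fin (N + 1)) → ℂ := fun σ =>
    ∏ p ∈ posRoots (N + 1), liebLinigerFactor g (ξ (σ.symm p.1) - ξ (σ.symm p.2))
  have hnear : ∀ᶠ s : ℝ in 𝓝 0, y₀ + s • e ∈ openGapAlcove N := by
    have hc : Continuous fun s : ℝ => y₀ + s • e := by fun_prop
    refine hc.continuousAt.eventually_mem ((isOpen_openGapAlcove N).mem_nhds ?_)
    rw [zero_smul, add_zero]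
    exact center_mem_openGapAlcove N
  have hzero : C 1 * Complex.exp
      (Complex.I * ((∑ i, ofGaps N y₀ i * ξ ((1 : Equiv.Perm (Fin (N + 1))).symm i) : ℝ) : ℂ)) =
      0 := by
    refine coeff_eq_zero_of_exp_sum_eq_zero
      (d := fun σ => C σ * Complex.exp
        (Complex.I * ((∑ i, ofGaps N y₀ i * ξ (σ.symm i) : ℝ) : ℂ)))
      (A := fun σ => ∑ i, ofGaps N e i * ξ (σ.symm i)) (i₀ := 1)
      (fun σ hσ => sum_mul_comp_symm_lt (strictAnti_ofGaps_one N) hanti hσ) ?_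
    filter_upwards [hnear] with s hs
    rw [← h _ hs, liebLinigerWave_eq]
    refine Finset.sum_congr rfl fun σ _ => ?_
    rw [mul_assoc, ← Complex.exp_add, ← mul_add, ← Complex.ofReal_add]
    congr 4
    rw [Finset.mul_sum, ← Finset.sum_add_distrib]
    refine Finset.sum_congr rfl fun i _ => ?_
    rw [map_add, map_smul, PiLp.add_apply, PiLp.smul_apply, smul_eq_mul]
    ring
  rcases mul_eq_zero.1 hzero with h1 | h1
  · obtain ⟨p, hp, h2⟩ := Finset.prod_eq_zero_iff.1 h1
    have hp' : p.1 < p.2 := by simpa [posRoots] using hp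
    exact liebLinigerFactor_ne_zero (sub_ne_zero.2 (hanti hp').ne') h2
  · exact Complex.exp_ne_zero _ h1

/-- A continuous nonnegative function with integral zero would vanish on the whole open alcove. -/
lemma innerOn_liebLinigerWave_self {N : ℕ} {g : ℝ} {ξ : V (N + 1)} (hξ : ξ ∈ chamber (N + 1)) :
    ∃ r : ℝ, 0 < r ∧ innerOn (alcove (N + 1)) (liebLinigerWave (N + 1) g ξ)
      (liebLinigerWave (N + 1) g ξ) = (r : ℂ) := by
  obtain ⟨c, hc0, hc⟩ := innerOn_eq N
  set ψ : (Fin N → ℝ) → ℂ := fun y => liebLinigerWave (N + 1) g ξ (ofGaps N y) with hψ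
  have hcont : Continuous ψ :=
    (continuous_liebLinigerWave (N + 1) g ξ).comp (continuous_ofGaps N)
  set D : Set (Fin N → ℝ) := ofGaps N ⁻¹' alcove (N + 1)
  have hcont2 : Continuous fun y => ‖ψ y‖ ^ 2 := by fun_prop
  have hint : IntegrableOn (fun y => ‖ψ y‖ ^ 2) D :=
    hcont2.continuousOn.integrableOn_compact (isCompact_preimage_alcove N)
  refine ⟨c * ∫ y in D, ‖ψ y‖ ^ 2, mul_pos hc0 ?_, ?_⟩
  · have hnn : 0 ≤ ∫ y in D, ‖ψ y‖ ^ 2 := integral_nonneg fun y => by positivity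
    refine lt_of_le_of_ne hnn fun h0 => ?_
    have h1 := (integral_eq_zero_iff_of_nonneg (fun y => by positivity) hint).1 h0.symm
    have h2 : (fun y => ‖ψ y‖ ^ 2) =ᵐ[volume.restrict (openGapAlcove N)] fun _ => 0 :=
      ae_mono (Measure.restrict_mono (openGapAlcove_subset N) le_rfl) h1
    have h3 := Measure.eqOn_open_of_ae_eq h2 (isOpen_openGapAlcove N) hcont2.continuousOn
      continuousOn_const
    obtain ⟨y, hy, hne⟩ := exists_liebLinigerWave_ne_zero (g := g) hξ
    have h4 := h3 hy
    simp only [ne_eq, OfNat.ofNat_ne_zero, not_false_eq_true, pow_eq_zero_iff, norm_eq_zero] at h4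
    exact hne h4
  · rw [hc, Complex.ofReal_mul, ← integral_complex_ofReal]
    congr 2
    funext y
    rw [Complex.mul_conj, Complex.normSq_eq_norm_sq]

/-! ### Assembly of the four assertions -/

/-- The Bethe vectors and wave functions of the lattice model. -/
lemma latticeBethe_main {N m : ℕ} (hm : 1 ≤ m) {g : ℝ} (hg : 0 < g) {μ : V (N + 1)}
    (hμ : μ ∈ latticeAlcove (N + 1) m) :
    (∃! ξ : V (N + 1), IsLatticeBetheVector (N + 1) m (coupling g m) μ ξ) ∧
      latticeBetheVector (N + 1) m (coupling g m) μ ∈ openAlcoveTwoPi (N + 1) ∧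
      LatticeBetheSystem (N + 1) m (coupling g m)
        (latticeBetheVector (N + 1) m (coupling g m) μ) ∧
      MemLp (staircaseWave (N + 1) m g (latticeBetheVector (N + 1) m (coupling g m) μ)) 2
        ((planeVolume (N + 1)).restrict (chamber (N + 1))) := by
  obtain ⟨k, hk, rfl⟩ := mem_latticeAlcove.1 hμ
  have ht0 := coupling_pos g m
  have ht1 := coupling_lt_one hg hm
  have hξ := latticeBetheVector_spec ht0 ht1 hm k
  refine ⟨existsUnique_latticeBethe ht0 ht1 hm k, ⟨hξ.mem_chamber ht0 ht1 hm, ?_⟩,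
    hξ.betheSystem ht0 ht1, memLp_staircaseWave hm hg _⟩
  rw [inner_highestRoot]
  exact hξ.sub_lt ht0 ht1 hk

/-- The Bethe vectors and wave functions of the Lieb–Liniger model. -/
lemma yangYang_main {N : ℕ} {g : ℝ} (hg : 0 < g) {μ : V (N + 1)}
    (hμ : μ ∈ dominantWeights (N + 1)) :
    (∃! ξ : V (N + 1), IsYangYangVector (N + 1) g μ ξ) ∧
      yangYangVector (N + 1) g μ ∈ chamber (N + 1) ∧
      LiebLinigerBetheSystem (N + 1) g (yangYangVector (N + 1) g μ) ∧
      MemLp (liebLinigerWave (N + 1) g (yangYangVector (N + 1) g μ)) 2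
        ((planeVolume (N + 1)).restrict (alcove (N + 1))) := by
  obtain ⟨k, rfl⟩ := mem_dominantWeights.1 hμ
  have hξ := yangYangVector_spec hg k
  exact ⟨existsUnique_yangYang hg k, hξ.mem_chamber hg, hξ.betheSystem hg,
    memLp_liebLinigerWave g _⟩

lemma tendsto_innerOn_betheVectors {N : ℕ} {g : ℝ} (hg : 0 < g) (k k' : Fin N → ℕ) :
    Tendsto (fun m : ℕ => innerOn (chamber (N + 1))
        (staircaseWave (N + 1) m g
          (latticeBetheVector (N + 1) m (coupling g m) (ofGaps N fun j => (k j : ℝ))))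
        (staircaseWave (N + 1) m g
          (latticeBetheVector (N + 1) m (coupling g m) (ofGaps N fun j => (k' j : ℝ)))))
      atTop
      (𝓝 (innerOn (alcove (N + 1))
        (liebLinigerWave (N + 1) g (yangYangVector (N + 1) g (ofGaps N fun j => (k j : ℝ))))
        (liebLinigerWave (N + 1) g (yangYangVector (N + 1) g (ofGaps N fun j => (k' j : ℝ)))))) :=
  tendsto_innerOn hg
    (strictAnti_of_mem_chamber ((yangYangVector_spec hg k).mem_chamber hg)).injective
    (strictAnti_of_mem_chamber ((yangYangVector_spec hg k').mem_chamber hg)).injective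
    (tendsto_latticeBetheVector hg k) (tendsto_latticeBetheVector hg k')

/-- Orthogonality of the Lieb–Liniger functions, inherited from the lattice. -/
lemma innerOn_liebLinigerWave_eq_zero {N : ℕ} {g : ℝ} (hg : 0 < g) {k k' : Fin N → ℕ}
    (hne : k ≠ k') :
    innerOn (alcove (N + 1))
      (liebLinigerWave (N + 1) g (yangYangVector (N + 1) g (ofGaps N fun j => (k j : ℝ))))
      (liebLinigerWave (N + 1) g (yangYangVector (N + 1) g (ofGaps N fun j => (k' j : ℝ)))) = 0 := by
  refine tendsto_nhds_unique (tendsto_innerOn_betheVectors hg k k') ?_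
  refine tendsto_const_nhds.congr' ?_
  filter_upwards [eventually_ge_atTop 1, eventually_ge_atTop (∑ j, k j),
    eventually_ge_atTop (∑ j, k' j)] with m hm hk hk'
  have ht0 := coupling_pos g m
  have ht1 := coupling_lt_one hg hm
  exact (innerOn_staircaseWave_eq_zero hm hg hk hk' hne (latticeBetheVector_spec ht0 ht1 hm k)
    (latticeBetheVector_spec ht0 ht1 hm k')).symm

end BetheAlcove
end

theorem proposition6p2 (n : ℕ) (hn : 1 ≤ n) (g : ℝ) (hg : 0 < g) :
    -- the lattice Bethe vectors are well defined, and the staircase functions are in `L²(C)`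
    (∀ m : ℕ, 1 ≤ m → ∀ μ ∈ latticeAlcove n m,
      (∃! ξ : V n, IsLatticeBetheVector n m (coupling g m) μ ξ) ∧
      latticeBetheVector n m (coupling g m) μ ∈ openAlcoveTwoPi n ∧
      LatticeBetheSystem n m (coupling g m) (latticeBetheVector n m (coupling g m) μ) ∧
      MemLp (staircaseWave n m g (latticeBetheVector n m (coupling g m) μ)) 2
        ((planeVolume n).restrict (chamber n))) ∧
    -- the Yang–Yang vectors are well defined, and the Lieb–Liniger functions are in `L²(A)`
    (∀ μ ∈ dominantWeights n,
      (∃! ξ : V n, IsYangYangVector n g μ ξ) ∧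
      yangYangVector n g μ ∈ chamber n ∧
      LiebLinigerBetheSystem n g (yangYangVector n g μ) ∧
      MemLp (liebLinigerWave n g (yangYangVector n g μ)) 2
        ((planeVolume n).restrict (alcove n))) ∧
    -- convergence of the inner products
    (∀ μ ∈ dominantWeights n, ∀ μ' ∈ dominantWeights n,
      Tendsto
        (fun m : ℕ => innerOn (chamber n)
          (staircaseWave n m g (latticeBetheVector n m (coupling g m) μ))
          (staircaseWave n m g (latticeBetheVector n m (coupling g m) μ')))
        atTop
        (𝓝 (innerOn (alcove n)
          (liebLinigerWave n g (yangYangVector n g μ))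
          (liebLinigerWave n g (yangYangVector n g μ'))))) ∧
    -- orthogonality of the Lieb–Liniger functions on the alcove
    (∀ μ ∈ dominantWeights n, ∀ μ' ∈ dominantWeights n, μ ≠ μ' →
      innerOn (alcove n)
        (liebLinigerWave n g (yangYangVector n g μ))
        (liebLinigerWave n g (yangYangVector n g μ')) = 0) ∧
    (∀ μ ∈ dominantWeights n, ∃ r : ℝ, 0 < r ∧
      innerOn (alcove n)
        (liebLinigerWave n g (yangYangVector n g μ))
        (liebLinigerWave n g (yangYangVector n g μ)) = (r : ℂ)) := by
  obtain ⟨N, rfl⟩ := Nat.exists_eq_add_of_le' hn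
  refine ⟨fun m hm μ hμ => latticeBethe_main hm hg hμ, fun μ hμ => yangYang_main hg hμ, ?_, ?_, ?_⟩
  · intro μ hμ μ' hμ'
    obtain ⟨k, rfl⟩ := mem_dominantWeights.1 hμ
    obtain ⟨k', rfl⟩ := mem_dominantWeights.1 hμ'
    exact tendsto_innerOn_betheVectors hg k k'
  · intro μ hμ μ' hμ' hne
    obtain ⟨k, rfl⟩ := mem_dominantWeights.1 hμ
    obtain ⟨k', rfl⟩ := mem_dominantWeights.1 hμ'
    exact innerOn_liebLinigerWave_eq_zero hg fun h => hne (by rw [h])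
  · intro μ hμ
    exact innerOn_liebLinigerWave_self (yangYang_main hg hμ).2.1
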